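/- Let $(V,\Omega)$ be a finite-dimensional complex symplectic vector space. For a basis $\{e_a\}$ of $V$ put $\Omega_{ab}=\Omega(e_a,e_b)$ and let $\Omega^{ab}$ be the inverse matrix, $\Omega_{ab}\Omega^{bc}=\delta_a^c$ (repeated indices are summed). There are bases for which the matrix $(\Omega_{ab})$ is unitary (for example Darboux bases). Let $\{e_a\}$ be any such basis. Let $\mathrm{Sb}[V]$ be the symplectic boson vertex operator algebra, freely generated by Grassmann-even fields $q^a(z)=\sum_n q^a_n z^{-n-1}$ with $q^a(z)q^b(w)\sim \Omega^{ab}/(z-w)$, i.e. $[q^a_n,q^b_m]=\Omega^{ab}\delta_{n+m+1,0}$, with stress tensor $T=\tfrac12\Omega_{ab}{:}q^b\partial q^a{:}$, so that $q^a$ has conformal weight $\tfrac12$. Equip it with * the bilinear form $(x,y)=\mathrm{Res}_z\, z^{-1}\langle 0|Y(e^{zL_1}(e^{i\pi}z^{-2})^{L_0}x,z^{-1})y$, where $\langle 0|$ is the linear functional that kills the positive weight spaces and sends $|0\rangle$ to $1$; * the $\mathbb Z_2$-grading $\mathrm{Sb}[V]^0\oplus \mathrm{Sb}[V]^{1/2}$,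 with parity operator $s$, and the filtration $\mathfrak R_{p+\alpha}\mathrm{Sb}[V]=\bigoplus_{p'\le p}\mathrm{Sb}[V]_{p'+\alpha}$ ($p,p'\in\mathbb Z$, $\alpha\in\{0,\tfrac12\}$), where $\mathrm{Sb}[V]_{\ell/2}$ is spanned by the products $q^{a_1}_{-n_1-1}\cdots q^{a_\ell}_{-n_\ell-1}|0\rangle$ with $n_i\ge 0$ (and is $0$ for $\ell<0$), and $\mathrm{Sb}[V]^{\alpha}=\bigoplus_{p\in\mathbb Z}\mathrm{Sb}[V]_{p+\alpha}$; * the antilinear map $\rho$ with $\rho\big(q^{a_1}_{-n_1-1}\cdots q^{a_\ell}_{-n_\ell-1}|0\rangle\big)=(-1)^\ell\,\Omega_{a_1b_1}\cdots\Omega_{a_\ell b_\ell}\,q^{b_1}_{-n_1-1}\cdots q^{b_\ell}_{-n_\ell-1}|0\rangle$; in particular $\rho(q^a)=-\Omega_{ab}q^b$. Then these data make $\mathrm{Sb}[V]$ a graded-unitary VOA. That is: 1. $\mathrm{Sb}[V]$ is a VOA (in particular a Möbius vertex algebra), and $(-,-)$ is a nondegenerate invariant bilinear form: $(Y(x,z)u,v)=(-1)^{|x||u|}(u,Y(e^{zL_1}(e^{i\pi}z^{-2})^{L_0}x,z^{-1})v)$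 and $(L_mu,v)=(u,L_{-m}v)$ for $m\in\{-1,0,1\}$. 2. $\mathfrak R_\bullet$ is a half-integral filtration: it is increasing and exhaustive, compatible with the gradings, $|0\rangle\in\mathfrak R_0$, and $x_ny\in\mathfrak R_{p+q}$ for $x\in\mathfrak R_p$, $y\in\mathfrak R_q$, $n\in\mathbb Z$. It is good: $x_ny\in\mathfrak R_{p+q-1}$ if moreover $n\ge0$. It is nondegenerate: the restriction of $(-,-)$ to each $\mathfrak R_p$ is nondegenerate. 3. Let $\sigma$ act as $i^{2p}$ on the orthogonal complement of $\mathfrak R_{p-1}$ in $\mathfrak R_p$. Then $\rho$ is a quaternionic structure: an antilinear bijection with $\rho(x_ny)=(-1)^{|x||y|}\rho(x)_n\rho(y)$ that preserves the vacuum, the conformal vector and each $\mathfrak R_p$, commutes with $\partial$ and $L_0,L_{\pm1}$, and satisfies $\rho\circ\rho=s$ and $\rho\circ\sigma=\sigma^{-1}\circ\rho$. 4. The form $\langle x|y\rangle=((\sigma\circ\rho)(x),y)$ is Hermitian and positive-definite. -/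

import Mathlib

open scoped VertexOperator ComplexConjugate

noncomputable section

namespace GradedUnitary

/-! ### Vertex superalgebras, Möbius vertex algebras, vertex operator algebras

For `A : VertexOperator ℂ W` the `n`-th mode, i.e. the coefficient of `z ^ (-n - 1)`, is `A[[n]]`.
Half-integral labels (conformal weights `h`, filtration degrees `p`) are stored doubled, as the
integers `2h`, `2p`. -/

/-- The data underlying a vertex superalgebra: vacuum, translation operator `∂`, state-field
correspondence and Grassmann parity. -/
structure VertexData (W : Type*) [AddCommGroup W] [Module ℂ W] where
  vac : W
  der : Module.End ℂ W
  Y : W →ₗ[ℂ] VertexOperator ℂ W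
  par : ZMod 2 → Submodule ℂ W

/-- The data underlying a Möbius vertex algebra: `wt d` is the space of conformal weight `d / 2`;
only `L (-1)`, `L 0`, `L 1` are relevant in the Möbius case. -/
structure MobiusData (W : Type*) [AddCommGroup W] [Module ℂ W] extends VertexData W where
  wt : ℤ → Submodule ℂ W
  L : ℤ → Module.End ℂ W

/-- The sign `(-1) ^ (|x| |y|)` for Grassmann parities `i = |x|` and `j = |y|`. -/
def koszulSign (i j : ZMod 2) : ℂ := if i = 1 ∧ j = 1 then -1 else 1

variable {W : Type*} [AddCommGroup W] [Module ℂ W]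

/-- The axioms of a vertex superalgebra. The field property is part of the type of `Y`. -/
structure IsVertexAlgebra (A : VertexData W) : Prop where
  par_internal : DirectSum.IsInternal A.par
  vac_par : A.vac ∈ A.par 0
  mode_par : ∀ i j : ZMod 2, ∀ x ∈ A.par i, ∀ y ∈ A.par j, ∀ n : ℤ,
    ((A.Y x)[[n]]) y ∈ A.par (i + j)
  vacuum : ∀ (n : ℤ) (y : W), ((A.Y A.vac)[[n]]) y = if n = -1 then y else 0
  creation : ∀ x : W, ((A.Y x)[[-1]]) A.vac = x
  creation_nonneg : ∀ (x : W) (n : ℤ), 0 ≤ n → ((A.Y x)[[n]]) A.vac = 0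
  der_vac : A.der A.vac = 0
  translation : ∀ (x : W) (n : ℤ) (y : W),
    A.der (((A.Y x)[[n]]) y) - ((A.Y x)[[n]]) (A.der y) = -(n : ℂ) • ((A.Y x)[[n - 1]]) y
  /-- `(z - w) ^ N x(z) y(w) = (-1) ^ (|x| |y|) (z - w) ^ N y(w) x(z)` for some `N`. -/
  locality : ∀ i j : ZMod 2, ∀ x ∈ A.par i, ∀ y ∈ A.par j, ∃ N : ℕ, ∀ (m n : ℤ) (v : W),
    ∑ k ∈ Finset.range (N + 1), ((-1 : ℂ) ^ k * (N.choose k : ℂ)) •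
        ((A.Y x)[[m + N - k]]) (((A.Y y)[[n + k]]) v) =
      koszulSign i j • ∑ k ∈ Finset.range (N + 1), ((-1 : ℂ) ^ k * (N.choose k : ℂ)) •
        ((A.Y y)[[n + k]]) (((A.Y x)[[m + N - k]]) v)

/-- The axioms of a Möbius vertex algebra. -/
structure IsMobius (M : MobiusData W) : Prop extends IsVertexAlgebra M.toVertexData where
  wt_internal : DirectSum.IsInternal M.wt
  wt_finite : ∀ d, FiniteDimensional ℂ (M.wt d)
  wt_bounded : ∃ N : ℤ, ∀ d < N, M.wt d = ⊥
  wt_par : ∀ d, M.wt d ≤ ⨆ i, M.wt d ⊓ M.par i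
  mode_wt : ∀ d e : ℤ, ∀ x ∈ M.wt d, ∀ y ∈ M.wt e, ∀ n : ℤ,
    ((M.Y x)[[n]]) y ∈ M.wt (d + e - 2 * n - 2)
  L_comm : ∀ m n : ℤ, |m| ≤ 1 → |n| ≤ 1 → ∀ y : W,
    M.L m (M.L n y) - M.L n (M.L m y) = ((m : ℂ) - n) • M.L (m + n) y
  L_vac : ∀ m : ℤ, |m| ≤ 1 → M.L m M.vac = 0
  L_neg_one : M.L (-1) = M.der
  L_zero : ∀ d : ℤ, ∀ x ∈ M.wt d, M.L 0 x = ((d : ℂ) / 2) • x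
  /-- `[L_m, Y(x, z)] = ∑ₙ (m+1 choose n) z ^ (m + 1 - n) Y(L_{n-1} x, z)`, mode by mode. -/
  L_covariance : ∀ m : ℤ, |m| ≤ 1 → ∀ (x : W) (k : ℤ) (y : W),
    M.L m (((M.Y x)[[k]]) y) - ((M.Y x)[[k]]) (M.L m y) =
      ∑ n ∈ Finset.range ((m + 1).toNat + 1), (((m + 1).toNat.choose n : ℕ) : ℂ) •
        ((M.Y (M.L ((n : ℤ) - 1) x))[[k + m + 1 - n]]) y

/-- A Möbius vertex algebra is a vertex operator algebra with conformal vector `ω` if the modes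
`L_m = ω_{m+1}` satisfy the Virasoro relations for some central charge and induce the given
Möbius structure. -/
structure IsVOA (M : MobiusData W) (ω : W) : Prop extends IsMobius M where
  conformal_par : ω ∈ M.par 0
  conformal_wt : ω ∈ M.wt 4
  L_eq : ∀ m : ℤ, |m| ≤ 1 → M.L m = ((M.Y ω)[[m + 1]])
  virasoro : ∃ c : ℂ, ∀ (m n : ℤ) (y : W),
    ((M.Y ω)[[m + 1]]) (((M.Y ω)[[n + 1]]) y) - ((M.Y ω)[[n + 1]]) (((M.Y ω)[[m + 1]]) y) =
      ((m : ℂ) - n) • ((M.Y ω)[[m + n + 1]]) y +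
        (if m + n = 0 then c / 12 * ((m : ℂ) ^ 3 - m) else 0) • y

/-! ### Invariant forms, filtrations, conjugations -/

/-- Invariance of a bilinear form:
`(Y(x, z) u, v) = (-1) ^ (|x| |u|) (u, Y(exp (z L₁) (exp (i π) z⁻²) ^ L₀ x, z⁻¹) v)`, mode by mode
for `x` of conformal weight `d / 2`, and `(L_m u, v) = (u, L_{-m} v)`. -/
structure IsInvariantForm (M : MobiusData W) (B : LinearMap.BilinForm ℂ W) : Prop where
  mode : ∀ (i j : ZMod 2) (d : ℤ), ∀ x ∈ M.wt d ⊓ M.par i, ∀ u ∈ M.par j, ∀ (n : ℤ) (v : W),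
    B (((M.Y x)[[n]]) u) v = koszulSign i j * Complex.I ^ d *
      ∑ᶠ k : ℕ, ((k.factorial : ℂ)⁻¹ * B u (((M.Y ((M.L 1 ^ k) x))[[d - n - 2 - k]]) v))
  mobius : ∀ m : ℤ, |m| ≤ 1 → ∀ u v : W, B (M.L m u) v = B u (M.L (-m) v)

/-- Nondegeneracy, on both sides, of the restriction of `B` to `S`. -/
def NondegenerateOn (B : LinearMap.BilinForm ℂ W) (S : Submodule ℂ W) : Prop :=
  (∀ x ∈ S, (∀ y ∈ S, B x y = 0) → x = 0) ∧ (∀ y ∈ S, (∀ x ∈ S, B x y = 0) → y = 0)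

/-- Half-integral filtrations: `F r` is the component of degree `r / 2`, and `z2 0`, `z2 1` are the
two summands `𝒱⁰`, `𝒱^{1/2}` of the `ℤ₂`-grading. -/
structure IsHalfIntegralFiltration (A : VertexData W) (z2 : ZMod 2 → Submodule ℂ W)
    (F : ℤ → Submodule ℂ W) : Prop where
  z2_internal : DirectSum.IsInternal z2
  z2_par : ∀ i, A.par i ≤ ⨆ α, A.par i ⊓ z2 α
  mode_z2 : ∀ α β : ZMod 2, ∀ x ∈ z2 α, ∀ y ∈ z2 β, ∀ n : ℤ, ((A.Y x)[[n]]) y ∈ z2 (α + β)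
  le_z2 : ∀ r : ℤ, F r ≤ z2 (r : ZMod 2)
  le_succ : ∀ r : ℤ, F r ≤ F (r + 2)
  exhaustive : ∀ α : ZMod 2, ∀ x ∈ z2 α, ∃ r : ℤ, (r : ZMod 2) = α ∧ x ∈ F r
  vac_mem : A.vac ∈ F 0
  mode_mem : ∀ r t : ℤ, ∀ x ∈ F r, ∀ y ∈ F t, ∀ n : ℤ, ((A.Y x)[[n]]) y ∈ F (r + t)

/-- Goodness: the nonnegative modes lower the filtration degree by one (doubled: by two). -/
def IsGoodFiltration (A : VertexData W) (F : ℤ → Submodule ℂ W) : Prop :=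
  ∀ r t : ℤ, ∀ x ∈ F r, ∀ y ∈ F t, ∀ n : ℤ, 0 ≤ n → ((A.Y x)[[n]]) y ∈ F (r + t - 2)

/-- Nondegeneracy of a filtration, which is compatible with the conformal weight grading. -/
structure IsNondegenerateFiltration (M : MobiusData W) (B : LinearMap.BilinForm ℂ W)
    (F : ℤ → Submodule ℂ W) : Prop where
  wt_compatible : ∀ r, F r ≤ ⨆ d, F r ⊓ M.wt d
  nondegenerate : ∀ r, NondegenerateOn B (F r)

/-- The grading refining a nondegenerate filtration: the component of degree `r / 2` is the
orthogonal complement of `F (r - 2)` in `F r`. -/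
def refinedGrading (B : LinearMap.BilinForm ℂ W) (F : ℤ → Submodule ℂ W) (r : ℤ) :
    Submodule ℂ W where
  carrier := {x | x ∈ F r ∧ ∀ y ∈ F (r - 2), B x y = 0}
  zero_mem' := by simp
  add_mem' {x x'} hx hx' :=
    ⟨(F r).add_mem hx.1 hx'.1, fun y hy => by simp [hx.2 y hy, hx'.2 y hy]⟩
  smul_mem' c x hx := ⟨(F r).smul_mem c hx.1, fun y hy => by simp [hx.2 y hy]⟩

open Classical in
/-- The operator `σ` acting as `i ^ r` on the component of degree `r / 2` of the refined grading
(with the value `0` if the refined components do not form a grading). -/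
def sigmaMap (B : LinearMap.BilinForm ℂ W) (F : ℤ → Submodule ℂ W) : Module.End ℂ W :=
  if h : DirectSum.IsInternal (refinedGrading B F) then
    DirectSum.toModule ℂ ℤ W
        (fun r => (Complex.I ^ r : ℂ) • (refinedGrading B F r).subtype) ∘ₗ
      (LinearEquiv.ofBijective (DirectSum.coeLinearMap (refinedGrading B F)) h).symm.toLinearMap
  else 0

/-- Conjugations of a Möbius vertex algebra with a half-integral filtration. -/
structure IsConjugation (M : MobiusData W) (F : ℤ → Submodule ℂ W)
    (ρ : W →ₛₗ[starRingEnd ℂ] W) : Prop where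
  bijective : Function.Bijective ρ
  der : ∀ x, ρ (M.der x) = M.der (ρ x)
  vac : ρ M.vac = M.vac
  mode : ∀ i j : ZMod 2, ∀ x ∈ M.par i, ∀ y ∈ M.par j, ∀ n : ℤ,
    ρ (((M.Y x)[[n]]) y) = koszulSign i j • ((M.Y (ρ x))[[n]]) (ρ y)
  mobius : ∀ m : ℤ, |m| ≤ 1 → ∀ x, M.L m (ρ x) = ρ (M.L m x)
  filtration : ∀ r, ∀ x ∈ F r, ρ x ∈ F r

/-- Quaternionic structures: conjugations with `ρ ∘ ρ = s`, where `s` is `1` on `z2 0` and `-1` on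
`z2 1`, and `ρ ∘ σ = σ⁻¹ ∘ ρ`. -/
structure IsQuaternionicStructure (M : MobiusData W) (B : LinearMap.BilinForm ℂ W)
    (z2 : ZMod 2 → Submodule ℂ W) (F : ℤ → Submodule ℂ W)
    (ρ : W →ₛₗ[starRingEnd ℂ] W) : Prop extends IsConjugation M F ρ where
  sq_even : ∀ x ∈ z2 0, ρ (ρ x) = x
  sq_odd : ∀ x ∈ z2 1, ρ (ρ x) = -x
  sigma_bijective : Function.Bijective (sigmaMap B F)
  sigma : ∀ x, sigmaMap B F (ρ (sigmaMap B F x)) = ρ x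

/-- Graded-unitary vertex algebras. -/
structure IsGradedUnitary (M : MobiusData W) (B : LinearMap.BilinForm ℂ W)
    (z2 : ZMod 2 → Submodule ℂ W) (F : ℤ → Submodule ℂ W)
    (ρ : W →ₛₗ[starRingEnd ℂ] W) : Prop where
  isMobius : IsMobius M
  z2_wt : ∀ d, M.wt d ≤ ⨆ α, M.wt d ⊓ z2 α
  invariant : IsInvariantForm M B
  form_nondegenerate : NondegenerateOn B ⊤
  filtration : IsHalfIntegralFiltration M.toVertexData z2 F
  filtration_nondegenerate : IsNondegenerateFiltration M B F
  filtration_good : IsGoodFiltration M.toVertexData F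
  quaternionic : IsQuaternionicStructure M B z2 F ρ
  hermitian : ∀ x y, B (sigmaMap B F (ρ x)) y = conj (B (sigmaMap B F (ρ y)) x)
  positive : ∀ x, x ≠ 0 → 0 < (B (sigmaMap B F (ρ x)) x).re

/-- Graded-unitary vertex operator algebras; here the conjugation also fixes `ω`. -/
structure IsGradedUnitaryVOA (M : MobiusData W) (ω : W) (B : LinearMap.BilinForm ℂ W)
    (z2 : ZMod 2 → Submodule ℂ W) (F : ℤ → Submodule ℂ W)
    (ρ : W →ₛₗ[starRingEnd ℂ] W) : Prop extends IsGradedUnitary M B z2 F ρ where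
  isVOA : IsVOA M ω
  conj_conformal : ρ ω = ω

/-! ### Normally ordered products -/

theorem mode_eventually_zero (A : VertexOperator ℂ W) (v : W) :
    ∃ N : ℕ, ∀ n : ℤ, (N : ℤ) ≤ n → (A[[n]]) v = 0 := by
  refine ⟨(-(HahnSeries.order ((HahnModule.of ℂ).symm (A v)))).toNat, fun n hn => ?_⟩
  apply VertexOperator.ncoeff_eq_zero_of_lt_order
  omega

/-- The `j`-th term of the `m`-th mode of the normally ordered product `:(∂ⁿA / n!) B:`. -/
def normalTerm (n : ℕ) (A B : VertexOperator ℂ W) (m : ℤ) (j : ℕ) : Module.End ℂ W :=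
  ((n + j).choose n : ℂ) •
    ((A[[-n - 1 - j]]) ∘ₗ (B[[m + j]]) + (-1 : ℂ) ^ n • ((B[[m - n - 1 - j]]) ∘ₗ (A[[j]])))

theorem normalTerm_eventually_zero (n : ℕ) (A B : VertexOperator ℂ W) (v : W) :
    ∃ N : ℕ, (∀ (m : ℤ) (j : ℕ), (N : ℤ) ≤ j → (N : ℤ) ≤ m + j → normalTerm n A B m j v = 0) ∧
      ∀ m : ℤ, (N : ℤ) ≤ m → ∀ j, normalTerm n A B m j v = 0 := by
  obtain ⟨N₁, h₁⟩ := mode_eventually_zero B v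
  obtain ⟨N₂, h₂⟩ := mode_eventually_zero A v
  choose K hK using fun j : ℕ => mode_eventually_zero B ((A[[(j : ℤ)]]) v)
  refine ⟨N₁ + N₂ + n + 1 + N₂ + ∑ j ∈ Finset.range N₂, K j, ?_, ?_⟩
  · intro m j hj hm
    push_cast at hj hm
    have hs : (0 : ℤ) ≤ ∑ j ∈ Finset.range N₂, (K j : ℤ) := by positivity
    simp [normalTerm, h₁ (m + j) (by omega), h₂ j (by omega)]
  · intro m hm j
    push_cast at hm
    have hs : (0 : ℤ) ≤ ∑ j ∈ Finset.range N₂, (K j : ℤ) := by positivity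
    have e₂ : (B[[m - n - 1 - j]]) ((A[[(j : ℤ)]]) v) = 0 := by
      by_cases hj : j < N₂
      · have := Finset.single_le_sum (f := fun j => (K j : ℤ)) (fun i _ => by positivity)
          (Finset.mem_range.2 hj)
        exact hK j _ (by omega)
      · rw [h₂ j (by omega), map_zero]
    simp [normalTerm, h₁ (m + j) (by omega), e₂]

theorem normalTerm_support_finite (n : ℕ) (A B : VertexOperator ℂ W) (m : ℤ) (v : W) :
    (Function.support fun j => normalTerm n A B m j v).Finite := by
  obtain ⟨N, hN, -⟩ := normalTerm_eventually_zero n A B v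
  refine (Set.finite_lt_nat (N + (N - m).toNat)).subset fun j hj => ?_
  by_contra h
  simp only [Set.mem_ofPred_eq, not_lt] at h
  exact hj (hN m j (by omega) (by omega))

/-- The `m`-th mode of the normally ordered product `:(∂ⁿA / n!) B:`. -/
def normalMode (n : ℕ) (A B : VertexOperator ℂ W) (m : ℤ) : Module.End ℂ W where
  toFun v := ∑ᶠ j : ℕ, normalTerm n A B m j v
  map_add' u v := by
    simp only [map_add]
    exact finsum_add_distrib (normalTerm_support_finite n A B m u)
      (normalTerm_support_finite n A B m v)
  map_smul' c v := by
    simp only [map_smul, RingHom.id_apply]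
    exact (smul_finsum' c (normalTerm_support_finite n A B m v)).symm

/-- The normally ordered product `:(∂ⁿA / n!) B:` of two fields, with modes
`∑_{j ≥ 0} (n+j choose n) (A_{-n-1-j} B_{m+j} + (-1)ⁿ B_{m-n-1-j} A_j)`. -/
def normalProduct (n : ℕ) (A B : VertexOperator ℂ W) : VertexOperator ℂ W :=
  VertexOperator.of_coeff (fun k => normalMode n A B (-k - 1)) fun v => by
    obtain ⟨N, -, hN⟩ := normalTerm_eventually_zero n A B v
    refine ⟨-N - 1, fun k hk => ?_⟩
    by_contra h
    refine hk ?_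
    simp [normalMode, hN (-k - 1) (by omega)]

/-- The identity field. -/
def idField : VertexOperator ℂ W :=
  VertexOperator.of_coeff (fun k => if k = 0 then LinearMap.id else 0) fun v => by
    refine ⟨0, fun k hk => ?_⟩
    by_contra h
    exact hk (by simp [show k ≠ 0 by omega])

end GradedUnitary

/-! ### Symplectic bosons

`Ω` is the matrix `Ω_{ab}` of the symplectic form in the chosen basis and `Ω⁻¹` is `Ω^{ab}`. -/

namespace Sb

open GradedUnitary

variable {ι : Type*}

/-- The Fock space: the variable `X (a, n)` is the creation operator `q^a_{-n-1}`, and a monomial in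
these variables is the corresponding product applied to the vacuum `1`. -/
abbrev Space (ι : Type*) : Type _ := MvPolynomial (ι × ℕ) ℂ

/-- The `ℤ₂`-grading: states with an even, resp. odd, number of generators. -/
def z2 (α : ZMod 2) : Submodule ℂ (Space ι) :=
  ⨆ (l : ℕ) (_ : (l : ZMod 2) = α), MvPolynomial.homogeneousSubmodule (ι × ℕ) ℂ l

/-- The `ℜ`-filtration: the component of degree `r / 2` is spanned by products of `l` generators
(each in degree `1 / 2`) with `l ≤ r` and `l` congruent to `r` modulo `2`. -/
def filtration (r : ℤ) : Submodule ℂ (Space ι) :=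
  ⨆ (l : ℕ) (_ : (l : ℤ) ≤ r ∧ (2 : ℤ) ∣ r - l), MvPolynomial.homogeneousSubmodule (ι × ℕ) ℂ l

/-- The translation operator, the derivation with `∂ q^a_{-n-1} = (n + 1) q^a_{-n-2}`. -/
def der : Module.End ℂ (Space ι) :=
  (MvPolynomial.mkDerivation ℂ fun p : ι × ℕ =>
    ((p.2 + 1 : ℕ) : ℂ) • (MvPolynomial.X (p.1, p.2 + 1) : Space ι)).toLinearMap

/-- The space of conformal weight `d / 2`; the generator `q^a_{-n-1}` contributes `n + 1/2`. -/
def wt (d : ℤ) : Submodule ℂ (Space ι) :=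
  MvPolynomial.weightedHomogeneousSubmodule ℂ (fun p : ι × ℕ => (2 * p.2 + 1 : ℤ)) d

variable [Fintype ι]

/-- The conjugation: the antilinear ring homomorphism with `ρ(q^a_{-n-1}) = -Ω_{ab} q^b_{-n-1}`. -/
def rho (Ω : Matrix ι ι ℂ) : Space ι →ₛₗ[starRingEnd ℂ] Space ι where
  toFun := MvPolynomial.eval₂Hom (MvPolynomial.C.comp (starRingEnd ℂ))
    fun p => -∑ b, MvPolynomial.C (Ω p.1 b) * MvPolynomial.X (b, p.2)
  map_add' := map_add _
  map_smul' c x := by simp [MvPolynomial.smul_eq_C_mul]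

variable [DecidableEq ι]

/-- The modes `q^a_k`: multiplication by `X (a, n)` for `k = -n-1 < 0`, and
`∑_b Ω^{ab} ∂/∂X(b, n)` for `k = n ≥ 0`, so that `[q^a_n, q^b_m] = Ω^{ab} δ_{n+m+1,0}`. -/
def q (Ω : Matrix ι ι ℂ) (a : ι) : ℤ → Module.End ℂ (Space ι)
  | Int.negSucc n => LinearMap.mulLeft ℂ (MvPolynomial.X (a, n))
  | Int.ofNat n => ∑ b, Ω⁻¹ a b • (MvPolynomial.pderiv (b, n)).toLinearMap

theorem q_eventually_zero (Ω : Matrix ι ι ℂ) (a : ι) (v : Space ι) :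
    ∃ N : ℕ, ∀ n : ℤ, (N : ℤ) ≤ n → q Ω a n v = 0 := by
  refine ⟨∑ p ∈ v.vars, (p.2 + 1), fun n hn => ?_⟩
  obtain ⟨m, rfl⟩ := Int.eq_ofNat_of_zero_le (le_trans (Int.natCast_nonneg _) hn)
  have hm : ∀ b, (b, m) ∉ v.vars := fun b hb => by
    have := Finset.single_le_sum (f := fun p : ι × ℕ => p.2 + 1) (fun _ _ => Nat.zero_le _) hb
    simp only at this
    omega
  change (∑ b, Ω⁻¹ a b • (MvPolynomial.pderiv (b, m)).toLinearMap) v = 0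
  simp [LinearMap.sum_apply, MvPolynomial.pderiv_eq_zero_of_notMem_vars (hm _)]

/-- The generating field `q^a(z)`. -/
def qField (Ω : Matrix ι ι ℂ) (a : ι) : VertexOperator ℂ (Space ι) :=
  VertexOperator.of_coeff (fun k => q Ω a (-k - 1)) fun v => by
    obtain ⟨N, hN⟩ := q_eventually_zero Ω a v
    refine ⟨-N - 1, fun k hk => ?_⟩
    by_contra h
    exact hk (hN _ (by omega))

/-- The nested normally ordered product of the fields `∂ⁿq^a(z) / n!` for `(a, n)` in a list. -/
def listField (Ω : Matrix ι ι ℂ) : List (ι × ℕ) → VertexOperator ℂ (Space ι)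
  | [] => idField
  | p :: l => normalProduct p.2 (qField Ω p.1) (listField Ω l)

/-- The state-field correspondence: the field of `q^{a₁}_{-n₁-1} ⋯ q^{aₗ}_{-nₗ-1}|0⟩` is the
normally ordered product of the `∂ⁿq^a(z) / n!` (the order of the factors is immaterial). -/
def Y (Ω : Matrix ι ι ℂ) : Space ι →ₗ[ℂ] VertexOperator ℂ (Space ι) :=
  (MvPolynomial.basisMonomials (ι × ℕ) ℂ).constr ℂ fun m =>
    listField Ω (Finsupp.toMultiset m).toList

/-- The conformal vector `½ Ω_{ab} q^b_{-1} q^a_{-2}|0⟩`, i.e. `T = ½ Ω_{ab} :q^b ∂q^a:`. -/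
def omega (Ω : Matrix ι ι ℂ) : Space ι :=
  ((1 : ℂ) / 2) • ∑ a, ∑ b, Ω a b • (MvPolynomial.X (b, 0) * MvPolynomial.X (a, 1))

/-- The symplectic boson vertex operator algebra; it is purely Grassmann-even. -/
def mobius (Ω : Matrix ι ι ℂ) : MobiusData (Space ι) where
  vac := 1
  der := der
  Y := Y Ω
  par i := if i = 0 then ⊤ else ⊥
  wt := wt
  L m := ((Y Ω (omega Ω))[[m + 1]])

/-- The canonical invariant form
`(x, y) = Res_z z⁻¹ ⟨0| Y(exp (z L₁) (exp (i π) z⁻²) ^ L₀ x, z⁻¹) y`. On a monomial `x` of conformal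
weight `d / 2` this is `i ^ d ∑ₖ (1 / k!) ⟨0| (L₁ᵏ x)_{d-1-k} y`, and `⟨0|` is the constant
coefficient; the terms with `k > d` vanish as `L₁ᵏ x` then has negative weight. -/
def form (Ω : Matrix ι ι ℂ) : LinearMap.BilinForm ℂ (Space ι) :=
  (MvPolynomial.basisMonomials (ι × ℕ) ℂ).constr ℂ fun m =>
    let d : ℕ := m.sum fun p e => e * (2 * p.2 + 1)
    (Complex.I ^ d : ℂ) • ∑ k ∈ Finset.range (d + 1), ((k.factorial : ℂ)⁻¹) •
      (MvPolynomial.lcoeff ℂ (0 : (ι × ℕ) →₀ ℕ) ∘ₗ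
        ((Y Ω (((mobius Ω).L 1 ^ k) (MvPolynomial.monomial m 1)))[[(d : ℤ) - 1 - k]]))

end Sb

end

open scoped VertexOperator ComplexConjugate

noncomputable section

/-! The state space is a polynomial ring: negative modes of q^a multiply by variables, nonnegative
modes are combinations of partial derivatives. Every state comes from the vacuum by applying ∂ and
multiplying by the lowest generators `X (a, 0)` (`space_induction_der`). The field of a product with
a generator is a normally ordered product (`mode_X_mul`), and the field of ∂x is the derivative of
the field of x (`mode_der`). Most statements about fields therefore follow by one induction, whose
only real input is the Heisenberg relations `q_comm`.

This induction gives the commutator formula `q_mode_comm` and, from it, `locality`. The generators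
are primary of weight 1/2 (`omega_q_comm`), which yields the covariance of all fields under L₋₁, L₀
and L₁. The full Virasoro relations need no computation with the field of ω: the defect of the
bracket commutes with all q^a_k, so it is a scalar by Schur's lemma, and the Jacobi identity fixes
the scalars.

For invariance, the operators `dagger` prescribed by the definition of the form satisfy the same
recursions as adjoints should. The central identity is (q^a_k x, y) = i (x, q^a_{-1-k} y), in
`form_q`; `form_mode` extends it to all fields.

For positivity, let R act as i^l on products of l generators. Then Rρ sends q^a_{-n-1} to -i Ω_{ab}
q^b_{-n-1}, and the adjoint of multiplication by this is -i · i Ω_{ab} Ω^{bc} ∂/∂X(c, n) = ∂/∂X(a,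
n). Hence (Rρ x, y) is the Fischer inner product: monomials are orthogonal, and the monomial with
exponent u has norm u! (`form_degreeRotation_rho_monomial`). This gives Hermitian symmetry,
positivity, nondegeneracy on every subspace stable under Rρ, and the identification of the refined
grading with the number of generators, so that R = σ. Unitarity and skewness of Ω give conj Ω_{ab} =
-Ω^{ab}, which makes ρ compatible with the Heisenberg relations and with ρ² = s. A basis with
unitary Gram matrix is found by splitting off hyperbolic planes. -/

namespace GradedUnitary

/-! ### Finitely supported sums over the natural numbers. -/

section FiniteSums

variable {M : Type*} [AddCommGroup M]

theorem hasFiniteSupport_of_forall_ge {f : ℕ → M} (N : ℕ) (h : ∀ j, N ≤ j → f j = 0) :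
    f.HasFiniteSupport :=
  (Set.finite_lt_nat N).subset fun j hj => by
    by_contra hc
    exact hj (h j (not_lt.1 hc))

theorem finsum_eq_sum_range {f : ℕ → M} (N : ℕ) (h : ∀ j, N ≤ j → f j = 0) :
    ∑ᶠ j, f j = ∑ j ∈ Finset.range N, f j :=
  finsum_eq_sum_of_support_subset _ fun j hj => by
    by_contra hc
    exact hj (h j (by simpa using hc))

theorem finsum_eq_zero_add {f : ℕ → M} (hf : f.HasFiniteSupport) :
    ∑ᶠ j, f j = f 0 + ∑ᶠ j, f (j + 1) := by
  obtain ⟨N, hN⟩ := (hf : (Function.support f).Finite).bddAbove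
  have h : ∀ j, N + 1 ≤ j → f j = 0 := fun j hj => by
    by_contra hc
    have := hN hc
    omega
  rw [finsum_eq_sum_range (N + 2) fun j hj => h j (by omega),
    finsum_eq_sum_range (N + 1) fun j hj => h (j + 1) (by omega), Finset.sum_range_succ']
  abel

end FiniteSums

/-! ### Normally ordered products and their reordering. -/

variable {W : Type*} [AddCommGroup W] [Module ℂ W]

theorem normalMode_apply (n : ℕ) (A B : VertexOperator ℂ W) (m : ℤ) (v : W) :
    normalMode n A B m v = ∑ᶠ j : ℕ, normalTerm n A B m j v := rfl

theorem ncoeff_normalProduct (n : ℕ) (A B : VertexOperator ℂ W) (m : ℤ) :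
    (normalProduct n A B)[[m]] = normalMode n A B m := by
  simp [normalProduct]

theorem ncoeff_idField (m : ℤ) (v : W) :
    ((idField : VertexOperator ℂ W)[[m]]) v = if m = -1 then v else 0 := by
  have h : (idField : VertexOperator ℂ W)[[m]] = if -m - 1 = 0 then LinearMap.id else 0 :=
    VertexOperator.ncoeff_of_coeff _ _ m
  rw [h]
  by_cases h : m = -1
  · simp [h]
  · rw [if_neg h, if_neg (by omega), LinearMap.zero_apply]

theorem normalMode_eq_sum (n : ℕ) (A B : VertexOperator ℂ W) (m : ℤ) (v : W) (N : ℕ)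
    (hA : ∀ j : ℕ, N ≤ j → (A[[(j : ℤ)]]) v = 0)
    (hB : ∀ j : ℕ, N ≤ j → (B[[m + j]]) v = 0) :
    normalMode n A B m v = ∑ j ∈ Finset.range N, normalTerm n A B m j v :=
  finsum_eq_sum_range N fun j hj => by simp [normalTerm, hA j hj, hB j hj]

/-- Nested normally ordered products of free fields may be reordered. -/
theorem normalProduct_left_comm (n n' : ℕ) (A A' C : VertexOperator ℂ W)
    (hneg : ∀ (i j : ℕ) (v : W), (A[[-i - 1]]) ((A'[[-j - 1]]) v) = (A'[[-j - 1]]) ((A[[-i - 1]]) v))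
    (hpos : ∀ (i j : ℕ) (v : W), (A[[(i : ℤ)]]) ((A'[[(j : ℤ)]]) v) = (A'[[(j : ℤ)]]) ((A[[(i : ℤ)]]) v)) :
    normalProduct n A (normalProduct n' A' C) = normalProduct n' A' (normalProduct n A C) := by
  -- Full expansion into words with creators on the left and annihilators on the right. Both
  -- nestings give the same words, so only creators among themselves and annihilators among
  -- themselves need commuting. The square range valid for all large `N` permits a common cutoff and
  -- an exchange of the sums.
  have key : ∀ (n n' : ℕ) (A A' C : VertexOperator ℂ W) (m : ℤ) (v : W),
      (∀ (i j : ℕ) (v : W),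
        (A[[(i : ℤ)]]) ((A'[[(j : ℤ)]]) v) = (A'[[(j : ℤ)]]) ((A[[(i : ℤ)]]) v)) →
      ∃ N₀ : ℕ, ∀ N, N₀ ≤ N → normalMode n A (normalProduct n' A' C) m v =
        ∑ j ∈ Finset.range N, ∑ i ∈ Finset.range N, (((n + j).choose n : ℂ) * ((n' + i).choose n' : ℂ)) •
          ((A[[-n - 1 - j]]) ((A'[[-n' - 1 - i]]) ((C[[m + j + i]]) v)) +
          (-1 : ℂ) ^ n' • (A[[-n - 1 - j]]) ((C[[m + j - n' - 1 - i]]) ((A'[[(i : ℤ)]]) v)) +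
          (-1 : ℂ) ^ n • (A'[[-n' - 1 - i]]) ((C[[m - n - 1 - j + i]]) ((A[[(j : ℤ)]]) v)) +
          ((-1 : ℂ) ^ n * (-1 : ℂ) ^ n') •
            (C[[m - n - 1 - j - n' - 1 - i]]) ((A'[[(i : ℤ)]]) ((A[[(j : ℤ)]]) v))) := by
    intro n n' A A' C m v hpos
    obtain ⟨J, hJ⟩ := mode_eventually_zero A v
    obtain ⟨I, hI⟩ := mode_eventually_zero A' v
    obtain ⟨K, hK⟩ := mode_eventually_zero C v
    choose P hP using fun j : ℕ => mode_eventually_zero C ((A[[(j : ℤ)]]) v)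
    obtain ⟨D, hD⟩ := mode_eventually_zero (normalProduct n' A' C) v
    refine ⟨J + I + K + m.natAbs + D + ∑ j ∈ Finset.range J, (P j + n + 1 + j), fun N hN => ?_⟩
    have hPN : ∀ j : ℕ, j < J → P j + n + 1 + j + m.natAbs ≤ N := fun j hj => by
      have := Finset.single_le_sum (f := fun j => P j + n + 1 + j) (fun i _ => by positivity)
        (Finset.mem_range.2 hj)
      omega
    rw [normalMode_eq_sum n A _ m v N (fun j hj => hJ _ (by omega)) fun j hj => hD _ (by omega)]
    refine Finset.sum_congr rfl fun j _ => ?_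
    have h₁ : normalMode n' A' C (m + j) v = ∑ i ∈ Finset.range N, normalTerm n' A' C (m + j) i v :=
      normalMode_eq_sum n' A' C (m + j) v N (fun i hi => hI _ (by omega)) fun i hi => hK _ (by omega)
    have h₂ : normalMode n' A' C (m - n - 1 - j) ((A[[(j : ℤ)]]) v) =
        ∑ i ∈ Finset.range N, normalTerm n' A' C (m - n - 1 - j) i ((A[[(j : ℤ)]]) v) := by
      -- The cutoff for `C` depends on the vector `A_j v`, but only finitely many of these vectors
      -- are nonzero.
      by_cases hj : j < J
      · refine normalMode_eq_sum n' A' C _ _ N (fun i hi => ?_) fun i hi => hP j _ ?_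
        · rw [← hpos, hI _ (by omega), map_zero]
        · have := hPN j hj
          omega
      · simp [hJ j (by omega)]
    simp only [normalTerm, ncoeff_normalProduct, LinearMap.smul_apply, LinearMap.add_apply,
      LinearMap.comp_apply] at h₁ h₂ ⊢
    rw [h₁, h₂, map_sum, Finset.smul_sum, ← Finset.sum_add_distrib, Finset.smul_sum]
    refine Finset.sum_congr rfl fun i _ => ?_
    simp only [map_smul, map_add, smul_add, smul_smul]
    module
  apply VertexOperator.ext
  intro v
  apply (HahnModule.of ℂ).symm.injective
  ext k
  obtain ⟨N₁, h₁⟩ := key n n' A A' C (-k - 1) v hpos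
  obtain ⟨N₂, h₂⟩ := key n' n A' A C (-k - 1) v fun i j v => (hpos j i v).symm
  have e : ∀ D : VertexOperator ℂ W,
      ((HahnModule.of ℂ).symm (D v)).coeff k = (D[[-k - 1]]) v := fun D => by
    rw [← VertexOperator.coeff_eq_ncoeff]
    rfl
  rw [e, e, ncoeff_normalProduct, ncoeff_normalProduct, h₁ (max N₁ N₂) (le_max_left _ _),
    h₂ (max N₁ N₂) (le_max_right _ _), Finset.sum_comm]
  refine Finset.sum_congr rfl fun i _ => Finset.sum_congr rfl fun j _ => ?_
  have c₁ := hneg (n + j) (n' + i) ((C[[-k - 1 + i + j]]) v)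
  rw [show (-((n + j : ℕ) : ℤ) - 1) = -n - 1 - j by push_cast; ring,
    show (-((n' + i : ℕ) : ℤ) - 1) = -n' - 1 - i by push_cast; ring] at c₁
  rw [show (-k - 1 + j + i : ℤ) = -k - 1 + i + j by ring, c₁,
    show (-k - 1 + j - n' - 1 - i : ℤ) = -k - 1 - n' - 1 - i + j by ring,
    show (-k - 1 - n - 1 - j + i : ℤ) = -k - 1 + i - n - 1 - j by ring, hpos j i,
    show (-k - 1 - n - 1 - j - n' - 1 - i : ℤ) = -k - 1 - n' - 1 - i - n - 1 - j by ring]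
  module

end GradedUnitary

namespace GradedUnitary

variable {W : Type*} [AddCommGroup W] [Module ℂ W]

theorem normalMode_add (n : ℕ) (A B C : VertexOperator ℂ W) (m : ℤ) :
    normalMode n A (B + C) m = normalMode n A B m + normalMode n A C m := by
  ext v
  simp only [normalMode_apply, LinearMap.add_apply]
  rw [← finsum_add_distrib (normalTerm_support_finite n A B m v)
    (normalTerm_support_finite n A C m v)]
  refine finsum_congr fun j => ?_
  simp [normalTerm]
  module

theorem normalMode_smul (n : ℕ) (A B : VertexOperator ℂ W) (c : ℂ) (m : ℤ) :
    normalMode n A (c • B) m = c • normalMode n A B m := by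
  ext v
  simp only [normalMode_apply, LinearMap.smul_apply]
  rw [smul_finsum]
  refine finsum_congr fun j => ?_
  simp [normalTerm]
  module

end GradedUnitary

/-! ### Induction principles on the Fock space and the Heisenberg relations. -/

namespace Sb

open GradedUnitary MvPolynomial

theorem monomial_eq_smul {σ : Type*} (u : σ →₀ ℕ) (c : ℂ) :
    (monomial u c : MvPolynomial σ ℂ) = c • monomial u 1 := by simp [smul_monomial]

/-- A derivation which is homogeneous on the variables is homogeneous. -/
theorem isWeightedHomogeneous_of_leibniz {σ M : Type*} [AddCommMonoid M] {w : σ → M}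
    {D : Module.End ℂ (MvPolynomial σ ℂ)} {c : M} (one : D 1 = 0)
    (mul : ∀ x y, D (x * y) = D x * y + x * D y)
    (X_mem : ∀ p, IsWeightedHomogeneous w (D (X p)) (w p + c)) {x : MvPolynomial σ ℂ} {n : M}
    (hx : IsWeightedHomogeneous w x n) : IsWeightedHomogeneous w (D x) (n + c) := by
  -- The weight is left existential during the induction; a nonzero monomial has only one weight,
  -- which identifies it with `n` at the end.
  have key : ∀ (u : σ →₀ ℕ) (a : ℂ), ∃ k, IsWeightedHomogeneous w (monomial u a) k ∧
      IsWeightedHomogeneous w (D (monomial u a)) (k + c) := by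
    refine induction_on_monomial (fun a => ⟨0, isWeightedHomogeneous_C _ _, ?_⟩) ?_
    · rw [← mul_one (C a), ← smul_eq_C_mul, map_smul, one, smul_zero]
      exact isWeightedHomogeneous_zero _ _ _
    · rintro x p ⟨k, h₁, h₂⟩
      refine ⟨k + w p, h₁.mul (isWeightedHomogeneous_X _ _ _), ?_⟩
      rw [mul]
      refine IsWeightedHomogeneous.add ?_ ?_
      · rw [add_right_comm]
        exact h₂.mul (isWeightedHomogeneous_X _ _ _)
      · rw [add_assoc]
        exact h₁.mul (X_mem p)
  rw [x.as_sum, map_sum]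
  refine IsWeightedHomogeneous.sum _ _ _ fun u hu => ?_
  obtain ⟨k, h₁, h₂⟩ := key u (coeff u x)
  have h₃ : IsWeightedHomogeneous w (monomial u (coeff u x)) n :=
    isWeightedHomogeneous_monomial _ _ _ (hx (mem_support_iff.1 hu))
  rwa [h₁.inj_right (by simpa using hu) h₃] at h₂

variable {ι : Type*}

theorem der_one : der (1 : Space ι) = 0 := by simp [der]

theorem der_mul (x y : Space ι) : der (x * y) = der x * y + x * der y := by
  simp only [der, Derivation.coeFn_coe, Derivation.leibniz, smul_eq_mul]
  ring

theorem der_X (a : ι) (n : ℕ) : der (X (a, n) : Space ι) = ((n : ℂ) + 1) • X (a, n + 1) := by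
  simp [der, mkDerivation_X]

/-- Induction along products with generators. -/
theorem space_induction {P : Space ι → Prop} (one : P 1) (add : ∀ x y, P x → P y → P (x + y))
    (smul : ∀ (c : ℂ) x, P x → P (c • x)) (X_mul : ∀ a n x, P x → P (X (a, n) * x))
    (x : Space ι) : P x := by
  induction x using MvPolynomial.induction_on with
  | C a =>
    have := smul a 1 one
    rwa [smul_eq_C_mul, mul_one] at this
  | add p q hp hq => exact add p q hp hq
  | mul_X p i hp =>
    rw [mul_comm]
    exact X_mul _ _ p hp

/-- Induction along derivatives and products with the generators of lowest weight. -/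
theorem space_induction_der {P : Space ι → Prop} (one : P 1)
    (add : ∀ x y, P x → P y → P (x + y)) (smul : ∀ (c : ℂ) x, P x → P (c • x))
    (der : ∀ x, P x → P (der x)) (X_mul : ∀ a x, P x → P (X (a, 0) * x)) (x : Space ι) : P x := by
  -- Induction on the number of generators, with an inner induction on the mode index of the
  -- generator split off.
  have key : ∀ (l : ℕ) (u : ι × ℕ →₀ ℕ), u.degree = l → P (monomial u 1) := by
    intro l
    induction l with
    | zero =>
      intro u hu
      rw [(Finsupp.degree_eq_zero_iff u).1 hu]
      exact one
    | succ l ih =>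
      have hall : ∀ x : Space ι, x ∈ homogeneousSubmodule (ι × ℕ) ℂ l → P x := by
        intro x hx
        rw [x.as_sum]
        refine Finset.sum_induction _ P add (by simpa using smul 0 1 one) fun u hu => ?_
        rw [monomial_eq_smul]
        exact smul _ _ (ih u (by rw [Finsupp.degree_eq_weight_one]; exact hx (mem_support_iff.1 hu)))
      have hX : ∀ (n : ℕ) (a : ι) (x : Space ι), x ∈ homogeneousSubmodule (ι × ℕ) ℂ l →
          P (X (a, n) * x) := by
        intro n
        induction n with
        | zero => exact fun a x hx => X_mul a x (hall x hx)
        | succ n ihn =>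
          intro a x hx
          -- The Leibniz rule trades `X (a, n + 1)` for ∂ and `X (a, n)`. The derivative `der x`
          -- still has `l` generators, so the inner hypothesis applies to it.
          have e : (X (a, n + 1) * x : Space ι) = ((n : ℂ) + 1)⁻¹ •
              (Sb.der (X (a, n) * x) + (-1 : ℂ) • (X (a, n) * Sb.der x)) := by
            rw [der_mul, der_X, smul_mul_assoc, neg_one_smul, add_neg_cancel_right, smul_smul,
              inv_mul_cancel₀ (Nat.cast_add_one_ne_zero n), one_smul]
          rw [e]
          refine smul _ _ (add _ _ (der _ (ihn a x hx)) (smul _ _ (ihn a _ ?_)))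
          exact isWeightedHomogeneous_of_leibniz (c := 0) der_one der_mul (fun p => by
            rw [der_X, smul_eq_C_mul, add_zero]
            exact (isWeightedHomogeneous_X ℂ _ _).C_mul _) hx
      intro u hu
      obtain ⟨p, hp⟩ : ∃ p, u p ≠ 0 := by
        by_contra! h
        rw [show u = 0 from Finsupp.ext h] at hu
        simp at hu
      have hle : Finsupp.single p 1 ≤ u := by
        rw [Finsupp.single_le_iff]
        omega
      have e : (monomial u 1 : Space ι) = X (p.1, p.2) * monomial (u - Finsupp.single p 1) 1 := by
        rw [X, monomial_mul, mul_one, add_tsub_cancel_of_le hle]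
      rw [e]
      refine hX _ _ _ (isHomogeneous_monomial _ ?_)
      have := congrArg Finsupp.degree (add_tsub_cancel_of_le hle)
      rw [map_add, Finsupp.degree_single, hu] at this
      omega
  induction x using MvPolynomial.induction_on' with
  | monomial u c =>
    rw [monomial_eq_smul]
    exact smul _ _ (key _ u rfl)
  | add p q hp hq => exact add p q hp hq

variable [Fintype ι] [DecidableEq ι] (Ω : Matrix ι ι ℂ)

theorem q_creation (a : ι) (n : ℕ) (v : Space ι) : q Ω a (-n - 1) v = X (a, n) * v := by
  rw [show (-n - 1 : ℤ) = Int.negSucc n by omega]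
  rfl

theorem q_annihilation (a : ι) (n : ℕ) (v : Space ι) :
    q Ω a n v = ∑ b, Ω⁻¹ a b • pderiv (b, n) v := by
  change (∑ b, Ω⁻¹ a b • (pderiv (b, n)).toLinearMap) v = _
  simp [LinearMap.sum_apply]

theorem ncoeff_qField (a : ι) (k : ℤ) : (qField Ω a)[[k]] = q Ω a k := by
  have h : (qField Ω a)[[k]] = q Ω a (-(-k - 1) - 1) := VertexOperator.ncoeff_of_coeff _ _ k
  rw [h]
  congr 1
  ring

theorem q_annihilation_mul (a : ι) (n : ℕ) (v w : Space ι) :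
    q Ω a n (v * w) = q Ω a n v * w + v * q Ω a n w := by
  simp only [q_annihilation, Derivation.leibniz, Finset.sum_mul, Finset.mul_sum,
    ← Finset.sum_add_distrib]
  refine Finset.sum_congr rfl fun b _ => ?_
  simp only [smul_eq_mul, smul_add, mul_smul_comm, smul_mul_assoc]
  rw [add_comm, mul_comm w]

theorem q_annihilation_X (a b : ι) (n k : ℕ) :
    q Ω a n (X (b, k)) = if n = k then C (Ω⁻¹ a b) else 0 := by
  rw [q_annihilation]
  by_cases h : n = k
  · subst h
    rw [if_pos rfl, Finset.sum_eq_single b]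
    · simp [smul_eq_C_mul]
    · intro c _ hc
      rw [pderiv_X_of_ne (by simpa using hc.symm), smul_zero]
    · simp
  · rw [if_neg h]
    refine Finset.sum_eq_zero fun c _ => ?_
    rw [pderiv_X_of_ne (by simp only [ne_eq, Prod.mk.injEq, not_and]; exact fun _ => Ne.symm h), smul_zero]

theorem q_annihilation_one (a : ι) (n : ℕ) : q Ω a n 1 = 0 := by
  simp [q_annihilation]

/-- The commutator of two derivations is a derivation, and this one vanishes on the variables. -/
theorem pderiv_comm {σ : Type*} (i j : σ) (v : MvPolynomial σ ℂ) :
    pderiv i (pderiv j v) = pderiv j (pderiv i v) := by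
  classical
  have h : ⁅(pderiv i : Derivation ℂ (MvPolynomial σ ℂ) (MvPolynomial σ ℂ)),
      (pderiv j : Derivation ℂ (MvPolynomial σ ℂ) (MvPolynomial σ ℂ))⁆ = 0 := by
    refine derivation_ext fun p => ?_
    simp only [Derivation.commutator_apply, pderiv_X, Pi.single_apply]
    split_ifs <;> simp
  have := congrArg (fun D => D v) h
  simp only [Derivation.commutator_apply, Derivation.zero_apply] at this
  rw [← sub_eq_zero, this]

theorem q_annihilation_comm (a b : ι) (i j : ℕ) (v : Space ι) :
    q Ω a i (q Ω b j v) = q Ω b j (q Ω a i v) := by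
  have h : ∀ (a b : ι) (i j : ℕ), q Ω a i (q Ω b j v) =
      ∑ d, ∑ c, Ω⁻¹ b d • Ω⁻¹ a c • pderiv (c, i) (pderiv (d, j) v) := fun a b i j => by
    simp only [q_annihilation, map_sum, map_smul, Finset.smul_sum]
  rw [h, h, Finset.sum_comm]
  refine Finset.sum_congr rfl fun c _ => Finset.sum_congr rfl fun d _ => ?_
  rw [smul_comm, pderiv_comm]

/-- The Heisenberg relations. -/
theorem q_comm (hA : ∀ a b, Ω⁻¹ b a = -Ω⁻¹ a b) (a b : ι) (m n : ℤ) (v : Space ι) :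
    q Ω a m (q Ω b n v) - q Ω b n (q Ω a m v) = if m + n + 1 = 0 then Ω⁻¹ a b • v else 0 := by
  have key : ∀ (a b : ι) (i j : ℕ), q Ω a i (q Ω b (-j - 1) v) - q Ω b (-j - 1) (q Ω a i v) =
      if i = j then Ω⁻¹ a b • v else 0 := fun a b i j => by
    rw [q_creation, q_creation, q_annihilation_mul, q_annihilation_X]
    split_ifs <;> simp [smul_eq_C_mul]
  have hm : (∃ i : ℕ, m = i) ∨ ∃ i : ℕ, m = -i - 1 := by
    obtain h | h := le_or_gt 0 m
    · exact Or.inl ⟨m.toNat, by omega⟩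
    · exact Or.inr ⟨(-m - 1).toNat, by omega⟩
  have hn : (∃ i : ℕ, n = i) ∨ ∃ i : ℕ, n = -i - 1 := by
    obtain h | h := le_or_gt 0 n
    · exact Or.inl ⟨n.toNat, by omega⟩
    · exact Or.inr ⟨(-n - 1).toNat, by omega⟩
  obtain ⟨i, rfl⟩ | ⟨i, rfl⟩ := hm <;> obtain ⟨j, rfl⟩ | ⟨j, rfl⟩ := hn
  · rw [q_annihilation_comm, sub_self, if_neg (by omega)]
  · rw [key]
    congr 1
    simp only [eq_iff_iff]
    omega
  · rw [← neg_sub, key, hA a b]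
    split_ifs <;> first | omega | simp
  · rw [if_neg (by omega)]
    simp only [q_creation]
    ring

/-- The modes of the fields of the symplectic boson vertex algebra, linear in the state. -/
def mode : Space ι →ₗ[ℂ] ℤ → Module.End ℂ (Space ι) := VertexOperator.ncoeff ∘ₗ Y Ω

theorem mode_def (x : Space ι) (n : ℤ) : (Y Ω x)[[n]] = mode Ω x n := rfl

/-- `Y` is defined through an arbitrary ordering of the factors of a monomial. Independence of that
ordering allows any chosen factor to be placed first. -/
theorem listField_perm {l l' : List (ι × ℕ)} (h : l.Perm l') : listField Ω l = listField Ω l' := by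
  induction h with
  | nil => rfl
  | cons p _ ih => simp only [listField, ih]
  | swap p p' l =>
    refine normalProduct_left_comm _ _ _ _ _ (fun i j v => ?_) fun i j v => ?_
    · simp only [ncoeff_qField, q_creation]
      ring
    · simp only [ncoeff_qField, q_annihilation_comm]
  | trans _ _ ih₁ ih₂ => exact ih₁.trans ih₂

theorem Y_monomial (u : ι × ℕ →₀ ℕ) :
    Y Ω (monomial u 1) = listField Ω (Finsupp.toMultiset u).toList := by
  have := (basisMonomials (ι × ℕ) ℂ).constr_basis ℂ
    (fun m => listField Ω (Finsupp.toMultiset m).toList) u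
  rwa [coe_basisMonomials] at this

theorem mode_one (m : ℤ) (v : Space ι) : mode Ω 1 m v = if m = -1 then v else 0 := by
  rw [← mode_def, ← ncoeff_idField, show (1 : Space ι) = monomial 0 1 from rfl, Y_monomial]
  simp [listField]

theorem mode_X_mul_eq_normalMode (a : ι) (n : ℕ) (x : Space ι) (m : ℤ) :
    mode Ω (X (a, n) * x) m = normalMode n (qField Ω a) (Y Ω x) m := by
  induction x using MvPolynomial.induction_on' with
  | monomial u c =>
    rw [monomial_eq_smul, mul_smul_comm, map_smul, map_smul, normalMode_smul, Pi.smul_apply]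
    congr 1
    rw [mul_comm, X, monomial_mul, mul_one, ← mode_def, ← ncoeff_normalProduct, Y_monomial,
      Y_monomial]
    refine congrArg (VertexOperator.ncoeff · m) ?_
    refine listField_perm Ω (l' := (a, n) :: (Finsupp.toMultiset u).toList) ?_
    rw [← Multiset.coe_eq_coe, Multiset.coe_toList, ← Multiset.cons_coe, Multiset.coe_toList,
      map_add, Finsupp.toMultiset_single, one_smul, add_comm, Multiset.singleton_add]
  | add p q hp hq => rw [mul_add, map_add, map_add, normalMode_add, Pi.add_apply, hp, hq]

theorem mode_eventually_zero (x v : Space ι) : ∃ N : ℕ, ∀ n : ℤ, (N : ℤ) ≤ n → mode Ω x n v = 0 :=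
  GradedUnitary.mode_eventually_zero (Y Ω x) v

/-- The field of `q^a_{-n-1} x` is the normally ordered product of `∂ⁿq^a / n!` and the field
of `x`. -/
theorem mode_X_mul (a : ι) (n : ℕ) (x : Space ι) (m : ℤ) (v : Space ι) :
    mode Ω (X (a, n) * x) m v = ∑ᶠ j : ℕ, ((n + j).choose n : ℂ) •
      (q Ω a (-n - 1 - j) (mode Ω x (m + j) v) +
        (-1 : ℂ) ^ n • mode Ω x (m - n - 1 - j) (q Ω a j v)) := by
  rw [mode_X_mul_eq_normalMode, normalMode_apply]
  simp only [normalTerm, ncoeff_qField, mode_def]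
  rfl

end Sb

/-! ### Derivatives of fields and commutators with the generating fields. -/

namespace GradedUnitary

/-- A uniform bound is needed for one index only. In the applications it comes from `q^a_j y = 0`
for large `j`, while the bound in the other index may depend on `j`. -/
theorem finsum_comm_of_forall_ge {M : Type*} [AddCommGroup M] {f : ℕ → ℕ → M} (J : ℕ)
    (hJ : ∀ i j, J ≤ j → f i j = 0) (hf : ∀ j, Function.HasFiniteSupport fun i => f i j) :
    ∑ᶠ i, ∑ᶠ j, f i j = ∑ᶠ j, ∑ᶠ i, f i j := by
  have h : ∀ j, J ≤ j → ∑ᶠ i, f i j = 0 := fun j hj => by simp [hJ _ j hj]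
  rw [finsum_eq_sum_range J h, ← finsum_sum_comm _ _ fun j _ => hf j]
  exact finsum_congr fun i => finsum_eq_sum_range J fun j hj => hJ i j hj

end GradedUnitary

namespace Sb

open GradedUnitary MvPolynomial

theorem succ_mul_choose_succ (r : ℂ) (j : ℕ) :
    ((j : ℂ) + 1) * Ring.choose r (j + 1) = (r - j) * Ring.choose r j := by
  have := Ring.choose_smul_choose r (Nat.le_succ j)
  simp only [Nat.succ_eq_add_one, Nat.choose_succ_self_right, Nat.add_sub_cancel_left,
    Ring.choose_one_right, nsmul_eq_mul] at this
  push_cast at this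
  rw [this, mul_comm]

variable {ι : Type*} [Fintype ι] [DecidableEq ι] (Ω : Matrix ι ι ℂ)

theorem int_cases (k : ℤ) : (∃ n : ℕ, k = n) ∨ ∃ n : ℕ, k = -n - 1 := by
  obtain h | h := le_or_gt 0 k
  · exact Or.inl ⟨k.toNat, by omega⟩
  · exact Or.inr ⟨(-k - 1).toNat, by omega⟩

/-- For nonnegative `k` both operators are derivations, hence so is their commutator, and it is
determined by the generators. For negative `k` this is the Leibniz rule for a product with a
generator. -/
theorem der_q (a : ι) (k : ℤ) (v : Space ι) :
    der (q Ω a k v) - q Ω a k (der v) = -(k : ℂ) • q Ω a (k - 1) v := by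
  obtain ⟨n, rfl⟩ | ⟨n, rfl⟩ := int_cases k
  · have hC : ∀ (b : ι) (i : ℕ), der (q Ω a n (X (b, i))) = 0 := fun b i => by
      rw [q_annihilation_X]
      split_ifs
      · rw [← mul_one (C _), ← smul_eq_C_mul, map_smul, der_one, smul_zero]
      · exact map_zero _
    -- For `k = 0` the mode `q_{-1}` on the right is not a derivation, but its coefficient is zero.
    obtain _ | n := n
    · induction v using space_induction with
      | one => rw [der_one, q_annihilation_one]; simp
      | add x y hx hy =>
        simp only [Nat.cast_zero, Int.cast_zero, neg_zero, zero_smul, map_add] at hx hy ⊢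
        linear_combination hx + hy
      | smul c x hx =>
        simp only [Nat.cast_zero, Int.cast_zero, neg_zero, zero_smul, map_smul] at hx ⊢
        rw [← smul_sub, hx, smul_zero]
      | X_mul b i x hx =>
        have h₁ := hC b i
        have h₂ : q Ω a (0 : ℕ) (der (X (b, i))) = 0 := by
          rw [der_X, map_smul, q_annihilation_X, if_neg (by omega), smul_zero]
        simp only [q_annihilation_mul, der_mul, map_add, h₁, h₂]
        simp only [Nat.cast_zero, Int.cast_zero, neg_zero, zero_smul] at hx ⊢
        linear_combination X (b, i) * hx
    · rw [show (((n + 1 : ℕ) : ℤ) - 1) = (n : ℤ) by push_cast; ring]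
      induction v using space_induction with
      | one => simp only [der_one, q_annihilation_one, map_zero, smul_zero, sub_zero]
      | add x y hx hy =>
        simp only [map_add, smul_add] at hx hy ⊢
        linear_combination hx + hy
      | smul c x hx =>
        simp only [map_smul]
        rw [← smul_sub, hx, smul_comm]
      | X_mul b i x hx =>
        have h₁ := hC b i
        have h₂ : q Ω a ((n + 1 : ℕ) : ℤ) (der (X (b, i))) = ((n : ℂ) + 1) • q Ω a n (X (b, i)) := by
          rw [der_X, map_smul, q_annihilation_X, q_annihilation_X]
          by_cases h : n = i
          · subst h
            simp
          · rw [if_neg (by omega), if_neg h, smul_zero, smul_zero]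
        simp only [q_annihilation_mul, der_mul, map_add, h₁, h₂, smul_eq_C_mul] at hx ⊢
        push_cast at hx ⊢
        simp only [map_neg, map_add, map_one] at hx ⊢
        linear_combination X (b, i) * hx
  · rw [show (-(n : ℤ) - 1 - 1) = -(n + 1 : ℕ) - 1 by push_cast; ring]
    simp only [q_creation, der_mul, der_X]
    push_cast
    rw [add_sub_cancel_right, smul_mul_assoc]
    congr 1
    ring

theorem hasFiniteSupport_mode (x v : Space ι) (m : ℤ) (g : ℕ → Space ι → Space ι)
    (hg : ∀ j, g j 0 = 0) : Function.HasFiniteSupport fun j => g j (mode Ω x (m + j) v) := by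
  obtain ⟨N, hN⟩ := mode_eventually_zero Ω x v
  exact hasFiniteSupport_of_forall_ge (N + m.natAbs) fun j hj => by rw [hN _ (by omega), hg]

theorem hasFiniteSupport_q (a : ι) (v : Space ι) (m : ℤ) (g : ℕ → Space ι → Space ι)
    (hg : ∀ j, g j 0 = 0) : Function.HasFiniteSupport fun j => g j (q Ω a (m + j) v) := by
  obtain ⟨N, hN⟩ := q_eventually_zero Ω a v
  exact hasFiniteSupport_of_forall_ge (N + m.natAbs) fun j hj => by rw [hN _ (by omega), hg]

theorem hasFiniteSupport_q_natCast (a : ι) (v : Space ι) (g : ℕ → Space ι → Space ι)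
    (hg : ∀ j, g j 0 = 0) : Function.HasFiniteSupport fun j : ℕ => g j (q Ω a j v) := by
  simpa using hasFiniteSupport_q Ω a v 0 g hg

theorem mode_X_mul_eq_add (a : ι) (n : ℕ) (x : Space ι) (m : ℤ) (v : Space ι) :
    mode Ω (X (a, n) * x) m v =
      ∑ᶠ j : ℕ, ((n + j).choose n : ℂ) • q Ω a (-n - 1 - j) (mode Ω x (m + j) v) +
      ∑ᶠ j : ℕ, ((-1 : ℂ) ^ n * ((n + j).choose n : ℂ)) •
        mode Ω x (m - n - 1 - j) (q Ω a j v) := by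
  rw [mode_X_mul, ← finsum_add_distrib
    (hasFiniteSupport_mode Ω x v m (fun j w => ((n + j).choose n : ℂ) • q Ω a (-n - 1 - j) w)
      (by simp))
    (hasFiniteSupport_q_natCast Ω a v
      (fun j w => ((-1 : ℂ) ^ n * ((n + j).choose n : ℂ)) • mode Ω x (m - n - 1 - j) w) (by simp))]
  refine finsum_congr fun j => ?_
  module

theorem mode_X_zero_mul (a : ι) (x : Space ι) (m : ℤ) (v : Space ι) :
    mode Ω (X (a, 0) * x) m v = ∑ᶠ j : ℕ, q Ω a (-1 - j) (mode Ω x (m + j) v) +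
      ∑ᶠ j : ℕ, mode Ω x (m - 1 - j) (q Ω a j v) := by
  simp [mode_X_mul_eq_add]

/-- The field of `∂x` is the derivative of the field of `x`. -/
theorem mode_der (x : Space ι) (m : ℤ) (v : Space ι) :
    mode Ω (der x) m v = -(m : ℂ) • mode Ω x (m - 1) v := by
  induction x using space_induction generalizing m v with
  | one =>
    rw [der_one, map_zero, mode_one]
    by_cases h : m = 0
    · simp [h]
    · rw [if_neg (by omega), smul_zero]
      rfl
  | add x y hx hy => simp only [map_add, Pi.add_apply, LinearMap.add_apply, hx, hy, smul_add]
  | smul c x hx =>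
    simp only [map_smul, Pi.smul_apply, LinearMap.smul_apply, hx]
    rw [smul_comm]
  | X_mul a n x hx =>
    rw [der_mul, der_X, smul_mul_assoc, map_add, map_smul, Pi.add_apply, LinearMap.add_apply,
      Pi.smul_apply, LinearMap.smul_apply]
    simp only [mode_X_mul_eq_add, hx]
    -- Each side of the Leibniz rule is brought to the words of `mode_X_mul_eq_add` at index `m -
    -- 1`. The coefficients then add up by absorption: `(n+1) (n+1+j choose n+1) = (n+j+1) (n+j
    -- choose n)`, and its analogue with `j + 1` in the creation part, leave the factor `-m`.
    have s₁ := hasFiniteSupport_mode Ω x v (m - 1)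
      (fun j w => ((n + j).choose n * j : ℂ) • q Ω a (-n - 1 - j) w) (by simp)
    have s₂ := hasFiniteSupport_mode Ω x v (m - 1)
      (fun j w => ((n + j).choose n * (-m - j) : ℂ) • q Ω a (-n - 1 - j) w) (by simp)
    have s₃ := hasFiniteSupport_q_natCast Ω a v (fun j w => ((n + 1 : ℂ) * ((-1) ^ (n + 1) *
      ((n + 1 + j).choose (n + 1) : ℂ))) • mode Ω x (m - n - 2 - j) w) (by simp)
    have s₄ := hasFiniteSupport_q_natCast Ω a v (fun j w => (((-1) ^ n *
      ((n + j).choose n : ℂ) * -(m - n - 1 - j))) • mode Ω x (m - n - 2 - j) w) (by simp)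
    have e₁ : ((n : ℂ) + 1) • ∑ᶠ j : ℕ, ((n + 1 + j).choose (n + 1) : ℂ) •
          q Ω a (-(n + 1 : ℕ) - 1 - j) (mode Ω x (m + j) v) =
        ∑ᶠ j : ℕ, ((n + j).choose n * j : ℂ) • q Ω a (-n - 1 - j) (mode Ω x (m - 1 + j) v) := by
      rw [finsum_eq_zero_add s₁, smul_finsum]
      simp only [Nat.cast_zero, mul_zero, zero_smul, zero_add]
      refine finsum_congr fun j => ?_
      rw [smul_smul]
      have h := Nat.choose_succ_right_eq (n + 1 + j) n
      rw [show n + 1 + j - n = j + 1 by omega] at h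
      have h' : ((n + 1 + j).choose (n + 1) : ℂ) * (n + 1) = (n + 1 + j).choose n * (j + 1) := by
        exact_mod_cast h
      congr 1
      · rw [mul_comm, h', show n + (j + 1) = n + 1 + j by ring]
        push_cast
        ring
      · rw [show (-(n + 1 : ℕ) - 1 - j : ℤ) = -n - 1 - (j + 1 : ℕ) by push_cast; ring,
          show (m - 1 + (j + 1 : ℕ) : ℤ) = m + j by push_cast; ring]
    have e₂ : ∑ᶠ j : ℕ, ((n + j).choose n : ℂ) •
          q Ω a (-n - 1 - j) (-((m + j : ℤ) : ℂ) • mode Ω x (m + j - 1) v) =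
        ∑ᶠ j : ℕ, ((n + j).choose n * (-m - j) : ℂ) •
          q Ω a (-n - 1 - j) (mode Ω x (m - 1 + j) v) := by
      refine finsum_congr fun j => ?_
      rw [map_smul, smul_smul, show (m + j - 1 : ℤ) = m - 1 + j by ring]
      congr 1
      push_cast
      ring
    have e₃ : ((n : ℂ) + 1) • ∑ᶠ j : ℕ, ((-1 : ℂ) ^ (n + 1) * ((n + 1 + j).choose (n + 1) : ℂ)) •
          mode Ω x (m - (n + 1 : ℕ) - 1 - j) (q Ω a j v) =
        ∑ᶠ j : ℕ, ((n + 1 : ℂ) * ((-1) ^ (n + 1) * ((n + 1 + j).choose (n + 1) : ℂ))) •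
          mode Ω x (m - n - 2 - j) (q Ω a j v) := by
      rw [smul_finsum]
      refine finsum_congr fun j => ?_
      rw [smul_smul, show (m - (n + 1 : ℕ) - 1 - j : ℤ) = m - n - 2 - j by push_cast; ring]
    have e₄ : ∑ᶠ j : ℕ, ((-1 : ℂ) ^ n * ((n + j).choose n : ℂ)) •
          -((m - n - 1 - j : ℤ) : ℂ) • mode Ω x (m - n - 1 - j - 1) (q Ω a j v) =
        ∑ᶠ j : ℕ, ((-1) ^ n * ((n + j).choose n : ℂ) * -(m - n - 1 - j)) •
          mode Ω x (m - n - 2 - j) (q Ω a j v) := by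
      refine finsum_congr fun j => ?_
      rw [smul_smul, show (m - n - 1 - j - 1 : ℤ) = m - n - 2 - j by ring]
      push_cast
      rfl
    rw [smul_add, e₁, e₂, e₃, e₄, add_add_add_comm, ← finsum_add_distrib s₁ s₂,
      ← finsum_add_distrib s₃ s₄, smul_add, smul_finsum, smul_finsum]
    congr 1
    · refine finsum_congr fun j => ?_
      rw [← add_smul, smul_smul]
      congr 1
      ring
    · refine finsum_congr fun j => ?_
      rw [← add_smul, smul_smul, show (m - 1 - n - 1 - j : ℤ) = m - n - 2 - j by ring]
      congr 1
      have h := Nat.add_one_mul_choose_eq (n + j) n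
      have h' : ((n : ℂ) + j + 1) * (n + j).choose n = (n + 1 + j).choose (n + 1) * (n + 1) := by
        rw [show n + 1 + j = n + j + 1 by ring]
        exact_mod_cast h
      rw [pow_succ]
      linear_combination (-1 : ℂ) ^ n * h'

/-- The commutator of a mode of a generating field with a mode of an arbitrary field. -/
theorem q_mode_comm (hA : ∀ a b, Ω⁻¹ b a = -Ω⁻¹ a b) (a : ι) (y : Space ι) (m k : ℤ)
    (v : Space ι) : q Ω a m (mode Ω y k v) - mode Ω y k (q Ω a m v) =
      ∑ᶠ j : ℕ, Ring.choose (m : ℂ) j • mode Ω (q Ω a j y) (m + k - j) v := by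
  have hs : ∀ (y : Space ι) (m k : ℤ) (v : Space ι), Function.HasFiniteSupport fun j : ℕ =>
      Ring.choose (m : ℂ) j • mode Ω (q Ω a j y) (m + k - j) v := fun y m k v =>
    hasFiniteSupport_q_natCast Ω a y
      (fun j w => Ring.choose (m : ℂ) j • mode Ω w (m + k - j) v) (by simp)
  induction y using space_induction_der generalizing m k v with
  | one =>
    simp only [q_annihilation_one, map_zero, mode_one, Pi.zero_apply, LinearMap.zero_apply,
      smul_zero, finsum_zero]
    split_ifs <;> simp
  | add x y hx hy =>
    simp only [map_add, Pi.add_apply, LinearMap.add_apply, smul_add]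
    rw [finsum_add_distrib (hs x m k v) (hs y m k v), ← hx, ← hy]
    abel
  | smul c x hx =>
    simp only [map_smul, Pi.smul_apply, LinearMap.smul_apply]
    rw [← smul_sub, hx, smul_finsum]
    exact finsum_congr fun j => smul_comm _ _ _
  | der y hy =>
    simp only [mode_der, map_smul]
    rw [← smul_sub, hy]
    -- Moving `q_j` past ∂ gives a second sum containing `q_{j-1}`. Its `j = 0` term has coefficient
    -- 0; after a shift, `(j+1) (m choose j+1) = (m-j) (m choose j)` reduces the total coefficient
    -- to `-k (m choose j)`.
    have e : ∀ j : ℕ, Ring.choose (m : ℂ) j • mode Ω (q Ω a j (der y)) (m + k - j) v =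
        (Ring.choose (m : ℂ) j * -(m + k - j)) • mode Ω (q Ω a j y) (m + k - j - 1) v +
        (Ring.choose (m : ℂ) j * j) • mode Ω (q Ω a (j - 1) y) (m + k - j) v := fun j => by
      have h := der_q Ω a j y
      rw [show q Ω a j (der y) = der (q Ω a j y) + (j : ℂ) • q Ω a (j - 1) y by
        rw [sub_eq_iff_eq_add] at h
        rw [h]
        push_cast
        module, map_add, map_smul, Pi.add_apply, LinearMap.add_apply, mode_der, Pi.smul_apply,
        LinearMap.smul_apply]
      push_cast
      module
    have s₁ := hasFiniteSupport_q_natCast Ω a y (fun j w =>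
      (Ring.choose (m : ℂ) j * -(m + k - j)) • mode Ω w (m + k - j - 1) v) (by simp)
    have s₂ := hasFiniteSupport_q Ω a y (-1) (fun j w =>
      (Ring.choose (m : ℂ) j * j) • mode Ω w (m + k - j) v) (by simp)
    simp only [neg_add_eq_sub] at s₂
    have s₃ := hasFiniteSupport_q_natCast Ω a y (fun j w =>
      (Ring.choose (m : ℂ) (j + 1) * (j + 1)) • mode Ω w (m + k - (j + 1 : ℕ)) v) (by simp)
    rw [finsum_congr e, finsum_add_distrib s₁ s₂, finsum_eq_zero_add s₂]
    simp only [Nat.cast_zero, mul_zero, zero_smul, zero_add]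
    push_cast at s₃ ⊢
    simp only [add_sub_cancel_right]
    rw [← finsum_add_distrib s₁ s₃, smul_finsum]
    refine finsum_congr fun j => ?_
    rw [smul_smul, ← sub_sub, ← add_smul, show (m + (k - 1) - j : ℤ) = m + k - j - 1 by ring]
    congr 1
    linear_combination -succ_mul_choose_succ (m : ℂ) j
  | X_mul b y hy =>
    -- By the Leibniz rule the right side is a contraction of `q^a` with the new generator, present
    -- only for `j = 0`, plus the contractions with `y`.
    have e : ∀ j : ℕ, Ring.choose (m : ℂ) j • mode Ω (q Ω a j (X (b, 0) * y)) (m + k - j) v =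
        (if j = 0 then Ω⁻¹ a b • mode Ω y (m + k) v else 0) +
        Ring.choose (m : ℂ) j • mode Ω (X (b, 0) * q Ω a j y) (m + k - j) v := fun j => by
      rw [q_annihilation_mul, q_annihilation_X, map_add, Pi.add_apply, LinearMap.add_apply, smul_add]
      by_cases h : j = 0
      · subst h
        simp [← smul_eq_C_mul]
      · simp [h]
    obtain ⟨J, hJ⟩ := q_eventually_zero Ω a y
    have hJ' : ∀ j : ℕ, J ≤ j → q Ω a j y = 0 := fun j hj => hJ _ (by omega)
    have s₁ : Function.HasFiniteSupport fun j : ℕ =>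
        if j = 0 then Ω⁻¹ a b • mode Ω y (m + k) v else 0 :=
      hasFiniteSupport_of_forall_ge 1 fun j hj => if_neg (by omega)
    have s₂ := hasFiniteSupport_q_natCast Ω a y (fun j w =>
      Ring.choose (m : ℂ) j • mode Ω (X (b, 0) * w) (m + k - j) v) (by simp)
    have s₃ : ∀ w : Space ι, Function.HasFiniteSupport fun j : ℕ => q Ω b (-1 - j) (mode Ω y (k + j) w) :=
      fun w => hasFiniteSupport_mode Ω y w k (fun j w => q Ω b (-1 - j) w) (by simp)
    have s₃' := hasFiniteSupport_mode Ω y v k (fun j w => q Ω a m (q Ω b (-1 - j) w)) (by simp)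
    have s₄ : ∀ w : Space ι, Function.HasFiniteSupport fun j : ℕ => mode Ω y (k - 1 - j) (q Ω b j w) :=
      fun w => hasFiniteSupport_q_natCast Ω b w (fun j w => mode Ω y (k - 1 - j) w) (by simp)
    have s₄' := hasFiniteSupport_q_natCast Ω b v
      (fun j w => q Ω a m (mode Ω y (k - 1 - j) w)) (by simp)
    have s₅ := hasFiniteSupport_q_natCast Ω a y (fun j w => Ring.choose (m : ℂ) j •
      ∑ᶠ i : ℕ, q Ω b (-1 - i) (mode Ω w (m + k - j + i) v)) (by simp)
    have s₆ := hasFiniteSupport_q_natCast Ω a y (fun j w => Ring.choose (m : ℂ) j •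
      ∑ᶠ i : ℕ, mode Ω w (m + k - j - 1 - i) (q Ω b i v)) (by simp)
    have hr : ∑ᶠ j : ℕ, Ring.choose (m : ℂ) j • mode Ω (X (b, 0) * q Ω a j y) (m + k - j) v =
        ∑ᶠ i : ℕ, q Ω b (-1 - i) (q Ω a m (mode Ω y (k + i) v) - mode Ω y (k + i) (q Ω a m v)) +
        ∑ᶠ i : ℕ, (q Ω a m (mode Ω y (k - 1 - i) (q Ω b i v)) -
          mode Ω y (k - 1 - i) (q Ω a m (q Ω b i v))) := by
      simp only [mode_X_zero_mul, smul_add, hy]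
      rw [finsum_add_distrib s₅ s₆]
      congr 1
      · have hm : ∀ i : ℕ, q Ω b (-1 - i) (∑ᶠ j : ℕ,
            Ring.choose (m : ℂ) j • mode Ω (q Ω a j y) (m + (k + i) - j) v) =
            ∑ᶠ j : ℕ, Ring.choose (m : ℂ) j •
              q Ω b (-1 - i) (mode Ω (q Ω a j y) (m + k - j + i) v) := fun i => by
          rw [map_finsum _ (hs y m (k + i) v)]
          refine finsum_congr fun j => ?_
          rw [map_smul, show m + (k + i) - j = m + k - j + i by ring]
        rw [finsum_congr hm, finsum_comm_of_forall_ge J (fun i j hj => by simp [hJ' j hj]) fun j => ?_]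
        · exact finsum_congr fun j => smul_finsum _ _
        · exact hasFiniteSupport_mode Ω (q Ω a j y) v (m + k - j)
            (fun i w => Ring.choose (m : ℂ) j • q Ω b (-1 - i) w) (by simp)
      · rw [finsum_comm_of_forall_ge J (fun i j hj => by simp [hJ' j hj]) fun j => ?_]
        · refine finsum_congr fun j => ?_
          rw [smul_finsum]
          refine finsum_congr fun i => ?_
          rw [show m + (k - 1 - i) - j = m + k - j - 1 - i by ring]
        · exact hasFiniteSupport_q_natCast Ω b v
            (fun i w => Ring.choose (m : ℂ) j • mode Ω (q Ω a j y) (m + (k - 1 - i) - j) w) (by simp)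
    -- Among the Heisenberg commutators of `q^a_m` with the modes of `q^b` exactly one is nonzero:
    -- in the creation sum if `m ≥ 0`, in the annihilation sum if `m < 0`.
    have hl : Ω⁻¹ a b • mode Ω y (m + k) v =
        ∑ᶠ i : ℕ, (q Ω a m (q Ω b (-1 - i) (mode Ω y (k + i) v)) -
          q Ω b (-1 - i) (q Ω a m (mode Ω y (k + i) v))) +
        ∑ᶠ i : ℕ, mode Ω y (k - 1 - i) (q Ω a m (q Ω b i v) - q Ω b i (q Ω a m v)) := by
      simp only [q_comm Ω hA]
      obtain ⟨n, rfl⟩ | ⟨n, rfl⟩ := int_cases m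
      · rw [finsum_eq_single _ n fun i hi => if_neg (by omega), if_pos (by omega),
          finsum_congr (g := fun _ => 0) (fun i => by rw [if_neg (by omega), map_zero]), finsum_zero,
          add_zero, add_comm k]
      · rw [finsum_congr (g := fun _ => 0) (fun i => by rw [if_neg (by omega)]), finsum_zero,
          zero_add, finsum_eq_single _ n fun i hi => by rw [if_neg (by omega), map_zero],
          if_pos (by omega), map_smul, show k - 1 - n = -n - 1 + k by ring]
    rw [finsum_congr e, finsum_add_distrib s₁ s₂, finsum_eq_single _ 0 fun j hj => if_neg hj,
      if_pos rfl, hr, hl, mode_X_zero_mul, mode_X_zero_mul, map_add, map_finsum _ (s₃ v),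
      map_finsum _ (s₄ v)]
    simp only [map_sub]
    rw [finsum_sub_distrib s₃' (hasFiniteSupport_mode Ω y v k
        (fun j w => q Ω b (-1 - j) (q Ω a m w)) (by simp)),
      finsum_sub_distrib (hasFiniteSupport_q_natCast Ω b v
        (fun j w => mode Ω y (k - 1 - j) (q Ω a m w)) (by simp)) (s₄ _),
      finsum_sub_distrib (hasFiniteSupport_mode Ω y v k
        (fun j w => q Ω b (-1 - j) (q Ω a m w)) (by simp)) (s₃ _),
      finsum_sub_distrib s₄' (hasFiniteSupport_q_natCast Ω b v
        (fun j w => mode Ω y (k - 1 - j) (q Ω a m w)) (by simp))]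
    abel

end Sb

/-! ### Formal distributions in two variables and expansions of powers of z - w. -/

namespace GradedUnitary

section ShiftDiff

variable {W : Type*} [AddCommGroup W] [Module ℂ W]

/-- Multiplication by `z - w` on the coefficients of a formal distribution in `z` and `w`. -/
def shiftDiff : Module.End ℂ (ℤ → ℤ → W) where
  toFun F m n := F (m + 1) n - F m (n + 1)
  map_add' F G := by
    ext
    simp only [Pi.add_apply]
    abel
  map_smul' c F := by
    ext
    simp [smul_sub]

theorem shiftDiff_apply (F : ℤ → ℤ → W) (m n : ℤ) :
    shiftDiff F m n = F (m + 1) n - F m (n + 1) := rfl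

/-- `shiftDiff` is a sum of two commuting shifts, so the binomial theorem applies. The right side is
the form in which locality is stated. -/
theorem shiftDiff_pow_apply (N : ℕ) (F : ℤ → ℤ → W) (m n : ℤ) :
    (shiftDiff ^ N) F m n = ∑ k ∈ Finset.range (N + 1),
      ((-1 : ℂ) ^ k * (N.choose k : ℂ)) • F (m + N - k) (n + k) := by
  let S : Module.End ℂ (ℤ → ℤ → W) :=
    { toFun := fun F m n => F (m + 1) n, map_add' := fun _ _ => rfl, map_smul' := fun _ _ => rfl }
  let T : Module.End ℂ (ℤ → ℤ → W) :=
    { toFun := fun F m n => -F m (n + 1)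
      map_add' := fun _ _ => by
        ext
        simp only [Pi.add_apply, neg_add]
      map_smul' := fun _ _ => by
        ext
        simp }
  have hS : ∀ (k : ℕ) (F : ℤ → ℤ → W) (m n : ℤ), (S ^ k) F m n = F (m + k) n := by
    intro k
    induction k with
    | zero => simp
    | succ k ih =>
      intro F m n
      rw [pow_succ, Module.End.mul_apply, ih]
      change F (m + k + 1) n = _
      push_cast
      rw [add_assoc]
  have hT : ∀ (k : ℕ) (F : ℤ → ℤ → W) (m n : ℤ), (T ^ k) F m n = (-1 : ℂ) ^ k • F m (n + k) := by
    intro k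
    induction k with
    | zero => simp
    | succ k ih =>
      intro F m n
      rw [pow_succ, Module.End.mul_apply, ih]
      change (-1 : ℂ) ^ k • -F m (n + k + 1) = _
      push_cast
      rw [add_assoc, pow_succ]
      module
  have hST : shiftDiff = T + S := by
    ext F m n
    simp only [shiftDiff_apply, LinearMap.add_apply, Pi.add_apply]
    change _ = -F m (n + 1) + F (m + 1) n
    abel
  have hc : Commute T S := rfl
  rw [hST, hc.add_pow, LinearMap.sum_apply, Finset.sum_apply, Finset.sum_apply]
  refine Finset.sum_congr rfl fun k hk => ?_
  have hk' : k ≤ N := by simpa [Nat.lt_succ_iff] using hk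
  rw [← nsmul_eq_mul', LinearMap.smul_apply, Module.End.mul_apply, Pi.smul_apply, Pi.smul_apply, hT,
    hS, ← Nat.cast_smul_eq_nsmul ℂ, smul_smul, mul_comm, Nat.cast_sub hk', add_sub_assoc]

theorem shiftDiff_pow_eq_zero_of_le {N N' : ℕ} (h : N ≤ N') {F : ℤ → ℤ → W}
    (hF : (shiftDiff ^ N) F = 0) : (shiftDiff ^ N') F = 0 := by
  rw [← Nat.sub_add_cancel h, pow_add, Module.End.mul_apply, hF, map_zero]

/-- Multiplication by a power of z - w uses finitely many coefficients at a time, so it commutes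
with pointwise finite sums of distributions. -/
theorem shiftDiff_pow_finsum (N : ℕ) (H : ℕ → ℤ → ℤ → W)
    (hfin : ∀ m n, Function.HasFiniteSupport fun i => H i m n)
    (h : ∀ i, (shiftDiff ^ N) (H i) = 0) :
    (shiftDiff ^ N) (fun m n => ∑ᶠ i, H i m n) = 0 := by
  ext m n
  rw [shiftDiff_pow_apply]
  simp only [smul_finsum]
  rw [← finsum_sum_comm _ _ fun k _ => ?_]
  · rw [finsum_congr (g := fun _ => 0) fun i => ?_, finsum_zero]
    · rfl
    · rw [← shiftDiff_pow_apply, h]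
      rfl
  · exact (hfin (m + N - k) (n + k)).subset fun i hi hc => hi (by
      simp only at hc
      simp [hc])

theorem shiftDiff_pow_map (N : ℕ) (H : ℤ → ℤ → W) (f : Module.End ℂ W) (c : ℤ)
    (h : (shiftDiff ^ N) H = 0) : (shiftDiff ^ N) (fun m n => f (H (m + c) n)) = 0 := by
  ext m n
  have := congrArg f (congrFun (congrFun h (m + c)) n)
  rw [shiftDiff_pow_apply, map_sum] at this
  rw [shiftDiff_pow_apply]
  simp only [map_smul, Pi.zero_apply, map_zero] at this ⊢
  rw [← this]
  refine Finset.sum_congr rfl fun k _ => ?_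
  rw [show m + N - k + c = m + c + N - k by ring]

/-- Multiplication by the expansion of `(z - w) ^ (-j - 1)` in the domain `|z| > |w|`. -/
def expandLeft (j : ℕ) (F : ℤ → ℤ → W) (m n : ℤ) : W :=
  ∑ᶠ i : ℕ, Ring.choose (i : ℂ) j • F (m - 1 - i) (n + i - j)

/-- Multiplication by the expansion of `(z - w) ^ (-j - 1)` in the domain `|w| > |z|`. -/
def expandRight (j : ℕ) (F : ℤ → ℤ → W) (m n : ℤ) : W :=
  -∑ᶠ i : ℕ, Ring.choose (-1 - i : ℂ) j • F (m + i) (n - 1 - i - j)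

/-- Multiplying by z - w telescopes the geometric series when `j = 0`; in general Pascal's rule
lowers `j` by one. The vanishing of `F` for large `n`, uniformly in `m`, makes the sums finite. The
expansion in the other domain is treated in the same way with the roles of the indices exchanged. -/
theorem shiftDiff_pow_expandLeft (j : ℕ) {F : ℤ → ℤ → W}
    (hF : ∃ K : ℕ, ∀ m n : ℤ, K ≤ n → F m n = 0) : (shiftDiff ^ (j + 1)) (expandLeft j F) = F := by
  obtain ⟨K, hK⟩ := hF
  have hs : ∀ (c : ℕ → ℂ) (e : ℕ → ℤ) (n : ℤ),
      Function.HasFiniteSupport fun i : ℕ => c i • F (e i) (n + i) := fun c e n =>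
    hasFiniteSupport_of_forall_ge (K + n.natAbs) fun i hi => by rw [hK _ _ (by omega), smul_zero]
  induction j with
  | zero =>
    ext m n
    rw [zero_add, pow_one, shiftDiff_apply]
    simp only [expandLeft, Ring.choose_zero_right, CharP.cast_eq_zero, sub_zero]
    rw [finsum_eq_zero_add (hs _ _ _)]
    simp only [one_smul, Nat.cast_zero, add_zero, sub_zero, add_sub_cancel_right]
    rw [finsum_congr (fun i : ℕ => by
      rw [show m - ((i + 1 : ℕ) : ℤ) = m - 1 - i by push_cast; ring,
        show n + ((i + 1 : ℕ) : ℤ) = n + 1 + i by push_cast; ring]), add_sub_cancel_right]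
  | succ j ih =>
    rw [pow_succ, Module.End.mul_apply]
    convert ih using 2
    ext m n
    rw [shiftDiff_apply]
    have e : ∀ (c : ℕ → ℂ) (f : ℕ → ℤ) (n : ℤ),
        Function.HasFiniteSupport fun i : ℕ => c i • F (f i) (n + i - (j + 1 : ℕ)) := fun c f n => by
      simpa only [add_sub_right_comm] using hs c f (n - (j + 1 : ℕ))
    simp only [expandLeft]
    rw [finsum_eq_zero_add (e _ _ _)]
    simp only [Nat.cast_zero, Ring.choose_zero_succ, zero_smul, zero_add]
    have e₁ := e (fun i => Ring.choose ((i + 1 : ℕ) : ℂ) (j + 1)) (fun i => m - 1 - i) (n + 1)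
    have e₂ := e (fun i => Ring.choose (i : ℂ) (j + 1)) (fun i => m - 1 - i) (n + 1)
    rw [finsum_congr (fun i : ℕ => by
      rw [show m + 1 - 1 - ((i + 1 : ℕ) : ℤ) = m - 1 - i by push_cast; ring,
        show n + ((i + 1 : ℕ) : ℤ) = n + 1 + i by push_cast; ring]), ← finsum_sub_distrib e₁ e₂]
    refine finsum_congr fun i => ?_
    rw [← sub_smul, Nat.cast_add_one, Ring.choose_succ_succ, add_sub_cancel_right]
    congr 2
    push_cast
    ring

theorem shiftDiff_pow_expandRight (j : ℕ) {F : ℤ → ℤ → W}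
    (hF : ∃ K : ℕ, ∀ m n : ℤ, K ≤ m → F m n = 0) : (shiftDiff ^ (j + 1)) (expandRight j F) = F := by
  obtain ⟨K, hK⟩ := hF
  have hs : ∀ (c : ℕ → ℂ) (e : ℕ → ℤ) (m : ℤ),
      Function.HasFiniteSupport fun i : ℕ => c i • F (m + i) (e i) := fun c e m =>
    hasFiniteSupport_of_forall_ge (K + m.natAbs) fun i hi => by rw [hK _ _ (by omega), smul_zero]
  induction j with
  | zero =>
    ext m n
    rw [zero_add, pow_one, shiftDiff_apply]
    simp only [expandRight, Ring.choose_zero_right, CharP.cast_eq_zero, sub_zero]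
    rw [finsum_eq_zero_add (hs (fun _ => 1) (fun i => n + 1 - 1 - i) m)]
    simp only [one_smul, Nat.cast_zero, add_zero, sub_zero, add_sub_cancel_right]
    rw [finsum_congr (fun i : ℕ => by
      rw [show m + 1 + (i : ℤ) = m + (i + 1 : ℕ) by push_cast; ring,
        show n - 1 - (i : ℤ) = n - (i + 1 : ℕ) by push_cast; ring])]
    abel
  | succ j ih =>
    rw [pow_succ, Module.End.mul_apply]
    convert ih using 2
    ext m n
    rw [shiftDiff_apply]
    simp only [expandRight]
    have e := hs (fun i => Ring.choose (-1 - i : ℂ) (j + 1))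
      (fun i => n + 1 - 1 - i - (j + 1 : ℕ)) m
    have e₁ := hs (fun i => Ring.choose (-1 - i : ℂ) (j + 1))
      (fun i => n - 1 - i - (j + 1 : ℕ)) (m + 1)
    have e₂ := hs (fun i => Ring.choose (-1 - (i + 1 : ℕ) : ℂ) (j + 1))
      (fun i => n - 1 - i - (j + 1 : ℕ)) (m + 1)
    have e₃ := hs (fun i => Ring.choose (-1 - i : ℂ) j) (fun i => n - 1 - i - j) m
    rw [finsum_eq_zero_add e, finsum_eq_zero_add e₃, finsum_congr (f := fun i : ℕ =>
      Ring.choose (-1 - (i + 1 : ℕ) : ℂ) (j + 1) •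
        F (m + (i + 1 : ℕ)) (n + 1 - 1 - (i + 1 : ℕ) - (j + 1 : ℕ))) (fun i : ℕ => by
      rw [show m + ((i + 1 : ℕ) : ℤ) = m + 1 + i by push_cast; ring,
        show n + 1 - 1 - ((i + 1 : ℕ) : ℤ) = n - 1 - i by push_cast; ring])]
    -- The boundary term of the reindexed series: Pascal's rule for upper argument `-1`, where `(0
    -- choose j+1) = 0`.
    have h₀ : Ring.choose (-1 - (0 : ℕ) : ℂ) (j + 1) = -Ring.choose (-1 - (0 : ℕ) : ℂ) j := by
      have := Ring.choose_succ_succ (-1 : ℂ) j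
      rw [neg_add_cancel, Ring.choose_zero_succ] at this
      rw [Nat.cast_zero, sub_zero]
      linear_combination -this
    have h₁ : ∑ᶠ i : ℕ, Ring.choose (-1 - (i + 1 : ℕ) : ℂ) (j + 1) •
          F (m + 1 + i) (n - 1 - i - (j + 1 : ℕ)) -
        ∑ᶠ i : ℕ, Ring.choose (-1 - i : ℂ) (j + 1) • F (m + 1 + i) (n - 1 - i - (j + 1 : ℕ)) =
        -∑ᶠ i : ℕ, Ring.choose (-1 - (i + 1 : ℕ) : ℂ) j •
          F (m + (i + 1 : ℕ)) (n - 1 - (i + 1 : ℕ) - j) := by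
      rw [← finsum_sub_distrib e₂ e₁, ← finsum_neg_distrib]
      refine finsum_congr fun i => ?_
      have := Ring.choose_succ_succ (-1 - (i + 1 : ℕ) : ℂ) j
      rw [show (-1 - (i + 1 : ℕ) + 1 : ℂ) = -1 - i by push_cast; ring] at this
      rw [← sub_smul, this, show m + ((i + 1 : ℕ) : ℤ) = m + 1 + i by push_cast; ring,
        show n - 1 - ((i + 1 : ℕ) : ℤ) - j = n - 1 - i - (j + 1 : ℕ) by push_cast; ring]
      module
    rw [h₀, show n + 1 - 1 - ((0 : ℕ) : ℤ) - ((j + 1 : ℕ) : ℤ) = n - 1 - (0 : ℕ) - j by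
      push_cast; ring]
    linear_combination (norm := module) h₁

/-- Since (z - w) ∂_z F = ∂_z ((z - w) F) - F, differentiation costs one more power of z - w. -/
theorem shiftDiff_pow_succ_deriv (N : ℕ) (F : ℤ → ℤ → W) (hF : (shiftDiff ^ N) F = 0) :
    (shiftDiff ^ (N + 1)) (fun m n : ℤ => -(m : ℂ) • F (m - 1) n) = 0 := by
  induction N generalizing F with
  | zero =>
    rw [pow_zero, Module.End.one_apply] at hF
    simp only [hF, Pi.zero_apply, smul_zero]
    exact map_zero _
  | succ N ih =>
    rw [pow_succ, Module.End.mul_apply] at hF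
    have e : shiftDiff (fun m n : ℤ => -(m : ℂ) • F (m - 1) n) =
        (fun m n : ℤ => -(m : ℂ) • shiftDiff F (m - 1) n) - F := by
      ext m n
      simp only [shiftDiff_apply, Pi.sub_apply, add_sub_cancel_right, sub_add_cancel]
      push_cast
      module
    rw [pow_succ, Module.End.mul_apply, e, map_sub, ih _ hF, pow_succ, Module.End.mul_apply, hF,
      sub_zero]

end ShiftDiff

end GradedUnitary

/-! ### Locality. -/

namespace Sb

open GradedUnitary MvPolynomial

variable {ι : Type*} [Fintype ι] [DecidableEq ι] (Ω : Matrix ι ι ℂ)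

/-- Locality of the fields of the symplectic boson vertex algebra. -/
theorem locality (hA : ∀ a b, Ω⁻¹ b a = -Ω⁻¹ a b) (x y : Space ι) :
    ∃ N : ℕ, ∀ v, (shiftDiff ^ N) (fun m n =>
      mode Ω x m (mode Ω y n v) - mode Ω y n (mode Ω x m v)) = 0 := by
  induction x using space_induction_der generalizing y with
  | one =>
    refine ⟨0, fun v => ?_⟩
    ext m n
    simp only [mode_one, pow_zero, Module.End.one_apply]
    split_ifs <;> simp
  | add x x' hx hx' =>
    obtain ⟨N, hN⟩ := hx y
    obtain ⟨N', hN'⟩ := hx' y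
    refine ⟨N + N', fun v => ?_⟩
    have := congrArg₂ (· + ·) (shiftDiff_pow_eq_zero_of_le (Nat.le_add_right N N') (hN v))
      (shiftDiff_pow_eq_zero_of_le (Nat.le_add_left N' N) (hN' v))
    simp only [← map_add, add_zero] at this
    convert this using 2
    ext m n
    simp only [map_add, Pi.add_apply, LinearMap.add_apply]
    abel_nf
  | smul c x hx =>
    obtain ⟨N, hN⟩ := hx y
    refine ⟨N, fun v => ?_⟩
    have := congrArg (c • ·) (hN v)
    simp only [← map_smul, smul_zero] at this
    convert this using 2
    ext m n
    simp only [map_smul, Pi.smul_apply, LinearMap.smul_apply, smul_sub]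
  | der x hx =>
    obtain ⟨N, hN⟩ := hx y
    refine ⟨N + 1, fun v => ?_⟩
    convert shiftDiff_pow_succ_deriv N _ (hN v) using 2
    ext m n
    rw [mode_der, mode_der, map_smul, smul_sub]
  | X_mul a x hx =>
    obtain ⟨J, hJ⟩ := q_eventually_zero Ω a y
    have hJ' : ∀ j : ℕ, J ≤ j → q Ω a j y = 0 := fun j hj => hJ _ (by omega)
    obtain ⟨N, hN⟩ := hx y
    choose L hL using fun j : ℕ => hx (q Ω a j y)
    -- One exponent serves all finitely many pairs: `N` for `x` with `y`, and `L j` for `x` with the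
    -- contraction `q^a_j y`, which also carries a pole of order `j + 1`.
    refine ⟨N + ∑ j ∈ Finset.range J, (L j + (j + 1)), fun v => ?_⟩
    have hLN : ∀ j ∈ Finset.range J, L j + (j + 1) ≤ N + ∑ j ∈ Finset.range J, (L j + (j + 1)) :=
      fun j hj => le_add_left
        (Finset.single_le_sum (f := fun j => L j + (j + 1)) (fun i _ => Nat.zero_le _) hj)
    set K := N + ∑ j ∈ Finset.range J, (L j + (j + 1))
    have hK : ∀ v, (shiftDiff ^ K) (fun m n =>
        mode Ω x m (mode Ω y n v) - mode Ω y n (mode Ω x m v)) = 0 := fun v =>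
      shiftDiff_pow_eq_zero_of_le (Nat.le_add_right _ _) (hN v)
    have s₁ : ∀ m n : ℤ, Function.HasFiniteSupport fun i : ℕ =>
        q Ω a (-1 - i) (mode Ω x (m + i) (mode Ω y n v)) := fun m n =>
      hasFiniteSupport_mode Ω x _ m (fun i w => q Ω a (-1 - i) w) (by simp)
    have s₂ : ∀ m n : ℤ, Function.HasFiniteSupport fun i : ℕ =>
        q Ω a (-1 - i) (mode Ω y n (mode Ω x (m + i) v)) := fun m n =>
      hasFiniteSupport_mode Ω x _ m (fun i w => q Ω a (-1 - i) (mode Ω y n w)) (by simp)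
    have s₃ : ∀ m n : ℤ, Function.HasFiniteSupport fun i : ℕ =>
        mode Ω x (m - 1 - i) (mode Ω y n (q Ω a i v)) := fun m n =>
      hasFiniteSupport_q_natCast Ω a v (fun i w => mode Ω x (m - 1 - i) (mode Ω y n w)) (by simp)
    have s₄ : ∀ m n : ℤ, Function.HasFiniteSupport fun i : ℕ =>
        mode Ω y n (mode Ω x (m - 1 - i) (q Ω a i v)) := fun m n =>
      hasFiniteSupport_q_natCast Ω a v (fun i w => mode Ω y n (mode Ω x (m - 1 - i) w)) (by simp)
    have s₅ : ∀ m n : ℤ, Function.HasFiniteSupport fun i : ℕ =>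
        mode Ω x (m - 1 - i) (q Ω a i (mode Ω y n v)) := fun m n =>
      hasFiniteSupport_q_natCast Ω a _ (fun i w => mode Ω x (m - 1 - i) w) (by simp)
    have s₆ : ∀ m n : ℤ, Function.HasFiniteSupport fun i : ℕ =>
        mode Ω y n (q Ω a (-1 - i) (mode Ω x (m + i) v)) := fun m n =>
      hasFiniteSupport_mode Ω x _ m (fun i w => mode Ω y n (q Ω a (-1 - i) w)) (by simp)
    have hcomm : ∀ (m n : ℤ) (w : Space ι), q Ω a m (mode Ω y n w) - mode Ω y n (q Ω a m w) =
        ∑ j ∈ Finset.range J, Ring.choose (m : ℂ) j • mode Ω (q Ω a j y) (m + n - j) w :=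
      fun m n w => by
        rw [q_mode_comm Ω hA, finsum_eq_sum_range J (fun j hj => by simp [hJ' j hj])]
    -- Commuting `:q^a x:` with `y` leaves two families with commutators of `x` and `y`, and the
    -- contractions of `q^a` with `y`. By `hcomm`, summing the latter over annihilators gives (z -
    -- w)^{-j-1} expanded for |z| > |w|, and over creators the expansion for |w| > |z|.
    have split : (fun m n => mode Ω (X (a, 0) * x) m (mode Ω y n v) -
          mode Ω y n (mode Ω (X (a, 0) * x) m v)) =
        (fun m n => ∑ᶠ i : ℕ, q Ω a (-1 - i)
          (mode Ω x (m + i) (mode Ω y n v) - mode Ω y n (mode Ω x (m + i) v))) +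
        (fun m n => ∑ᶠ i : ℕ, (mode Ω x (m - 1 - i) (mode Ω y n (q Ω a i v)) -
          mode Ω y n (mode Ω x (m - 1 - i) (q Ω a i v)))) +
        ∑ j ∈ Finset.range J, (expandLeft j (fun m n => mode Ω x m (mode Ω (q Ω a j y) n v)) -
          expandRight j (fun m n => mode Ω (q Ω a j y) n (mode Ω x m v))) := by
      ext1 m
      ext1 n
      have h₁ : ∑ j ∈ Finset.range J,
            expandLeft j (fun m n => mode Ω x m (mode Ω (q Ω a j y) n v)) m n =
          ∑ᶠ i : ℕ, mode Ω x (m - 1 - i) (q Ω a i (mode Ω y n v)) -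
          ∑ᶠ i : ℕ, mode Ω x (m - 1 - i) (mode Ω y n (q Ω a i v)) := by
        rw [← finsum_sub_distrib (s₅ m n) (s₃ m n)]
        simp only [expandLeft]
        rw [← finsum_sum_comm _ _ fun j _ => ?_]
        · refine finsum_congr fun i => ?_
          rw [← map_sub, hcomm, map_sum]
          refine Finset.sum_congr rfl fun j _ => ?_
          rw [map_smul, Int.cast_natCast, add_comm n]
        · refine (hasFiniteSupport_mode Ω (q Ω a j y) v (n - j) (fun i w =>
            Ring.choose (i : ℂ) j • mode Ω x (m - 1 - i) w) (by simp)).subset fun i hi => ?_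
          simpa only [add_sub_right_comm] using hi
      have h₂ : ∑ j ∈ Finset.range J,
            expandRight j (fun m n => mode Ω (q Ω a j y) n (mode Ω x m v)) m n =
          ∑ᶠ i : ℕ, mode Ω y n (q Ω a (-1 - i) (mode Ω x (m + i) v)) -
          ∑ᶠ i : ℕ, q Ω a (-1 - i) (mode Ω y n (mode Ω x (m + i) v)) := by
        rw [← finsum_sub_distrib (s₆ m n) (s₂ m n)]
        simp only [expandRight]
        rw [Finset.sum_neg_distrib, ← finsum_sum_comm _ _ fun j _ => ?_, ← finsum_neg_distrib]
        · refine finsum_congr fun i => ?_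
          rw [← neg_sub (q Ω a (-1 - i) _), hcomm]
          congr 1
          refine Finset.sum_congr rfl fun j _ => ?_
          push_cast
          rw [show n - 1 - i - j = -1 - i + n - (j : ℤ) by ring]
        · exact hasFiniteSupport_mode Ω x v m (fun i w =>
            Ring.choose (-1 - i : ℂ) j • mode Ω (q Ω a j y) (n - 1 - i - j) w) (by simp)
      simp only [Pi.add_apply, Finset.sum_apply, Pi.sub_apply, Finset.sum_sub_distrib, h₁, h₂,
        map_sub]
      rw [finsum_sub_distrib (s₁ m n) (s₂ m n), finsum_sub_distrib (s₃ m n) (s₄ m n),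
        mode_X_zero_mul, mode_X_zero_mul, map_add, map_finsum _ (hasFiniteSupport_mode Ω x _ m
          (fun i w => q Ω a (-1 - i) w) (by simp)), map_finsum _ (hasFiniteSupport_q_natCast Ω a v
          (fun i w => mode Ω x (m - 1 - i) w) (by simp))]
      abel
    rw [split, map_add, map_add, map_sum]
    rw [shiftDiff_pow_finsum, shiftDiff_pow_finsum, Finset.sum_eq_zero, add_zero, add_zero]
    · intro j hj
      refine shiftDiff_pow_eq_zero_of_le (hLN j hj) ?_
      -- After `j + 1` factors z - w both expansions lose their pole. What remains is the commutator
      -- of `x` with `q^a_j y`, which `L j` further factors annihilate.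
      rw [pow_add, Module.End.mul_apply, map_sub, shiftDiff_pow_expandLeft,
        shiftDiff_pow_expandRight]
      · exact hL j v
      · obtain ⟨M, hM⟩ := mode_eventually_zero Ω x v
        exact ⟨M, fun m n hm => by rw [hM m hm, map_zero]⟩
      · obtain ⟨M, hM⟩ := mode_eventually_zero Ω (q Ω a j y) v
        exact ⟨M, fun m n hn => by rw [hM n hn, map_zero]⟩
    · intro m n
      exact ((s₃ m n).union (s₄ m n)).subset fun i hi => by
        by_contra hc
        simp only [Set.mem_union, Function.mem_support, not_or, not_not] at hc
        exact hi (by simp only [hc, sub_zero])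
    · intro i
      have := shiftDiff_pow_map K _ LinearMap.id (-1 - i) (hK (q Ω a i v))
      simp only [LinearMap.id_apply] at this
      convert this using 2
      ext m n
      rw [← add_sub_assoc, ← sub_eq_add_neg]
    · intro m n
      simp only [map_sub]
      exact ((s₁ m n).union (s₂ m n)).subset fun i hi => by
        by_contra hc
        simp only [Set.mem_union, Function.mem_support, not_or, not_not] at hc
        exact hi (by simp only [hc, sub_zero])
    · exact fun i => shiftDiff_pow_map K _ (q Ω a (-1 - i)) i (hK v)

end Sb

/-! ### Symplectic matrices and the action of the conformal vector. -/

namespace Sb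

open GradedUnitary MvPolynomial

theorem hasFiniteSupport_sum {A B C : Type*} [AddCommGroup C] (s : Finset B) {f : A → B → C}
    (h : ∀ b ∈ s, Function.HasFiniteSupport fun a => f a b) :
    Function.HasFiniteSupport fun a => ∑ b ∈ s, f a b :=
  (s.finite_toSet.biUnion h).subset fun a ha => by
    by_contra hc
    simp only [Set.mem_iUnion, Function.mem_support, not_exists, not_not] at hc
    exact ha (Finset.sum_eq_zero hc)

/-- The matrix of a symplectic form. -/
structure IsSymplectic {ι : Type*} [Fintype ι] [DecidableEq ι] (Ω : Matrix ι ι ℂ) : Prop where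
  transpose : Ω.transpose = -Ω
  isUnit : IsUnit Ω.det

variable {ι : Type*} [Fintype ι] [DecidableEq ι] {Ω : Matrix ι ι ℂ}

theorem IsSymplectic.skew (h : IsSymplectic Ω) (a b : ι) : Ω b a = -Ω a b :=
  congrFun (congrFun h.transpose a) b

theorem IsSymplectic.skew_inv (h : IsSymplectic Ω) (a b : ι) : Ω⁻¹ b a = -Ω⁻¹ a b := by
  have h₁ : (Ω⁻¹).transpose = -Ω⁻¹ := by
    rw [Matrix.transpose_nonsing_inv, h.transpose]
    refine Matrix.inv_eq_left_inv ?_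
    rw [neg_mul_neg, Matrix.nonsing_inv_mul _ h.isUnit]
  exact congrFun (congrFun h₁ a) b

theorem IsSymplectic.sum_mul_inv (h : IsSymplectic Ω) (a c : ι) :
    ∑ b, Ω a b * Ω⁻¹ b c = if a = c then 1 else 0 := by
  rw [← Matrix.mul_apply, Matrix.mul_nonsing_inv _ h.isUnit, Matrix.one_apply]

theorem IsSymplectic.sum_inv_mul (h : IsSymplectic Ω) (a c : ι) :
    ∑ b, Ω⁻¹ a b * Ω b c = if a = c then 1 else 0 := by
  rw [← Matrix.mul_apply, Matrix.nonsing_inv_mul _ h.isUnit, Matrix.one_apply]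

variable (Ω) in
theorem mode_apply_one (x : Space ι) (n : ℕ) : mode Ω x n 1 = 0 := by
  induction x using space_induction generalizing n with
  | one => rw [mode_one, if_neg (by omega)]
  | add x y hx hy => simp [hx, hy]
  | smul c x hx => simp [hx]
  | X_mul a k x hx =>
    rw [mode_X_mul]
    refine (finsum_congr fun j => ?_).trans finsum_zero
    rw [q_annihilation_one, ← Nat.cast_add, hx]
    simp

variable (Ω) in
theorem mode_neg_one_apply_one (x : Space ι) : mode Ω x (-1) 1 = x := by
  induction x using space_induction with
  | one => simp [mode_one]
  | add x y hx hy => simp [hx, hy]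
  | smul c x hx => simp [hx]
  | X_mul a k x hx =>
    rw [mode_X_mul, finsum_eq_single _ 0 fun j hj => ?_]
    · have h₀ := q_annihilation_one Ω a 0
      rw [Nat.cast_zero] at h₀
      simp [h₀, hx, q_creation]
    · obtain ⟨i, rfl⟩ := Nat.exists_eq_succ_of_ne_zero hj
      rw [q_annihilation_one, show (-1 + (i.succ : ℕ) : ℤ) = i by push_cast; ring, mode_apply_one]
      simp

variable (Ω) in
theorem mode_X_zero (a : ι) (m : ℤ) (v : Space ι) : mode Ω (X (a, 0)) m v = q Ω a m v := by
  rw [← mul_one (X (a, 0)), mode_X_zero_mul]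
  simp only [mode_one]
  obtain ⟨n, rfl⟩ | ⟨n, rfl⟩ := int_cases m
  · rw [finsum_congr (g := fun _ => 0) (fun j => by rw [if_neg (by omega), map_zero]), finsum_zero,
      zero_add, finsum_eq_single _ n fun j hj => if_neg (by omega), if_pos (by ring)]
  · rw [finsum_eq_single _ n fun j hj => by rw [if_neg (by omega), map_zero], if_pos (by ring),
      finsum_congr (g := fun _ => 0) (fun j => by rw [if_neg (by omega)]), finsum_zero, add_zero,
      show -1 - (n : ℤ) = -n - 1 by ring]

variable (Ω) in
theorem mode_X_one (a : ι) (m : ℤ) (v : Space ι) :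
    mode Ω (X (a, 1)) m v = -(m : ℂ) • q Ω a (m - 1) v := by
  rw [← mode_X_zero, ← mode_der, der_X]
  simp

/-- The commutators of the modes of ω with `q^c` are obtained from `q_mode_comm` with ω in the role
of the state. As ω involves only indices 0 and 1, its contractions with `q^c_0` and `q^c_1` suffice.
-/
theorem q_zero_omega (h : IsSymplectic Ω) (c : ι) :
    q Ω c (0 : ℕ) (omega Ω) = (-(1 / 2) : ℂ) • X (c, 1) := by
  have e : ∀ a b, q Ω c (0 : ℕ) (X (b, 0) * X (a, 1)) = Ω⁻¹ c b • (X (a, 1) : Space ι) := fun a b => by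
    simp only [q_annihilation_mul, q_annihilation_X]
    simp [smul_eq_C_mul]
  simp only [omega, map_smul, map_sum, e, smul_smul, ← Finset.sum_smul]
  have e' : ∀ a, ∑ b, Ω a b * Ω⁻¹ c b = if a = c then -1 else 0 := fun a => by
    rw [← neg_eq_iff_eq_neg.2 (show (if a = c then (1 : ℂ) else 0) = -(if a = c then -1 else 0) by
      split_ifs <;> simp), ← h.sum_mul_inv, ← Finset.sum_neg_distrib]
    exact Finset.sum_congr rfl fun b _ => by rw [h.skew_inv b c]; ring
  simp [e']

theorem q_one_omega (h : IsSymplectic Ω) (c : ι) :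
    q Ω c (1 : ℕ) (omega Ω) = (1 / 2 : ℂ) • X (c, 0) := by
  have e : ∀ a b, q Ω c (1 : ℕ) (X (b, 0) * X (a, 1)) = Ω⁻¹ c a • (X (b, 0) : Space ι) := fun a b => by
    simp only [q_annihilation_mul, q_annihilation_X]
    simp [smul_eq_C_mul, mul_comm]
  simp only [omega, map_smul, map_sum, e, smul_smul]
  rw [Finset.sum_comm]
  simp only [← Finset.sum_smul]
  have e' : ∀ b, ∑ a, Ω a b * Ω⁻¹ c a = if c = b then 1 else 0 := fun b => by
    rw [← h.sum_inv_mul]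
    exact Finset.sum_congr rfl fun a _ => mul_comm _ _
  simp [e']

variable (Ω) in
theorem q_omega_of_two_le (c : ι) (n : ℕ) (hn : 2 ≤ n) : q Ω c n (omega Ω) = 0 := by
  simp only [omega, map_smul, map_sum, q_annihilation_mul, q_annihilation_X]
  simp [show n ≠ 0 by omega, show n ≠ 1 by omega]

/-- The generating fields are primary of weight `1 / 2`. -/
theorem omega_q_comm (h : IsSymplectic Ω) (c : ι) (n k : ℤ) (v : Space ι) :
    mode Ω (omega Ω) n (q Ω c k v) - q Ω c k (mode Ω (omega Ω) n v) =
      -((k : ℂ) + n / 2) • q Ω c (k + n - 1) v := by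
  rw [← neg_sub, q_mode_comm Ω h.skew_inv,
    finsum_eq_sum_range 2 (fun j hj => by simp [q_omega_of_two_le Ω c j hj]), Finset.sum_range_succ,
    Finset.sum_range_one, q_zero_omega h, q_one_omega h]
  simp only [map_smul, Pi.smul_apply, LinearMap.smul_apply, mode_X_zero, mode_X_one,
    Ring.choose_zero_right, Ring.choose_one_right, Nat.cast_zero, Nat.cast_one, sub_zero]
  push_cast
  module

/-- Both operators kill the vacuum and have the same commutators with the creation operators. -/
theorem omega_zero_eq_der (h : IsSymplectic Ω) (v : Space ι) : mode Ω (omega Ω) 0 v = der v := by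
  induction v using space_induction with
  | one => exact (mode_apply_one Ω _ 0).trans der_one.symm
  | add x y hx hy => rw [map_add, map_add, hx, hy]
  | smul c x hx => rw [map_smul, map_smul, hx]
  | X_mul a n x hx =>
    have h₁ := omega_q_comm h a 0 (-n - 1) x
    have h₂ := der_q Ω a (-n - 1) x
    rw [hx, add_zero] at h₁
    rw [← q_creation Ω, ← sub_left_inj, h₁, h₂]
    simp

/-- The case of the derivative in the covariance of a field under the action of `ω`. -/
def OmegaCovariant (Ω : Matrix ι ι ℂ) (M : ℕ) (y : Space ι) : Prop :=
  ∀ (k : ℤ) (v : Space ι), mode Ω (omega Ω) M (mode Ω y k v) - mode Ω y k (mode Ω (omega Ω) M v) =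
    ∑ j ∈ Finset.range (M + 1), (M.choose j : ℂ) • mode Ω (mode Ω (omega Ω) j y) (M + k - j) v

/-- The shift moves at most one term across the boundary between creators and annihilators, and that
term is assumed to vanish. This is where `M ≤ 2`, the Möbius range, matters. -/
theorem finsum_int_shift {A : Type*} [AddCommGroup A] (f : ℤ → A) (M : ℕ) (hM : M ≤ 2)
    (h₀ : M = 0 → f 0 = 0) (h₂ : M = 2 → f (-1) = 0)
    (hf : ∀ c : ℤ, Function.HasFiniteSupport fun i : ℕ => f (i + c)) :
    ∑ᶠ i : ℕ, f (i + 1 - M) = ∑ᶠ i : ℕ, f i := by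
  obtain rfl | rfl | rfl : M = 0 ∨ M = 1 ∨ M = 2 := by omega
  · have := hf 0
    simp only [add_zero] at this
    rw [finsum_eq_zero_add this]
    simp [h₀]
  · simp
  · have := hf (-1)
    simp only [Nat.cast_ofNat, show ∀ i : ℕ, (i : ℤ) + 1 - 2 = i + -1 from fun i => by ring]
    rw [finsum_eq_zero_add this]
    simp [h₂]

/-- `ω_M` is commuted through both halves of the normally ordered product. It shifts the modes of
`q^a` by `M - 1`, which could break the split into creators and annihilators. For `M ≤ 2` the mode
crossing the boundary has coefficient zero, because `q^a` is primary of weight 1/2. -/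
theorem OmegaCovariant.X_mul (h : IsSymplectic Ω) {M : ℕ} (hM : M ≤ 2) (a : ι) {y : Space ι}
    (hy : OmegaCovariant Ω M y) : OmegaCovariant Ω M (X (a, 0) * y) := by
  intro k v
  set ω := omega Ω
  have hω : ∀ (n k : ℤ) (v : Space ι), mode Ω ω n (q Ω a k v) =
      q Ω a k (mode Ω ω n v) - ((k : ℂ) + n / 2) • q Ω a (k + n - 1) v := fun n k v => by
    rw [sub_eq_iff_eq_add.1 (omega_q_comm h a n k v)]
    module
  have hy' : ∀ (k : ℤ) (v : Space ι), mode Ω ω M (mode Ω y k v) - mode Ω y k (mode Ω ω M v) =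
    ∑ j ∈ Finset.range (M + 1), (M.choose j : ℂ) • mode Ω (mode Ω ω j y) (M + k - j) v := hy
  have s₁ : ∀ w : Space ι, Function.HasFiniteSupport fun i : ℕ =>
      q Ω a (-1 - i) (mode Ω y (k + i) w) := fun w =>
    hasFiniteSupport_mode Ω y w k (fun i w => q Ω a (-1 - i) w) (by simp)
  have s₂ : ∀ w : Space ι, Function.HasFiniteSupport fun i : ℕ =>
      mode Ω y (k - 1 - i) (q Ω a i w) := fun w =>
    hasFiniteSupport_q_natCast Ω a w (fun i w => mode Ω y (k - 1 - i) w) (by simp)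
  -- Summands of the terms arising from the commutator of `ω_M` with `q^a`, in the creation and
  -- annihilation parts. They are defined for all integers so that the shift can be expressed. Here
  -- `f 0 = 0` if `M = 0`, `f (-1) = 0` if `M = 2`, and conversely for `g`.
  let f : ℤ → Space ι := fun J =>
    ((J : ℂ) + M / 2) • q Ω a (-1 - J) (mode Ω y (M + k - 1 + J) v)
  let g : ℤ → Space ι := fun J =>
    ((J : ℂ) + 1 - M / 2) • mode Ω y (M + k - 2 - J) (q Ω a J v)
  have hf : ∀ c : ℤ, Function.HasFiniteSupport fun i : ℕ => f (i + c) := fun c => by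
    have := hasFiniteSupport_mode Ω y v (M + k - 1 + c)
      (fun i w => (((i + c : ℤ) : ℂ) + M / 2) • q Ω a (-1 - (i + c)) w) (by simp)
    simpa only [add_assoc, add_comm c] using this
  have hg : ∀ c : ℤ, Function.HasFiniteSupport fun i : ℕ => g (i + c) := fun c => by
    have := hasFiniteSupport_q Ω a v c
      (fun i w => (((i + c : ℤ) : ℂ) + 1 - M / 2) • mode Ω y (M + k - 2 - (i + c)) w) (by simp)
    simpa only [add_comm c] using this
  have hf' : Function.HasFiniteSupport fun i : ℕ => f (i + 1 - M) := by
    simpa only [add_sub_assoc] using hf (1 - M)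
  have hg' : Function.HasFiniteSupport fun i : ℕ => g (i + 1 - (2 - M : ℕ)) := by
    simpa only [add_sub_assoc] using hg (1 - (2 - M : ℕ))
  have hR : ∑ j ∈ Finset.range (M + 1), (M.choose j : ℂ) •
        mode Ω (mode Ω ω j (X (a, 0) * y)) (M + k - j) v =
      ∑ j ∈ Finset.range (M + 1), (M.choose j : ℂ) •
        mode Ω (X (a, 0) * mode Ω ω j y) (M + k - j) v +
      (mode Ω (X (a, 1) * y) (M + k) v + (M / 2 : ℂ) • mode Ω (X (a, 0) * y) (M + k - 1) v) := by
    -- The correction `(-1 + j/2) q_{j-2} y` is a creation term for `j = 0, 1` and vanishes for `j =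
    -- 2`.
    have e : ∀ j : ℕ, mode Ω ω j (X (a, 0) * y) =
        X (a, 0) * mode Ω ω j y - (-1 + j / 2 : ℂ) • q Ω a (j - 2) y := fun j => by
      have h₁ := q_creation Ω a 0
      simp only [Nat.cast_zero, neg_zero, zero_sub] at h₁
      rw [← h₁, ← h₁, hω]
      push_cast
      rw [show (-1 + j - 1 : ℤ) = j - 2 by ring]
    have e₁ : q Ω a (-2) y = X (a, 1) * y := q_creation Ω a 1 y
    have e₀ : q Ω a (-1) y = X (a, 0) * y := q_creation Ω a 0 y
    simp only [e, map_sub, map_smul, Pi.sub_apply, LinearMap.sub_apply, Pi.smul_apply,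
      LinearMap.smul_apply, smul_sub, Finset.sum_sub_distrib]
    rw [sub_eq_add_neg]
    congr 1
    obtain rfl | rfl | rfl : M = 0 ∨ M = 1 ∨ M = 2 := by omega
    · simp [e₁]
    · simp [Finset.sum_range_succ, e₁, e₀]
      module
    · simp [Finset.sum_range_succ, e₁, e₀]
      module
  have hfs : ∑ᶠ j : ℕ, ((1 + j).choose 1 : ℂ) • q Ω a (-(1 : ℕ) - 1 - j) (mode Ω y (M + k + j) v) +
      (M / 2 : ℂ) • ∑ᶠ j : ℕ, q Ω a (-1 - j) (mode Ω y (M + k - 1 + j) v) = ∑ᶠ i : ℕ, f i := by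
    have t₁ := hasFiniteSupport_mode Ω y v (M + k - 1) (fun i w => (i : ℂ) • q Ω a (-1 - i) w) (by simp)
    have t₂ := hasFiniteSupport_mode Ω y v (M + k - 1)
      (fun i w => (M / 2 : ℂ) • q Ω a (-1 - i) w) (by simp)
    have e : ∑ᶠ j : ℕ, ((1 + j).choose 1 : ℂ) •
          q Ω a (-(1 : ℕ) - 1 - j) (mode Ω y (M + k + j) v) =
        ∑ᶠ i : ℕ, (i : ℂ) • q Ω a (-1 - i) (mode Ω y (M + k - 1 + i) v) := by
      rw [finsum_eq_zero_add t₁, Nat.cast_zero, zero_smul, zero_add]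
      refine finsum_congr fun j => ?_
      rw [Nat.choose_one_right, show M + k - 1 + ((j + 1 : ℕ) : ℤ) = M + k + j by push_cast; ring,
        show -1 - ((j + 1 : ℕ) : ℤ) = -(1 : ℕ) - 1 - j by push_cast; ring, add_comm 1 j]
    rw [e, smul_finsum, ← finsum_add_distrib t₁ t₂]
    exact finsum_congr fun i => (add_smul _ _ _).symm
  have hgs : ∑ᶠ j : ℕ, ((-1 : ℂ) ^ 1 * ((1 + j).choose 1 : ℂ)) •
        mode Ω y (M + k - (1 : ℕ) - 1 - j) (q Ω a j v) +
      (M / 2 : ℂ) • ∑ᶠ j : ℕ, mode Ω y (M + k - 1 - 1 - j) (q Ω a j v) = -∑ᶠ i : ℕ, g i := by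
    rw [smul_finsum, ← finsum_neg_distrib, ← finsum_add_distrib
      (hasFiniteSupport_q_natCast Ω a v (fun j w => ((-1 : ℂ) ^ 1 * ((1 + j).choose 1 : ℂ)) •
        mode Ω y (M + k - (1 : ℕ) - 1 - j) w) (by simp))
      (hasFiniteSupport_q_natCast Ω a v (fun j w => (M / 2 : ℂ) •
        mode Ω y (M + k - 1 - 1 - j) w) (by simp))]
    refine finsum_congr fun j => ?_
    rw [show M + k - (1 : ℕ) - 1 - (j : ℤ) = M + k - 2 - j by push_cast; ring,
      show M + k - 1 - 1 - (j : ℤ) = M + k - 2 - j by ring, Nat.choose_one_right]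
    simp only [g]
    push_cast
    module
  have hfsh := finsum_int_shift f M hM (by rintro rfl; simp [f]) (by rintro rfl; simp [f]) hf
  have hgsh := finsum_int_shift g (2 - M) (by omega)
    (fun hM' => by
      obtain rfl : M = 2 := by omega
      simp [g])
    (fun hM' => by
      obtain rfl : M = 0 := by omega
      simp [g]) hg
  have l₁ : ∑ᶠ i : ℕ, (mode Ω ω M (q Ω a (-1 - i) (mode Ω y (k + i) v)) -
        q Ω a (-1 - i) (mode Ω y (k + i) (mode Ω ω M v))) =
      ∑ j ∈ Finset.range (M + 1), (M.choose j : ℂ) • ∑ᶠ i : ℕ,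
        q Ω a (-1 - i) (mode Ω (mode Ω ω j y) (M + k - j + i) v) + ∑ᶠ i : ℕ, f (i + 1 - M) := by
    simp only [smul_finsum]
    rw [← finsum_sum_comm _ _ fun j _ => hasFiniteSupport_mode Ω _ v _ (fun i w =>
        (M.choose j : ℂ) • q Ω a (-1 - i) w) (by simp), ← finsum_add_distrib ?_ hf']
    · refine finsum_congr fun i => ?_
      rw [hω, sub_eq_iff_eq_add.1 (hy' (k + i) v), map_add, map_sum, Finset.sum_congr rfl
        fun j _ => show q Ω a (-1 - i) ((M.choose j : ℂ) • mode Ω (mode Ω ω j y) (M + (k + i) - j) v) =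
          (M.choose j : ℂ) • q Ω a (-1 - i) (mode Ω (mode Ω ω j y) (M + k - j + i) v) by
        rw [map_smul, show M + (k + i) - (j : ℤ) = M + k - j + i by ring] ]
      simp only [f]
      rw [show -1 - ((i : ℤ) + 1 - M) = -1 - i + M - 1 by ring,
        show M + k - 1 + ((i : ℤ) + 1 - M) = k + i by ring]
      push_cast
      module
    · exact hasFiniteSupport_sum _ fun j _ => hasFiniteSupport_mode Ω _ v _ (fun i w =>
        (M.choose j : ℂ) • q Ω a (-1 - i) w) (by simp)
  have l₂ : ∑ᶠ i : ℕ, (mode Ω ω M (mode Ω y (k - 1 - i) (q Ω a i v)) -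
        mode Ω y (k - 1 - i) (q Ω a i (mode Ω ω M v))) =
      ∑ j ∈ Finset.range (M + 1), (M.choose j : ℂ) • ∑ᶠ i : ℕ,
        mode Ω (mode Ω ω j y) (M + k - j - 1 - i) (q Ω a i v) -
        ∑ᶠ i : ℕ, g (i + 1 - (2 - M : ℕ)) := by
    simp only [smul_finsum]
    rw [← finsum_sum_comm _ _ fun j _ => hasFiniteSupport_q_natCast Ω a v (fun i w =>
        (M.choose j : ℂ) • mode Ω (mode Ω ω j y) (M + k - j - 1 - i) w) (by simp),
      ← finsum_sub_distrib ?_ hg']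
    · refine finsum_congr fun i => ?_
      have hω' : q Ω a i (mode Ω ω M v) = mode Ω ω M (q Ω a i v) +
          ((i : ℂ) + M / 2) • q Ω a (i + M - 1) v := by
        rw [hω]
        push_cast
        module
      rw [hω', map_add, sub_eq_iff_eq_add.1 (hy' (k - 1 - i) (q Ω a i v)), Finset.sum_congr rfl
        fun j _ => show (M.choose j : ℂ) • mode Ω (mode Ω ω j y) (M + (k - 1 - i) - j) (q Ω a i v) =
          (M.choose j : ℂ) • mode Ω (mode Ω ω j y) (M + k - j - 1 - i) (q Ω a i v) by
        rw [show M + (k - 1 - i) - (j : ℤ) = M + k - j - 1 - i by ring] ]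
      simp only [g]
      rw [show (i : ℤ) + 1 - (2 - M : ℕ) = i + M - 1 by omega,
        show M + k - 2 - ((i : ℤ) + M - 1) = k - 1 - i by ring, map_smul]
      push_cast
      module
    · exact hasFiniteSupport_sum _ fun j _ => hasFiniteSupport_q_natCast Ω a v (fun i w =>
        (M.choose j : ℂ) • mode Ω (mode Ω ω j y) (M + k - j - 1 - i) w) (by simp)
  rw [hR, mode_X_mul_eq_add Ω a 1, mode_X_zero_mul, mode_X_zero_mul, mode_X_zero_mul, map_add,
    map_finsum _ (s₁ v), map_finsum _ (s₂ v), smul_add, add_add_add_comm, hfs, hgs, ← hfsh, ← hgsh]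
  simp only [mode_X_zero_mul, smul_add, Finset.sum_add_distrib]
  rw [add_sub_add_comm, ← finsum_sub_distrib (hasFiniteSupport_mode Ω y v k
      (fun i w => mode Ω ω M (q Ω a (-1 - i) w)) (by simp)) (s₁ _), l₁,
    ← finsum_sub_distrib (hasFiniteSupport_q_natCast Ω a v
      (fun i w => mode Ω ω M (mode Ω y (k - 1 - i) w)) (by simp)) (s₂ _), l₂]
  abel

theorem OmegaCovariant.one (M : ℕ) : OmegaCovariant Ω M 1 := by
  intro k v
  simp only [mode_apply_one, map_zero, Pi.zero_apply, LinearMap.zero_apply, smul_zero,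
    Finset.sum_const_zero, mode_one]
  split_ifs <;> simp

theorem OmegaCovariant.add {M : ℕ} {x y : Space ι} (hx : OmegaCovariant Ω M x)
    (hy : OmegaCovariant Ω M y) : OmegaCovariant Ω M (x + y) := by
  intro k v
  have := congrArg₂ (· + ·) (hx k v) (hy k v)
  simp only [map_add, Pi.add_apply, LinearMap.add_apply, smul_add, Finset.sum_add_distrib] at this ⊢
  rw [← this]
  abel_nf

theorem OmegaCovariant.smul {M : ℕ} (c : ℂ) {x : Space ι} (hx : OmegaCovariant Ω M x) :
    OmegaCovariant Ω M (c • x) := by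
  intro k v
  simp only [map_smul, Pi.smul_apply, LinearMap.smul_apply]
  rw [← smul_sub, hx, Finset.smul_sum]
  exact Finset.sum_congr rfl fun j _ => smul_comm _ _ _

theorem omegaCovariant_zero (h : IsSymplectic Ω) (y : Space ι) : OmegaCovariant Ω 0 y := by
  induction y using space_induction_der with
  | one => exact .one 0
  | add x y hx hy => exact hx.add hy
  | smul c x hx => exact hx.smul c
  | der x hx =>
    intro k v
    have := fun k => hx k v
    simp only [zero_add, Finset.range_one, Finset.sum_singleton, Nat.choose_self, Nat.cast_one,
      one_smul, Nat.cast_zero, sub_zero, omega_zero_eq_der h, mode_der] at this ⊢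
    rw [map_smul, ← smul_sub, this]
  | X_mul a x hx => exact hx.X_mul h (by omega) a

/-- Translation covariance. -/
theorem der_mode (h : IsSymplectic Ω) (x : Space ι) (k : ℤ) (v : Space ι) :
    der (mode Ω x k v) - mode Ω x k (der v) = -(k : ℂ) • mode Ω x (k - 1) v := by
  have := omegaCovariant_zero h x k v
  simp only [zero_add, Finset.range_one, Finset.sum_singleton, Nat.choose_self, Nat.cast_one,
    one_smul, Nat.cast_zero, sub_zero, omega_zero_eq_der h] at this
  rw [this, mode_der]

/-- Translation covariance of the field of ω itself; it settles the derivative case for `M = 1` and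
`M = 2`. -/
theorem omega_der (h : IsSymplectic Ω) (k : ℤ) (v : Space ι) :
    mode Ω (omega Ω) k (der v) =
      der (mode Ω (omega Ω) k v) + (k : ℂ) • mode Ω (omega Ω) (k - 1) v := by
  rw [← sub_eq_iff_eq_add', ← neg_sub, der_mode h]
  module

theorem omegaCovariant_one (h : IsSymplectic Ω) (y : Space ι) : OmegaCovariant Ω 1 y := by
  induction y using space_induction_der with
  | one => exact .one 1
  | add x y hx hy => exact hx.add hy
  | smul c x hx => exact hx.smul c
  | der x hx =>
    intro k v
    have := hx (k - 1) v
    simp [Finset.sum_range_succ, omega_zero_eq_der h, mode_der, omega_der h] at this ⊢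
    linear_combination (norm := module) -(k : ℂ) • this
  | X_mul a x hx => exact hx.X_mul h (by omega) a

theorem omegaCovariant_two (h : IsSymplectic Ω) (y : Space ι) : OmegaCovariant Ω 2 y := by
  induction y using space_induction_der with
  | one => exact .one 2
  | add x y hx hy => exact hx.add hy
  | smul c x hx => exact hx.smul c
  | der x hx =>
    intro k v
    have := hx (k - 1) v
    simp [Finset.sum_range_succ, omega_zero_eq_der h, mode_der, omega_der h] at this ⊢
    rw [show 2 + (k - 1) - 1 = k by ring] at this
    rw [show 2 + k - 1 - 1 = k by ring]
    linear_combination (norm := module) -(k : ℂ) • this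
  | X_mul a x hx => exact hx.X_mul h (by omega) a

end Sb

/-! ### Weights, parity and the filtration. -/

namespace Sb

open GradedUnitary MvPolynomial

theorem linearMap_mem_of_support {σ M : Type*} [AddCommGroup M] [Module ℂ M]
    (f : MvPolynomial σ ℂ →ₗ[ℂ] M) (S : Submodule ℂ M) {x : MvPolynomial σ ℂ}
    (h : ∀ u, coeff u x ≠ 0 → f (monomial u 1) ∈ S) : f x ∈ S := by
  rw [x.as_sum, map_sum]
  refine S.sum_mem fun u hu => ?_
  rw [monomial_eq_smul, map_smul]
  exact S.smul_mem _ (h u (mem_support_iff.1 hu))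

theorem exponent_induction {σ : Type*} {P : (σ →₀ ℕ) → Prop} (zero : P 0)
    (add : ∀ p u, P u → P (Finsupp.single p 1 + u)) (u : σ →₀ ℕ) : P u := by
  classical
  have key : ∀ s : Multiset σ, P (Multiset.toFinsupp s) := fun s => by
    induction s using Multiset.induction with
    | empty => simpa using zero
    | cons p s ih =>
      rw [← Multiset.singleton_add, map_add, Multiset.toFinsupp_singleton]
      exact add p _ ih
  simpa using key (Finsupp.toMultiset u)

theorem monomial_single_add {σ : Type*} (p : σ) (u : σ →₀ ℕ) :
    (monomial (Finsupp.single p 1 + u) 1 : MvPolynomial σ ℂ) = X p * monomial u 1 := by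
  rw [X, monomial_mul, mul_one]

variable {ι : Type*}

theorem monomial_mem_wt (u : ι × ℕ →₀ ℕ) (c : ℂ) {d : ℤ}
    (h : Finsupp.weight (fun p : ι × ℕ => (2 * p.2 + 1 : ℤ)) u = d) : monomial u c ∈ wt d :=
  isWeightedHomogeneous_monomial _ _ _ h

theorem mem_filtration_iff {r : ℤ} {x : Space ι} :
    x ∈ filtration r ↔ ∀ u, coeff u x ≠ 0 → (u.degree : ℤ) ≤ r ∧ (2 : ℤ) ∣ r - u.degree := by
  constructor
  · intro hx
    have hle : filtration r ≤
        restrictSupport ℂ {u : ι × ℕ →₀ ℕ | (u.degree : ℤ) ≤ r ∧ (2 : ℤ) ∣ r - u.degree} := by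
      refine iSup₂_le fun l hl y hy => (mem_restrictSupport_iff ℂ).2 fun u hu => ?_
      have : u.degree = l := by
        rw [Finsupp.degree_eq_weight_one]
        exact hy (mem_support_iff.1 hu)
      simpa [this] using hl
    exact fun u hu => (mem_restrictSupport_iff ℂ).1 (hle hx) (mem_support_iff.2 hu)
  · intro h
    refine linearMap_mem_of_support LinearMap.id _ fun u hu => ?_
    exact le_iSup₂ (f := fun (l : ℕ) (_ : (l : ℤ) ≤ r ∧ (2 : ℤ) ∣ r - l) =>
      homogeneousSubmodule (ι × ℕ) ℂ l) u.degree (h u hu) (isHomogeneous_monomial _ rfl)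

theorem mem_z2_iff {α : ZMod 2} {x : Space ι} :
    x ∈ z2 α ↔ ∀ u, coeff u x ≠ 0 → (u.degree : ZMod 2) = α := by
  constructor
  · intro hx
    have hle : z2 α ≤ restrictSupport ℂ {u : ι × ℕ →₀ ℕ | (u.degree : ZMod 2) = α} := by
      refine iSup₂_le fun l hl y hy => (mem_restrictSupport_iff ℂ).2 fun u hu => ?_
      have : u.degree = l := by
        rw [Finsupp.degree_eq_weight_one]
        exact hy (mem_support_iff.1 hu)
      simpa [this] using hl
    exact fun u hu => (mem_restrictSupport_iff ℂ).1 (hle hx) (mem_support_iff.2 hu)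
  · intro h
    refine linearMap_mem_of_support LinearMap.id _ fun u hu => ?_
    exact le_iSup₂ (f := fun (l : ℕ) (_ : (l : ZMod 2) = α) =>
      homogeneousSubmodule (ι × ℕ) ℂ l) u.degree (h u hu) (isHomogeneous_monomial _ rfl)

theorem weight_one_eq_degree {σ M : Type*} [AddCommGroupWithOne M] (u : σ →₀ ℕ) :
    Finsupp.weight (fun _ => (1 : M)) u = u.degree := by
  induction u using exponent_induction with
  | zero => simp
  | add p u hu => rw [map_add, hu, map_add, Finsupp.weight_single, Finsupp.degree_single]; simp

theorem z2_eq (α : ZMod 2) :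
    z2 α = weightedHomogeneousSubmodule ℂ (fun _ : ι × ℕ => (1 : ZMod 2)) α := by
  ext x
  rw [mem_z2_iff, mem_weightedHomogeneousSubmodule]
  simp only [IsWeightedHomogeneous, weight_one_eq_degree]

theorem z2_isInternal : DirectSum.IsInternal (z2 (ι := ι)) := by
  rw [show z2 (ι := ι) = weightedHomogeneousSubmodule ℂ (fun _ : ι × ℕ => (1 : ZMod 2)) from
    funext z2_eq]
  have := weightedDecomposition ℂ (fun _ : ι × ℕ => (1 : ZMod 2))
  exact DirectSum.Decomposition.isInternal _

theorem wt_isInternal : DirectSum.IsInternal (wt (ι := ι)) := by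
  have := weightedDecomposition ℂ (fun p : ι × ℕ => (2 * p.2 + 1 : ℤ))
  exact DirectSum.Decomposition.isInternal
    (weightedHomogeneousSubmodule ℂ (fun p : ι × ℕ => (2 * p.2 + 1 : ℤ)))

theorem wt_apply_nonneg (u : ι × ℕ →₀ ℕ) :
    0 ≤ Finsupp.weight (fun p : ι × ℕ => (2 * p.2 + 1 : ℤ)) u := by
  rw [Finsupp.weight_apply]
  exact Finset.sum_nonneg fun p _ => by positivity

theorem wt_eq_bot {d : ℤ} (hd : d < 0) : wt (ι := ι) d = ⊥ := by
  rw [eq_bot_iff]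
  intro x hx
  refine (Submodule.mem_bot ℂ).2 (MvPolynomial.ext _ _ fun u => ?_)
  by_contra hu
  have := hx (show coeff u x ≠ 0 by simpa using hu)
  have := wt_apply_nonneg u
  omega

theorem wt_finiteDimensional [Finite ι] (d : ℤ) : FiniteDimensional ℂ (wt (ι := ι) d) := by
  classical
  have := Fintype.ofFinite ι
  set s : Set (ι × ℕ →₀ ℕ) := {u | Finsupp.weight (fun p : ι × ℕ => (2 * p.2 + 1 : ℤ)) u = d}
  have hs : s.Finite := by
    -- In an exponent of weight `d`, a variable `X (a, n)` that occurs has both `n` and its exponent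
    -- at most `d`; so all exponents lie in one finite box.
    refine (Set.finite_Iic (∑ p ∈ (Finset.univ : Finset ι) ×ˢ Finset.range (d.toNat + 1),
      Finsupp.single p d.toNat)).subset fun u hu => ?_
    intro p
    by_cases hp : u p = 0
    · simp [hp]
    · have h₁ : (u p : ℤ) * (2 * p.2 + 1) ≤ d := by
        rw [← show _ = d from hu, Finsupp.weight_apply, Finsupp.sum]
        refine le_trans (le_of_eq ?_) (Finset.single_le_sum (f := fun p => u p • (2 * p.2 + 1 : ℤ))
          (fun q _ => by positivity) (Finsupp.mem_support_iff.2 hp))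
        simp
      have h₂ : (1 : ℤ) ≤ u p := by omega
      have h₃ : (u p : ℤ) ≤ d := by nlinarith
      have h₄ : (p.2 : ℤ) ≤ d := by nlinarith
      rw [Finsupp.finsetSum_apply, Finset.sum_eq_single p]
      · rw [Finsupp.single_eq_same]
        omega
      · intro q _ hq
        exact Finsupp.single_eq_of_ne hq.symm
      · intro hc
        refine absurd (Finset.mem_product.2 ⟨Finset.mem_univ _, Finset.mem_range.2 ?_⟩) hc
        omega
  have hle : wt d ≤ restrictSupport ℂ s := fun x hx =>
    (mem_restrictSupport_iff ℂ).2 fun u hu => hx (mem_support_iff.1 hu)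
  have := hs.to_subtype
  have : FiniteDimensional ℂ (restrictSupport ℂ s) :=
    Module.Finite.of_basis (basisRestrictSupport ℂ s)
  exact Submodule.finiteDimensional_of_le hle

theorem X_mul_mem_filtration {r : ℤ} {x : Space ι} (p : ι × ℕ) (hx : x ∈ filtration r) :
    X p * x ∈ filtration (r + 1) := by
  classical
  refine linearMap_mem_of_support (LinearMap.mulLeft ℂ (X p)) _ fun u hu => ?_
  rw [LinearMap.mulLeft_apply, ← monomial_single_add, mem_filtration_iff]
  intro v hv
  rw [mem_filtration_iff] at hx
  obtain ⟨h₁, h₂⟩ := hx u hu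
  rw [coeff_monomial, ne_eq, ite_eq_right_iff, Classical.not_imp] at hv
  rw [← hv.1, map_add, Finsupp.degree_single]
  push_cast
  omega

theorem mem_filtration_of_isWeightedHomogeneous {r l : ℤ} {x : Space ι}
    (hx : IsWeightedHomogeneous (fun _ => (1 : ℤ)) x l) (h₁ : l ≤ r) (h₂ : (2 : ℤ) ∣ r - l) :
    x ∈ filtration r := by
  rw [mem_filtration_iff]
  intro u hu
  rw [← weight_one_eq_degree, hx hu]
  exact ⟨h₁, h₂⟩

theorem filtration_mono {r t : ℤ} (h₁ : r ≤ t) (h₂ : (2 : ℤ) ∣ t - r) :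
    filtration (ι := ι) r ≤ filtration t := fun x hx => by
  rw [mem_filtration_iff] at hx ⊢
  intro u hu
  have := hx u hu
  omega

theorem exists_mem_filtration {α : ZMod 2} {x : Space ι} (hx : x ∈ z2 α) :
    ∃ r : ℤ, (r : ZMod 2) = α ∧ x ∈ filtration r := by
  -- Twice the total degree leaves the parity free and dominates every degree; `α.val` then sets the
  -- parity.
  refine ⟨2 * x.totalDegree + α.val, ?_, ?_⟩
  · push_cast
    rw [ZMod.natCast_val, ZMod.cast_id', id, show (2 : ZMod 2) = 0 from rfl, zero_mul, zero_add]
  · rw [mem_filtration_iff]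
    intro u hu
    have h₁ := mem_z2_iff.1 hx u hu
    have h₂ : u.degree ≤ x.totalDegree := le_totalDegree (mem_support_iff.2 hu)
    refine ⟨by omega, ?_⟩
    rw [← h₁, ZMod.val_natCast]
    omega

theorem filtration_le_z2 (r : ℤ) : filtration (ι := ι) r ≤ z2 (r : ZMod 2) := fun x hx => by
  rw [mem_filtration_iff] at hx
  rw [mem_z2_iff]
  intro u hu
  have := (hx u hu).2
  have h := (ZMod.intCast_zmod_eq_zero_iff_dvd _ 2).2 (by exact_mod_cast this)
  push_cast at h
  exact (sub_eq_zero.1 h).symm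

variable [Fintype ι]

theorem omega_mem_wt (Ω : Matrix ι ι ℂ) : omega Ω ∈ wt 4 := by
  refine Submodule.smul_mem _ _ (sum_mem fun a _ => sum_mem fun b _ => Submodule.smul_mem _ _ ?_)
  exact (isWeightedHomogeneous_X ℂ (fun p : ι × ℕ => (2 * p.2 + 1 : ℤ)) (b, 0)).mul
    (isWeightedHomogeneous_X ℂ (fun p : ι × ℕ => (2 * p.2 + 1 : ℤ)) (a, 1))

variable [DecidableEq ι] (Ω : Matrix ι ι ℂ)

theorem q_annihilation_isWeightedHomogeneous {M : Type*} [AddCommGroup M] {w : ι × ℕ → M} (a : ι)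
    (n : ℕ) {c : M} (hw : ∀ b, w (b, n) = c) {x : Space ι} {d : M}
    (hx : IsWeightedHomogeneous w x d) : IsWeightedHomogeneous w (q Ω a n x) (d - c) := by
  rw [sub_eq_add_neg]
  refine isWeightedHomogeneous_of_leibniz (q_annihilation_one Ω a n) (q_annihilation_mul Ω a n)
    (fun p => ?_) hx
  rw [q_annihilation_X]
  split_ifs with h
  · rw [show w p + -c = 0 by rw [add_neg_eq_zero, ← hw p.1, h] ]
    exact isWeightedHomogeneous_C _ _
  · exact isWeightedHomogeneous_zero _ _ _

theorem mode_mem_wt {d e : ℤ} {x y : Space ι} (hx : x ∈ wt d) (hy : y ∈ wt e) (n : ℤ) :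
    mode Ω x n y ∈ wt (d + e - 2 * n - 2) := by
  have key : ∀ (u : ι × ℕ →₀ ℕ) (e : ℤ) (y : Space ι) (n : ℤ), y ∈ wt e →
      mode Ω (monomial u 1) n y ∈
        wt (Finsupp.weight (fun p : ι × ℕ => (2 * p.2 + 1 : ℤ)) u + e - 2 * n - 2) := by
    intro u
    induction u using exponent_induction with
    | zero =>
      intro e y n hy
      rw [show (monomial 0 1 : Space ι) = 1 from rfl, mode_one]
      split_ifs with h
      · rw [h]
        simpa using hy
      · exact zero_mem _
    | add p u ih =>
      intro e y n hy
      rw [monomial_single_add, mode_X_mul, map_add, Finsupp.weight_single]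
      refine finsum_induction (· ∈ wt _) (zero_mem _) (fun _ _ => add_mem) fun j => ?_
      refine Submodule.smul_mem _ _ (add_mem ?_ (Submodule.smul_mem _ _ ?_))
      · rw [show -p.2 - 1 - (j : ℤ) = -(p.2 + j : ℕ) - 1 by push_cast; ring, q_creation]
        have : _ ∈ wt _ := (isWeightedHomogeneous_X ℂ (fun p : ι × ℕ => (2 * p.2 + 1 : ℤ))
          (p.1, p.2 + j)).mul (ih e y (n + j) hy)
        convert this using 2
        push_cast
        simp only [one_smul]
        ring
      · convert ih (e - (2 * j + 1)) (q Ω p.1 j y) (n - p.2 - 1 - j)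
          (q_annihilation_isWeightedHomogeneous Ω _ _ (fun _ => rfl) hy) using 2
        simp only [one_smul]
        ring
  refine linearMap_mem_of_support (LinearMap.applyₗ y ∘ₗ LinearMap.proj n ∘ₗ mode Ω) _
    fun u hu => ?_
  rw [← hx hu]
  exact key u e y n hy

theorem q_mem_filtration {r : ℤ} {x : Space ι} (a : ι) (n : ℕ) (hx : x ∈ filtration r) :
    q Ω a n x ∈ filtration (r - 1) := by
  refine linearMap_mem_of_support (q Ω a n) _ fun u hu => ?_
  obtain ⟨h₁, h₂⟩ := mem_filtration_iff.1 hx u hu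
  refine mem_filtration_of_isWeightedHomogeneous (q_annihilation_isWeightedHomogeneous Ω a n
    (fun _ => rfl) (isWeightedHomogeneous_monomial _ _ _ (weight_one_eq_degree u))) ?_ ?_ <;> omega

/-- Filtration and goodness are proved by one induction on the monomial. A creation term adds one
generator and raises the mode index from `n` to `n + j`, so `0 ≤ n` persists. -/
theorem mode_mem_filtration_of_le {r t s : ℤ} {x y : Space ι} (hx : x ∈ filtration r)
    (hy : y ∈ filtration t) (n : ℤ) (hs : s = r + t ∨ 0 ≤ n ∧ s = r + t - 2) :
    mode Ω x n y ∈ filtration s := by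
  have key : ∀ (u : ι × ℕ →₀ ℕ) (t s : ℤ) (y : Space ι) (n : ℤ), y ∈ filtration t →
      (s = u.degree + t ∨ 0 ≤ n ∧ s = u.degree + t - 2) →
      mode Ω (monomial u 1) n y ∈ filtration s := by
    intro u
    induction u using exponent_induction with
    | zero =>
      intro t s y n hy hs
      rw [show (monomial 0 1 : Space ι) = 1 from rfl, mode_one]
      split_ifs with h
      · obtain rfl | hs := hs
        · simpa using hy
        · omega
      · exact zero_mem _
    | add p u ih =>
      intro t s y n hy hs
      rw [map_add, Finsupp.degree_single] at hs
      push_cast at hs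
      rw [monomial_single_add, mode_X_mul]
      refine finsum_induction (· ∈ filtration _) (zero_mem _) (fun _ _ => add_mem) fun j => ?_
      refine Submodule.smul_mem _ _ (add_mem ?_ (Submodule.smul_mem _ _ ?_))
      · rw [show -p.2 - 1 - (j : ℤ) = -(p.2 + j : ℕ) - 1 by push_cast; ring, q_creation]
        have := X_mul_mem_filtration (p.1, p.2 + j) (ih t (s - 1) y (n + j) hy (by omega))
        rwa [sub_add_cancel] at this
      -- A contraction removes one generator from each factor, which lowers the doubled degree by 2
      -- whatever the sign of `n`.
      · have := ih (t - 1) (u.degree + (t - 1)) (q Ω p.1 j y) (n - p.2 - 1 - j)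
          (q_mem_filtration Ω _ _ hy) (Or.inl rfl)
        exact filtration_mono (by omega) (by omega) this
  refine linearMap_mem_of_support (LinearMap.applyₗ y ∘ₗ LinearMap.proj n ∘ₗ mode Ω) _
    fun u hu => ?_
  obtain ⟨h₁, h₂⟩ := mem_filtration_iff.1 hx u hu
  have := key u t (s - (r - u.degree)) y n hy (by omega)
  exact filtration_mono (by omega) (by omega) this

theorem mode_mem_z2 {α β : ZMod 2} {x y : Space ι} (hx : x ∈ z2 α) (hy : y ∈ z2 β) (n : ℤ) :
    mode Ω x n y ∈ z2 (α + β) := by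
  obtain ⟨r, rfl, hr⟩ := exists_mem_filtration hx
  obtain ⟨t, rfl, ht⟩ := exists_mem_filtration hy
  rw [← Int.cast_add]
  exact filtration_le_z2 _ (mode_mem_filtration_of_le Ω hr ht n (Or.inl rfl))

variable {Ω}

/-- The action of `L₀ = ω₁`. -/
theorem omega_one_of_mem_wt (h : IsSymplectic Ω) {d : ℤ} {x : Space ι} (hx : x ∈ wt d) :
    mode Ω (omega Ω) 1 x = ((d : ℂ) / 2) • x := by
  have key : ∀ u : ι × ℕ →₀ ℕ, mode Ω (omega Ω) 1 (monomial u 1) =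
      (((Finsupp.weight (fun p : ι × ℕ => (2 * p.2 + 1 : ℤ)) u : ℤ) : ℂ) / 2) • monomial u 1 := by
    intro u
    induction u using exponent_induction with
    | zero =>
      rw [map_zero, show (monomial 0 1 : Space ι) = 1 from rfl]
      simpa using mode_apply_one Ω (omega Ω) 1
    | add p u ih =>
      have := omega_q_comm h p.1 1 (-p.2 - 1) (monomial u 1)
      rw [ih, add_sub_cancel_right, map_smul, q_creation] at this
      rw [monomial_single_add, sub_eq_iff_eq_add.1 this, map_add, Finsupp.weight_single, one_smul]
      push_cast
      module
  have := linearMap_mem_of_support (mode Ω (omega Ω) 1 - ((d : ℂ) / 2) • LinearMap.id) ⊥ (x := x)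
    fun u hu => by
      simp [key, hx hu]
  simpa [sub_eq_zero] using this

end Sb

/-! ### Schur's lemma and the Virasoro relations. -/

namespace Sb

open GradedUnitary MvPolynomial

theorem eq_C_of_pderiv_eq_zero {σ : Type*} {x : MvPolynomial σ ℂ}
    (hx : ∀ p, pderiv p x = 0) : x = C (coeff 0 x) := by
  classical
  ext u
  rw [coeff_C]
  split_ifs with h
  · rw [h]
  · obtain ⟨p, hp⟩ : ∃ p, u p ≠ 0 := by
      by_contra! hc
      exact h (Finsupp.ext fun p => (hc p).symm)
    have hle : Finsupp.single p 1 ≤ u := by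
      rw [Finsupp.single_le_iff]
      omega
    have := coeff_pderiv (i := p) x (u - Finsupp.single p 1)
    rw [hx, coeff_zero, tsub_add_cancel_of_le hle] at this
    have h₂ : ((((u - Finsupp.single p 1 : σ →₀ ℕ) p : ℕ) : ℂ) + 1) ≠ 0 := Nat.cast_add_one_ne_zero _
    exact (mul_eq_zero.1 this.symm).resolve_right h₂

theorem jacobi_identity {R : Type*} [Ring R] (a b c : R) :
    ⁅a, ⁅b, c⁆⁆ + ⁅b, ⁅c, a⁆⁆ + ⁅c, ⁅a, b⁆⁆ = 0 := by
  simp only [Ring.lie_def]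
  noncomm_ring

theorem lie_smul_add_smul_one {ι : Type*} (A B : Module.End ℂ (Space ι)) (c d : ℂ) :
    ⁅A, c • B + d • 1⁆ = c • ⁅A, B⁆ := by
  refine LinearMap.ext fun v => ?_
  simp only [Ring.lie_def, LinearMap.sub_apply, Module.End.mul_apply, LinearMap.add_apply,
    LinearMap.smul_apply, Module.End.one_apply, map_add, map_smul]
  module

variable {ι : Type*} [Fintype ι] [DecidableEq ι] {Ω : Matrix ι ι ℂ}

theorem pderiv_eq_sum_q (h : IsSymplectic Ω) (b : ι) (n : ℕ) (v : Space ι) :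
    pderiv (b, n) v = ∑ a, Ω b a • q Ω a n v := by
  simp only [q_annihilation, Finset.smul_sum, smul_smul]
  rw [Finset.sum_comm]
  simp only [← Finset.sum_smul, h.sum_mul_inv]
  simp

/-- Schur's lemma for the Fock representation of the Heisenberg algebra. -/
theorem eq_smul_of_commute_q (h : IsSymplectic Ω) {Z : Module.End ℂ (Space ι)}
    (hZ : ∀ a k v, Z (q Ω a k v) = q Ω a k (Z v)) : ∃ c : ℂ, Z = c • 1 := by
  refine ⟨coeff 0 (Z 1), LinearMap.ext fun v => ?_⟩
  -- `Z 1` is killed by all annihilators, hence by all partial derivatives since Ω is invertible, so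
  -- it is a multiple of the vacuum.
  have h₁ : Z 1 = C (coeff 0 (Z 1)) := eq_C_of_pderiv_eq_zero fun p => by
    rw [pderiv_eq_sum_q h]
    refine Finset.sum_eq_zero fun a _ => ?_
    rw [← hZ, q_annihilation_one, map_zero, smul_zero]
  induction v using space_induction with
  | one =>
    rw [LinearMap.smul_apply, Module.End.one_apply, smul_eq_C_mul, mul_one]
    exact h₁
  | add x y hx hy => rw [map_add, map_add, hx, hy]
  | smul c x hx => rw [map_smul, map_smul, hx]
  | X_mul a n x hx =>
    rw [← q_creation Ω, hZ, hx]
    simp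

variable (Ω) in
/-- The Virasoro modes `L_m = ω_{m+1}`. -/
def virasoroMode (m : ℤ) : Module.End ℂ (Space ι) := mode Ω (omega Ω) (m + 1)

theorem virasoroMode_q (h : IsSymplectic Ω) (m : ℤ) (a : ι) (k : ℤ) (v : Space ι) :
    virasoroMode Ω m (q Ω a k v) =
      q Ω a k (virasoroMode Ω m v) - ((k : ℂ) + (m + 1) / 2) • q Ω a (k + m) v := by
  have := omega_q_comm h a (m + 1) k v
  rw [show k + (m + 1) - 1 = k + m by ring] at this
  rw [virasoroMode, sub_eq_iff_eq_add.1 this]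
  push_cast
  module

theorem virasoroMode_one (m : ℤ) (hm : -1 ≤ m) : virasoroMode Ω m 1 = 0 := by
  obtain ⟨n, hn⟩ := Int.eq_ofNat_of_zero_le (show 0 ≤ m + 1 by omega)
  rw [virasoroMode, hn]
  exact mode_apply_one Ω _ n

theorem virasoroMode_mem_wt (m : ℤ) {d : ℤ} {x : Space ι} (hx : x ∈ wt d) :
    virasoroMode Ω m x ∈ wt (d - 2 * m) := by
  have := mode_mem_wt Ω (omega_mem_wt Ω) hx (m + 1)
  rwa [show 4 + d - 2 * (m + 1) - 2 = d - 2 * m by ring] at this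

/-- The bracket and `(m - n) L_{m+n}` have the same commutators with every `q^a_k`, so Schur's lemma
applies to their difference. -/
theorem virasoro_up_to_scalar (h : IsSymplectic Ω) (m n : ℤ) : ∃ c : ℂ,
    ⁅virasoroMode Ω m, virasoroMode Ω n⁆ = ((m : ℂ) - n) • virasoroMode Ω (m + n) + c • 1 := by
  obtain ⟨c, hc⟩ := eq_smul_of_commute_q h (Z := ⁅virasoroMode Ω m, virasoroMode Ω n⁆ -
      ((m : ℂ) - n) • virasoroMode Ω (m + n)) fun a k v => by
    simp only [LinearMap.sub_apply, LieRing.of_associative_ring_bracket, Module.End.mul_apply,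
      LinearMap.smul_apply, virasoroMode_q h, map_sub, map_smul]
    rw [show k + m + n = k + (m + n) by ring, show k + n + m = k + (m + n) by ring]
    push_cast
    module
  exact ⟨c, by rw [← hc, add_sub_cancel]⟩

/-- The Virasoro relations; the central charge is determined by `[L₂, L₋₂]`. -/
theorem virasoro (h : IsSymplectic Ω) : ∃ c : ℂ, ∀ m n : ℤ,
    ⁅virasoroMode Ω m, virasoroMode Ω n⁆ = ((m : ℂ) - n) • virasoroMode Ω (m + n) +
      (if m + n = 0 then c / 12 * ((m : ℂ) ^ 3 - m) else 0) • 1 := by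
  choose φ hφ using virasoro_up_to_scalar (Ω := Ω) h
  have hone : ∀ m n v, virasoroMode Ω m (virasoroMode Ω n v) - virasoroMode Ω n (virasoroMode Ω m v) =
      ((m : ℂ) - n) • virasoroMode Ω (m + n) v + φ m n • v := fun m n v => by
    have := congrArg (fun Z : Module.End ℂ (Space ι) => Z v) (hφ m n)
    simpa [LieRing.of_associative_ring_bracket] using this
  -- Applied to the vacuum, the defect has doubled weight `-2(m+n)`, while a scalar multiple of the
  -- vacuum has weight 0.
  have hne : ∀ m n : ℤ, m + n ≠ 0 → φ m n = 0 := fun m n hmn => by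
    have h₁ := hone m n 1
    rw [← sub_eq_iff_eq_add'] at h₁
    have h₀ : (1 : Space ι) ∈ wt 0 := isWeightedHomogeneous_one _ _
    have h₂ : φ m n • (1 : Space ι) ∈ wt (0 - 2 * m - 2 * n) := by
      rw [← h₁]
      refine sub_mem (sub_mem ?_ ?_) (Submodule.smul_mem _ _ ?_)
      · rw [sub_right_comm]
        exact virasoroMode_mem_wt m (virasoroMode_mem_wt n h₀)
      · exact virasoroMode_mem_wt n (virasoroMode_mem_wt m h₀)
      · rw [sub_sub, ← mul_add]
        exact virasoroMode_mem_wt (m + n) h₀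
    by_contra hc
    have := h₂ (d := 0) (by simpa using hc)
    rw [map_zero] at this
    omega
  have hskew : ∀ m n, φ n m = -φ m n := fun m n => by
    have h₁ := hone m n 1
    have h₂ := hone n m 1
    rw [add_comm n m] at h₂
    have h₃ : (φ n m + φ m n) • (1 : Space ι) = 0 := by
      linear_combination (norm := module) -h₁ - h₂
    rw [smul_eq_zero_iff_left one_ne_zero] at h₃
    linear_combination h₃
  have hs₁ : φ 1 (-1) = 0 := by
    have := hone 1 (-1) 1
    simpa [virasoroMode_one] using this.symm
  -- The Jacobi identity for L₁, L_m and L_{-m-1}, evaluated on the vacuum, where L₀ contributes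
  -- nothing.
  have hrec : ∀ m : ℤ, (m - 1 : ℂ) * φ (m + 1) (-(m + 1)) = (m + 2) * φ m (-m) := fun m => by
    have hJ := jacobi_identity (virasoroMode Ω 1) (virasoroMode Ω m) (virasoroMode Ω (-(m + 1)))
    rw [hφ m (-(m + 1)), hφ (-(m + 1)) 1, hφ 1 m, lie_smul_add_smul_one, lie_smul_add_smul_one,
      lie_smul_add_smul_one, show m + -(m + 1) = -1 by ring, show -(m + 1) + 1 = -m by ring,
      add_comm 1 m, hφ, hφ, hφ, hs₁, hskew (m + 1) (-(m + 1)), add_neg_cancel, add_neg_cancel,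
      neg_add_cancel] at hJ
    have := congrArg (fun Z : Module.End ℂ (Space ι) => Z 1) hJ
    simp only [LinearMap.add_apply, LinearMap.smul_apply, virasoroMode_one 0 (by norm_num),
      smul_zero, zero_add, Module.End.one_apply, LinearMap.zero_apply, smul_smul, ← add_smul] at this
    rw [smul_eq_zero_iff_left one_ne_zero] at this
    push_cast at this
    linear_combination this
  -- At `m = 1` the factor `m - 1` vanishes, so the recursion leaves `φ 2 (-2)` free and determines
  -- all later values. The normalization is `c / 12 * (2 ^ 3 - 2) = c / 2`.
  refine ⟨2 * φ 2 (-2), fun m n => ?_⟩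
  rw [hφ]
  congr 2
  have hnat : ∀ k : ℕ, φ (k + 2 : ℤ) (-(k + 2 : ℤ)) = 2 * φ 2 (-2) / 12 * (((k : ℂ) + 2) ^ 3 - (k + 2)) := by
    intro k
    induction k with
    | zero => norm_num; ring
    | succ k ih =>
      have := hrec (k + 2)
      rw [ih] at this
      push_cast at this ⊢
      rw [show (k : ℤ) + 1 + 2 = k + 2 + 1 by ring]
      have hk : (k : ℂ) + 1 ≠ 0 := Nat.cast_add_one_ne_zero k
      refine mul_left_cancel₀ hk ?_
      linear_combination this
  have hpos : ∀ k : ℕ, φ (k : ℤ) (-k) = 2 * φ 2 (-2) / 12 * ((k : ℂ) ^ 3 - k) := by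
    intro k
    obtain _ | _ | k := k
    · have := hskew 0 0
      have : φ 0 0 = 0 := by linear_combination this / 2
      simp [this]
    · simp [hs₁]
    · have := hnat k
      push_cast at this ⊢
      rw [add_assoc, add_assoc]
      norm_num
      rw [← this]
      norm_num
  split_ifs with hmn
  · obtain rfl : n = -m := by omega
    obtain ⟨k, rfl | rfl⟩ := m.eq_nat_or_neg
    · exact_mod_cast hpos k
    · rw [neg_neg, hskew, hpos]
      push_cast
      ring
  · exact hne m n hmn

end Sb

/-! ### Adjoint modes and invariance of the form. -/

namespace Sb

open GradedUnitary MvPolynomial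

variable {ι : Type*}

theorem der_mem_wt {d : ℤ} {x : Space ι} (hx : x ∈ wt d) : der x ∈ wt (d + 2) := by
  refine isWeightedHomogeneous_of_leibniz der_one der_mul (fun p => ?_) hx
  rw [show p = (p.1, p.2) from rfl, der_X]
  refine Submodule.smul_mem (weightedHomogeneousSubmodule ℂ _ _) _ ?_
  have := isWeightedHomogeneous_X ℂ (fun p : ι × ℕ => (2 * p.2 + 1 : ℤ)) (p.1, p.2 + 1)
  rwa [show (2 * ((p.2 + 1 : ℕ) : ℤ) + 1) = 2 * p.2 + 1 + 2 by push_cast; ring] at this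

theorem coeff_zero_X_mul {σ : Type*} (p : σ) (x : MvPolynomial σ ℂ) : coeff 0 (X p * x) = 0 := by
  rw [← constantCoeff_eq, map_mul, constantCoeff_X, zero_mul]

theorem coeff_zero_finsum {σ α : Type*} (f : α → MvPolynomial σ ℂ)
    (hf : Function.HasFiniteSupport f) : coeff 0 (∑ᶠ j, f j) = ∑ᶠ j, coeff 0 (f j) :=
  map_finsum (lcoeff ℂ 0) hf

theorem weight_eq_sum (u : ι × ℕ →₀ ℕ) :
    Finsupp.weight (fun p : ι × ℕ => (2 * p.2 + 1 : ℤ)) u =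
      (u.sum fun p e => e * (2 * p.2 + 1) : ℕ) := by
  rw [Finsupp.weight_apply, Finsupp.sum, Finsupp.sum]
  push_cast
  exact Finset.sum_congr rfl fun p _ => by rw [nsmul_eq_mul]

/-- Induction along sums of weight vectors. -/
theorem wt_induction {P : Space ι → Prop} (add : ∀ x y, P x → P y → P (x + y))
    (mem_wt : ∀ (d : ℕ), ∀ x ∈ wt (d : ℤ), P x) (x : Space ι) : P x :=
  induction_on' x (fun u c => mem_wt _ _ (monomial_mem_wt u c (weight_eq_sum u))) add

theorem eq_of_forall_mem_wt {M : Type*} [AddCommGroup M] [Module ℂ M] {f g : Space ι →ₗ[ℂ] M}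
    (hfg : ∀ (d : ℕ), ∀ x ∈ wt (d : ℤ), f x = g x) (x : Space ι) : f x = g x := by
  induction x using wt_induction with
  | add x y hx hy => rw [map_add, map_add, hx, hy]
  | mem_wt d x hx => exact hfg d x hx

/-- An index shift in the truncated series of exp(L₁). The boundary term vanishes because a high
power of L₁ kills a vector of given weight. -/
theorem sum_inv_factorial_smul_succ {M : Type*} [AddCommGroup M] [Module ℂ M] (e : ℕ → M) {N : ℕ}
    (he : e N = 0) : ∑ k ∈ Finset.range N, ((k.factorial : ℂ)⁻¹) • e (k + 1) =
      ∑ k ∈ Finset.range N, ((k.factorial : ℂ)⁻¹) • (k : ℂ) • e k := by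
  have h₁ := Finset.sum_range_succ' (fun k => ((k.factorial : ℂ)⁻¹) • (k : ℂ) • e k) N
  rw [Finset.sum_range_succ, he] at h₁
  simp only [smul_zero, add_zero, Nat.cast_zero, zero_smul] at h₁
  rw [h₁]
  refine Finset.sum_congr rfl fun k _ => ?_
  have h₂ : (k.factorial : ℂ) ≠ 0 := Nat.cast_ne_zero.2 k.factorial_ne_zero
  have h₃ : ((k : ℂ) + 1) ≠ 0 := Nat.cast_add_one_ne_zero k
  rw [smul_smul, Nat.factorial_succ]
  congr 1
  push_cast
  field_simp

theorem sum_inv_factorial_smul_add {M : Type*} [AddCommGroup M] [Module ℂ M] (e : ℕ → M)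
    (a b : ℕ → ℂ) {N : ℕ} (he : e N = 0) :
    ∑ k ∈ Finset.range N, (((k + 1).factorial : ℂ)⁻¹) •
        (a (k + 1) • e (k + 1) + (((k : ℂ) + 1) * b k) • e k) + a 0 • e 0 =
      ∑ k ∈ Finset.range N, ((k.factorial : ℂ)⁻¹) • (a k + b k) • e k := by
  have h₁ := Finset.sum_range_succ' (fun k => ((k.factorial : ℂ)⁻¹) • a k • e k) N
  rw [Finset.sum_range_succ, he] at h₁
  simp only [smul_zero, add_zero, Nat.factorial_zero, Nat.cast_one, inv_one, one_smul] at h₁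
  simp only [add_smul, smul_add, Finset.sum_add_distrib]
  rw [h₁, add_right_comm]
  congr 1
  refine Finset.sum_congr rfl fun k _ => ?_
  have h₂ : (k.factorial : ℂ) ≠ 0 := Nat.cast_ne_zero.2 k.factorial_ne_zero
  have h₃ : ((k : ℂ) + 1) ≠ 0 := Nat.cast_add_one_ne_zero k
  rw [smul_smul, smul_smul, Nat.factorial_succ]
  congr 1
  push_cast
  field_simp

variable [Fintype ι] [DecidableEq ι] {Ω : Matrix ι ι ℂ}

/-- The coefficient `k + (m+1)/2` of the commutator is zero for `k = -1` and `m = 1`. Hence exp(L₁)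
passes through multiplication by a lowest generator. -/
theorem virasoroMode_one_X_mul (h : IsSymplectic Ω) (a : ι) (x : Space ι) :
    virasoroMode Ω 1 (X (a, 0) * x) = X (a, 0) * virasoroMode Ω 1 x := by
  have := virasoroMode_q h 1 a (-(0 : ℕ) - 1) x
  rw [q_creation, q_creation] at this
  rw [this]
  norm_num

theorem virasoroMode_one_pow_X_mul (h : IsSymplectic Ω) (a : ι) (x : Space ι) (k : ℕ) :
    (virasoroMode Ω 1 ^ k) (X (a, 0) * x) = X (a, 0) * (virasoroMode Ω 1 ^ k) x := by
  induction k with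
  | zero => rfl
  | succ k ih => rw [pow_succ', Module.End.mul_apply, ih, virasoroMode_one_X_mul h,
      Module.End.mul_apply]

theorem virasoroMode_one_pow_mem_wt {d : ℤ} {x : Space ι} (hx : x ∈ wt d) (k : ℕ) :
    (virasoroMode Ω 1 ^ k) x ∈ wt (d - 2 * k) := by
  induction k with
  | zero => simpa using hx
  | succ k ih =>
    rw [pow_succ', Module.End.mul_apply]
    have := virasoroMode_mem_wt (Ω := Ω) 1 ih
    rwa [show d - 2 * k - 2 * 1 = d - 2 * ((k + 1 : ℕ) : ℤ) by push_cast; ring] at this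

theorem virasoroMode_one_pow_eq_zero {d k : ℕ} {x : Space ι} (hx : x ∈ wt d) (hk : d < k) :
    (virasoroMode Ω 1 ^ k) x = 0 := by
  have := virasoroMode_one_pow_mem_wt (Ω := Ω) hx k
  rwa [wt_eq_bot (by omega), Submodule.mem_bot] at this

theorem virasoroMode_one_der (h : IsSymplectic Ω) {d : ℤ} {x : Space ι} (hx : x ∈ wt d) :
    virasoroMode Ω 1 (der x) = der (virasoroMode Ω 1 x) + (d : ℂ) • x := by
  have := omega_der h 2 x
  rw [show (2 : ℤ) - 1 = 1 by norm_num, omega_one_of_mem_wt h hx, smul_smul] at this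
  rw [virasoroMode, show (1 : ℤ) + 1 = 2 by norm_num, this]
  congr 2
  push_cast
  ring

/-- The relation [L₁, ∂] = 2 L₀, iterated: L₁^j x has doubled weight `d - 2j`, and these numbers for
`j ≤ k` sum to `(k+1)(d-k)`. -/
theorem virasoroMode_one_pow_der (h : IsSymplectic Ω) {d : ℤ} {x : Space ι} (hx : x ∈ wt d)
    (k : ℕ) : (virasoroMode Ω 1 ^ (k + 1)) (der x) = der ((virasoroMode Ω 1 ^ (k + 1)) x) +
      (((k : ℂ) + 1) * (d - k)) • (virasoroMode Ω 1 ^ k) x := by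
  induction k with
  | zero => simp [virasoroMode_one_der h hx]
  | succ k ih =>
    have hp : ∀ j y, virasoroMode Ω 1 ((virasoroMode Ω 1 ^ j) y) = (virasoroMode Ω 1 ^ (j + 1)) y :=
      fun j y => by rw [pow_succ', Module.End.mul_apply]
    rw [← hp, ih, map_add, map_smul,
      virasoroMode_one_der h (virasoroMode_one_pow_mem_wt hx (k + 1)), hp, hp]
    push_cast
    module

variable (Ω) in
/-- The modes `x(m)†` of the field
`Y(exp (z L₁) (exp (i π) z⁻²) ^ L₀ x, z⁻¹)`, the adjoints of the modes `x(m)`. -/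
def dagger (m : ℤ) : Space ι →ₗ[ℂ] Module.End ℂ (Space ι) :=
  (basisMonomials (ι × ℕ) ℂ).constr ℂ fun u =>
    let d : ℕ := u.sum fun p e => e * (2 * p.2 + 1)
    (Complex.I ^ d : ℂ) • ∑ k ∈ Finset.range (d + 1), ((k.factorial : ℂ)⁻¹) •
      mode Ω ((virasoroMode Ω 1 ^ k) (monomial u 1)) (d - m - 2 - k)

/-- The cutoff in the definition may be replaced by any `N > d`, so that states of different weights
can be compared over one range. -/
theorem dagger_of_mem_wt {d N : ℕ} (hN : d < N) {x : Space ι} (hx : x ∈ wt d) (m : ℤ) :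
    dagger Ω m x = (Complex.I ^ d : ℂ) • ∑ k ∈ Finset.range N, ((k.factorial : ℂ)⁻¹) •
      mode Ω ((virasoroMode Ω 1 ^ k) x) (d - m - 2 - k) := by
  let g : Space ι →ₗ[ℂ] Module.End ℂ (Space ι) :=
    (Complex.I ^ d : ℂ) • ∑ k ∈ Finset.range N, ((k.factorial : ℂ)⁻¹) •
      (LinearMap.proj (d - m - 2 - k : ℤ) ∘ₗ mode Ω ∘ₗ (virasoroMode Ω 1 ^ k))
  have hg : ∀ x, g x = (Complex.I ^ d : ℂ) • ∑ k ∈ Finset.range N, ((k.factorial : ℂ)⁻¹) •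
      mode Ω ((virasoroMode Ω 1 ^ k) x) (d - m - 2 - k) := fun x => by
    simp [g, LinearMap.sum_apply]
  rw [← hg, ← sub_eq_zero, ← LinearMap.sub_apply, ← Submodule.mem_bot ℂ]
  refine linearMap_mem_of_support _ _ fun u hu => ?_
  have hd : (u.sum fun p e => e * (2 * p.2 + 1)) = d := by
    have := hx hu
    rw [weight_eq_sum] at this
    exact_mod_cast this
  rw [Submodule.mem_bot, LinearMap.sub_apply, sub_eq_zero, hg, dagger]
  rw [show (monomial u 1 : Space ι) = basisMonomials (ι × ℕ) ℂ u by simp, Module.Basis.constr_basis]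
  simp only [coe_basisMonomials, hd]
  congr 1
  refine Finset.sum_subset (Finset.range_subset_range.2 hN) fun k _ hk => ?_
  have hwt : (monomial u 1 : Space ι) ∈ wt d :=
    monomial_mem_wt u 1 (by rw [weight_eq_sum, hd])
  rw [virasoroMode_one_pow_eq_zero hwt (by simpa using hk)]
  simp

theorem form_eq (x y : Space ι) : form Ω x y = coeff 0 (dagger Ω (-1) x y) := by
  have : form Ω = (LinearMap.llcomp ℂ (Space ι) (Space ι) ℂ (lcoeff ℂ 0)) ∘ₗ dagger Ω (-1) := by
    refine (basisMonomials (ι × ℕ) ℂ).ext fun u => LinearMap.ext fun v => ?_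
    rw [LinearMap.comp_apply, form, dagger, Module.Basis.constr_basis, Module.Basis.constr_basis]
    simp only [LinearMap.llcomp_apply, map_smul, LinearMap.smul_apply, LinearMap.sum_apply, map_sum,
      LinearMap.comp_apply]
    congr 1
    refine Finset.sum_congr rfl fun k _ => ?_
    rw [sub_neg_eq_add, show ∀ d : ℤ, d + 1 - 2 - k = d - 1 - k by intro d; ring]
    rfl
  rw [this]
  rfl

theorem dagger_one (m : ℤ) (v : Space ι) : dagger Ω m 1 v = if m = -1 then v else 0 := by
  rw [dagger_of_mem_wt (d := 0) zero_lt_one (isWeightedHomogeneous_one _ _)]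
  simp only [pow_zero, one_smul, Finset.range_one, Finset.sum_singleton, Nat.factorial_zero,
    Nat.cast_one, inv_one, Module.End.one_apply, mode_one]
  congr 1
  simp only [eq_iff_iff]
  push_cast
  omega

/-- The recursion that `mode_der` forces on adjoints. The sign comes from `I ^ (d + 2) = -I ^ d`. -/
theorem dagger_der (h : IsSymplectic Ω) (m : ℤ) (x v : Space ι) :
    dagger Ω m (der x) v = -(m : ℂ) • dagger Ω (m - 1) x v := by
  refine eq_of_forall_mem_wt (f := LinearMap.applyₗ v ∘ₗ dagger Ω m ∘ₗ der)
    (g := -(m : ℂ) • (LinearMap.applyₗ v ∘ₗ dagger Ω (m - 1))) (fun d x hx => ?_) x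
  have hdx : der x ∈ wt ((d + 2 : ℕ) : ℤ) := der_mem_wt hx
  have := sum_inv_factorial_smul_add
    (fun k => mode Ω ((virasoroMode Ω 1 ^ k) x) (d - m - 1 - k) v)
    (fun k => -((d : ℂ) - m - k)) (fun k => (d : ℂ) - k) (N := d + 2)
    (by simp [virasoroMode_one_pow_eq_zero hx])
  simp only [LinearMap.comp_apply, LinearMap.applyₗ_apply_apply, LinearMap.smul_apply]
  rw [dagger_of_mem_wt (N := d + 3) (by omega) hdx, dagger_of_mem_wt (N := d + 2) (by omega) hx,
    Finset.sum_range_succ']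
  simp only [LinearMap.smul_apply, LinearMap.add_apply, LinearMap.sum_apply,
    virasoroMode_one_pow_der h hx, map_add, map_smul, Pi.add_apply, Pi.smul_apply,
    mode_der, pow_zero, Module.End.one_apply, Nat.factorial_zero, Nat.cast_one, inv_one, one_smul]
  have e₁ : ∀ k : ℕ, ((d + 2 : ℕ) : ℤ) - m - 2 - ((k + 1 : ℕ) : ℤ) = d - m - 1 - k := fun k => by
    push_cast
    ring
  have e₂ : ∀ k : ℕ, (d : ℤ) - m - 1 - k - 1 = d - m - 1 - (k + 1 : ℕ) := fun k => by
    push_cast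
    ring
  have e₃ : ((d + 2 : ℕ) : ℤ) - m - 2 - ((0 : ℕ) : ℤ) - 1 = d - m - 1 - (0 : ℕ) := by
    push_cast
    ring
  have e₄ : ∀ k : ℕ, (d : ℤ) - (m - 1) - 2 - k = d - m - 1 - k := fun k => by ring
  simp only [e₁, e₂, e₃, e₄]
  -- Differentiating the field and commuting L₁^k past ∂ give coefficients whose sum does not depend
  -- on `k`.
  have e₅ : ∀ k : ℕ, -((d : ℂ) - m - k) + (d - k) = m := fun k => by ring
  have e₆ : ∀ k : ℕ, -(((d : ℤ) - m - 1 - k : ℤ) : ℂ) = -((d : ℂ) - m - (k + 1 : ℕ)) := fun k => by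
    push_cast
    ring
  have e₇ : -((((d + 2 : ℕ) : ℤ) - m - 2 - ((0 : ℕ) : ℤ) : ℤ) : ℂ) = -((d : ℂ) - m - (0 : ℕ)) := by
    push_cast
    ring
  simp only [e₅, pow_zero, Module.End.one_apply] at this
  simp only [e₆, e₇]
  rw [Int.cast_natCast, this, pow_add, Complex.I_sq]
  simp only [smul_comm _ (m : ℂ), ← Finset.smul_sum]
  module

theorem dagger_eventually_zero (x v : Space ι) :
    ∃ N : ℕ, ∀ m : ℤ, m ≤ -N → dagger Ω m x v = 0 := by
  induction x using wt_induction with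
  | add x y hx hy =>
    obtain ⟨N₁, h₁⟩ := hx
    obtain ⟨N₂, h₂⟩ := hy
    exact ⟨N₁ + N₂, fun m hm => by
      rw [map_add, LinearMap.add_apply, h₁ m (by omega), h₂ m (by omega), add_zero]⟩
  | mem_wt d x hx =>
    choose N hN using fun k => mode_eventually_zero Ω ((virasoroMode Ω 1 ^ k) x) v
    refine ⟨∑ k ∈ Finset.range (d + 1), (N k + k + 2), fun m hm => ?_⟩
    rw [dagger_of_mem_wt (N := d + 1) d.lt_succ_self hx, LinearMap.smul_apply, LinearMap.sum_apply]
    refine smul_eq_zero_of_right _ (Finset.sum_eq_zero fun k hk => ?_)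
    rw [LinearMap.smul_apply, hN k, smul_zero]
    have := Finset.single_le_sum (f := fun k => N k + k + 2) (fun _ _ => Nat.zero_le _) hk
    omega

theorem hasFiniteSupport_dagger (x v : Space ι) (m : ℤ) (g : ℕ → Space ι → Space ι)
    (hg : ∀ j, g j 0 = 0) :
    Function.HasFiniteSupport fun j => g j (dagger Ω (m - 1 - j) x v) := by
  obtain ⟨N, hN⟩ := dagger_eventually_zero (Ω := Ω) x v
  exact hasFiniteSupport_of_forall_ge (N + m.natAbs) fun j hj => by rw [hN _ (by omega), hg]

/-- The adjoint counterpart of `mode_X_zero_mul`: the exponential of L₁ acts on `x` alone, the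
additional weight 1/2 contributes the factor i, and z → z⁻¹ exchanges creators and annihilators of
`q^a`. -/
theorem dagger_X_mul (h : IsSymplectic Ω) (a : ι) (m : ℤ) (x v : Space ι) :
    dagger Ω m (X (a, 0) * x) v = Complex.I • (∑ᶠ j : ℕ, dagger Ω (m + j) x (q Ω a j v) +
      ∑ᶠ j : ℕ, q Ω a (-1 - j) (dagger Ω (m - 1 - j) x v)) := by
  induction x using wt_induction with
  | add x y hx hy =>
    rw [mul_add, map_add, LinearMap.add_apply, hx, hy, ← smul_add, add_add_add_comm]
    simp only [map_add, LinearMap.add_apply]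
    rw [finsum_add_distrib (hasFiniteSupport_q_natCast Ω a v (fun j => dagger Ω (m + j) x) (by simp))
      (hasFiniteSupport_q_natCast Ω a v (fun j => dagger Ω (m + j) y) (by simp)),
      finsum_add_distrib (hasFiniteSupport_dagger x v m (fun j => q Ω a (-1 - j)) (by simp))
      (hasFiniteSupport_dagger y v m (fun j => q Ω a (-1 - j)) (by simp))]
  | mem_wt d x hx =>
    have hX : X (a, 0) * x ∈ wt ((d + 1 : ℕ) : ℤ) := by
      have := (isWeightedHomogeneous_X ℂ (fun p : ι × ℕ => (2 * p.2 + 1 : ℤ)) (a, 0)).mul hx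
      rwa [show 2 * ((a, 0) : ι × ℕ).2 + 1 + (d : ℤ) = ((d + 1 : ℕ) : ℤ) by
        push_cast
        ring] at this
    rw [dagger_of_mem_wt (N := d + 2) (by omega) hX]
    simp only [dagger_of_mem_wt (N := d + 2) (by omega) hx, virasoroMode_one_pow_X_mul h,
      LinearMap.smul_apply, LinearMap.sum_apply, mode_X_zero_mul, map_smul, map_sum]
    rw [pow_succ', mul_smul, ← smul_finsum, ← smul_finsum, ← smul_add]
    congr 2
    rw [finsum_sum_comm _ _ fun (k : ℕ) _ => hasFiniteSupport_q_natCast Ω a v (fun j y => ((k.factorial : ℂ)⁻¹) •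
        mode Ω ((virasoroMode Ω 1 ^ k) x) (d - (m + j) - 2 - k) y) (by simp),
      finsum_sum_comm _ _ fun (k : ℕ) _ => by
        have := hasFiniteSupport_mode Ω ((virasoroMode Ω 1 ^ k) x) v (d - (m - 1) - 2 - k)
          (fun j y => ((k.factorial : ℂ)⁻¹) • q Ω a (-1 - j) y) (by simp)
        refine this.subset fun j hj => ?_
        rw [Function.mem_support] at hj ⊢
        rwa [show (d : ℤ) - (m - 1) - 2 - k + j = d - (m - 1 - j) - 2 - k by ring],
      ← Finset.sum_add_distrib]
    refine Finset.sum_congr rfl fun k _ => ?_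
    rw [← smul_finsum, ← smul_finsum, ← smul_add, add_comm]
    congr 2
    · refine finsum_congr fun j => ?_
      rw [show ((d + 1 : ℕ) : ℤ) - m - 2 - k - 1 - j = d - (m + j) - 2 - k by push_cast; ring]
    · refine finsum_congr fun j => ?_
      rw [show ((d + 1 : ℕ) : ℤ) - m - 2 - k + j = d - (m - 1 - j) - 2 - k by push_cast; ring]

/-- Translation covariance read on the adjoint side, with L₁ in the role of the adjoint of ∂. It
follows from covariance under `ω_2` after resumming the exponential. -/
theorem virasoroMode_one_dagger (h : IsSymplectic Ω) (m : ℤ) (x v : Space ι) :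
    virasoroMode Ω 1 (dagger Ω m x v) - dagger Ω m x (virasoroMode Ω 1 v) =
      (m : ℂ) • dagger Ω (m - 1) x v := by
  refine eq_of_forall_mem_wt
    (f := virasoroMode Ω 1 ∘ₗ LinearMap.applyₗ v ∘ₗ dagger Ω m -
      LinearMap.applyₗ (virasoroMode Ω 1 v) ∘ₗ dagger Ω m)
    (g := (m : ℂ) • (LinearMap.applyₗ v ∘ₗ dagger Ω (m - 1))) (fun d x hx => ?_) x
  have := sum_inv_factorial_smul_succ
    (fun k => mode Ω ((virasoroMode Ω 1 ^ k) x) (d - m - 1 - k) v) (N := d + 2)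
    (by simp [virasoroMode_one_pow_eq_zero hx])
  have hc : ∀ k : ℕ, virasoroMode Ω 1 (mode Ω ((virasoroMode Ω 1 ^ k) x) (d - m - 2 - k) v) -
      mode Ω ((virasoroMode Ω 1 ^ k) x) (d - m - 2 - k) (virasoroMode Ω 1 v) =
      mode Ω ((virasoroMode Ω 1 ^ (k + 1)) x) (d - m - 1 - (k + 1 : ℕ)) v +
        ((m : ℂ) - k) • mode Ω ((virasoroMode Ω 1 ^ k) x) (d - m - 1 - k) v := fun k => by
    have := omegaCovariant_two h ((virasoroMode Ω 1 ^ k) x) (d - m - 2 - k) v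
    simp only [Finset.sum_range_succ, Finset.sum_range_zero, zero_add] at this
    rw [Nat.cast_zero, Nat.cast_one, omega_zero_eq_der h,
      omega_one_of_mem_wt h (virasoroMode_one_pow_mem_wt hx k), mode_der] at this
    simp only [map_smul, Pi.smul_apply, LinearMap.smul_apply] at this
    change virasoroMode Ω 1 _ - mode Ω _ _ (virasoroMode Ω 1 v) = _ + _ +
      _ • mode Ω (virasoroMode Ω 1 ((virasoroMode Ω 1 ^ k) x)) _ v at this
    rw [← Module.End.mul_apply (virasoroMode Ω 1) (virasoroMode Ω 1 ^ k), ← pow_succ'] at this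
    rw [this, show ((2 : ℕ) : ℤ) + (d - m - 2 - k) - 0 - 1 = d - m - 1 - k by push_cast; ring,
      show ((2 : ℕ) : ℤ) + (d - m - 2 - k) - 1 = d - m - 1 - k by push_cast; ring,
      show ((2 : ℕ) : ℤ) + (d - m - 2 - k) - (2 : ℕ) = d - m - 1 - (k + 1 : ℕ) by push_cast; ring]
    norm_num
    module
  simp only [LinearMap.comp_apply, LinearMap.applyₗ_apply_apply, LinearMap.smul_apply,
    LinearMap.sub_apply]
  rw [dagger_of_mem_wt (N := d + 2) (by omega) hx, dagger_of_mem_wt (N := d + 2) (by omega) hx]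
  simp only [LinearMap.smul_apply, LinearMap.sum_apply, map_smul, map_sum]
  rw [← smul_sub, ← Finset.sum_sub_distrib]
  simp only [← smul_sub, hc]
  rw [smul_comm (m : ℂ)]
  congr 1
  simp only [smul_add, Finset.sum_add_distrib]
  rw [this, ← Finset.sum_add_distrib]
  rw [Finset.smul_sum]
  refine Finset.sum_congr rfl fun k _ => ?_
  rw [show (d : ℤ) - (m - 1) - 2 - k = d - m - 1 - k by ring]
  module

theorem coeff_zero_virasoroMode_one (h : IsSymplectic Ω) (x : Space ι) :
    coeff 0 (virasoroMode Ω 1 x) = 0 := by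
  induction x using space_induction with
  | one => rw [virasoroMode_one 1 (by norm_num), coeff_zero]
  | add x y hx hy => rw [map_add, coeff_add, hx, hy, add_zero]
  | smul c x hx => rw [map_smul, coeff_smul, hx, smul_zero]
  | X_mul a n x hx =>
    rw [← q_creation Ω, virasoroMode_q h, q_creation, coeff_sub, coeff_zero_X_mul, coeff_smul]
    obtain _ | n := n
    · norm_num
    · rw [show -((n + 1 : ℕ) : ℤ) - 1 + 1 = -n - 1 by push_cast; ring, q_creation,
        coeff_zero_X_mul, smul_zero, sub_zero]

/-- Dual to the vanishing of nonnegative modes on the vacuum: ⟨0| is killed from the right by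
creation operators, and the remaining terms keep a nonnegative index. -/
theorem coeff_zero_dagger (h : IsSymplectic Ω) (m : ℕ) (x v : Space ι) :
    coeff 0 (dagger Ω m x v) = 0 := by
  induction x using space_induction_der generalizing m v with
  | one => rw [dagger_one, if_neg (by omega), coeff_zero]
  | add x y hx hy => rw [map_add, LinearMap.add_apply, coeff_add, hx, hy, add_zero]
  | smul c x hx => rw [map_smul, LinearMap.smul_apply, coeff_smul, hx, smul_zero]
  | der x hx =>
    rw [dagger_der h, coeff_smul]
    obtain _ | m := m
    · simp
    · rw [Nat.cast_succ, add_sub_cancel_right, hx, smul_zero]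
  | X_mul a x hx =>
    rw [dagger_X_mul h, coeff_smul, coeff_add]
    have h₁ : coeff 0 (∑ᶠ j : ℕ, dagger Ω (m + j) x (q Ω a j v)) = 0 := by
      rw [coeff_zero_finsum _ (hasFiniteSupport_q_natCast Ω a v (fun j => dagger Ω (m + j) x)
        (by simp))]
      exact (finsum_congr fun j => by exact_mod_cast hx (m + j) _).trans finsum_zero
    rw [h₁, coeff_zero_finsum _ (hasFiniteSupport_dagger x v m (fun j => q Ω a (-1 - j)) (by simp)),
      finsum_congr fun j : ℕ => show coeff 0 (q Ω a (-1 - j) _) = 0 by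
        rw [show (-1 - j : ℤ) = -j - 1 by ring, q_creation, coeff_zero_X_mul] ]
    rw [finsum_zero, add_zero, smul_zero]

theorem form_one (y : Space ι) : form Ω 1 y = coeff 0 y := by
  rw [form_eq, dagger_one, if_pos rfl]

/-- The commutator of L₁ with the adjoint mode of index -1, paired with ⟨0|, which L₁ annihilates
from the right. -/
theorem form_der (h : IsSymplectic Ω) (x y : Space ι) :
    form Ω (der x) y = form Ω x (virasoroMode Ω 1 y) := by
  have := congrArg (coeff 0) (virasoroMode_one_dagger h (-1) x y)
  rw [coeff_sub, coeff_zero_virasoroMode_one h, coeff_smul] at this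
  rw [form_eq, form_eq, dagger_der h, coeff_smul]
  push_cast at this ⊢
  rw [smul_eq_mul] at this ⊢
  linear_combination this

theorem form_X_zero_mul (h : IsSymplectic Ω) (a : ι) (x y : Space ι) :
    form Ω (X (a, 0) * x) y = Complex.I * form Ω x (q Ω a 0 y) := by
  rw [form_eq, form_eq, dagger_X_mul h, coeff_smul, smul_eq_mul, coeff_add,
    coeff_zero_finsum _ (hasFiniteSupport_q_natCast Ω a y (fun j => dagger Ω (-1 + j) x) (by simp)),
    coeff_zero_finsum _ (hasFiniteSupport_dagger x y (-1) (fun j => q Ω a (-1 - j)) (by simp)),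
    finsum_eq_single _ 0 fun j hj => ?_, finsum_congr fun j : ℕ => show coeff 0 (q Ω a (-1 - j) _) = 0 by
        rw [show (-1 - j : ℤ) = -j - 1 by ring, q_creation, coeff_zero_X_mul] ]
  · simp
  · obtain ⟨j, rfl⟩ := Nat.exists_eq_succ_of_ne_zero hj
    rw [show (-1 + (j.succ : ℤ)) = (j : ℕ) by push_cast; ring, coeff_zero_dagger h]

/-- Only `n = 0` needs the definition of the form. Since ∂ is adjoint to L₁, writing `(n+1) X (a,
n+1)` as the commutator of ∂ with `X (a, n)` raises `n`. -/
theorem form_X_mul (h : IsSymplectic Ω) (a : ι) (n : ℕ) (x y : Space ι) :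
    form Ω (X (a, n) * x) y = Complex.I * form Ω x (q Ω a n y) := by
  induction n generalizing x y with
  | zero => exact form_X_zero_mul h a x y
  | succ n ih =>
    have hc := virasoroMode_q h 1 a n y
    have h₁ := form_der h (X (a, n) * x) y
    rw [der_mul, der_X, smul_mul_assoc, map_add, LinearMap.add_apply, map_smul,
      LinearMap.smul_apply, ih, ih, form_der h, hc, map_sub, map_smul, smul_eq_mul,
      smul_eq_mul] at h₁
    have hn : ((n : ℂ) + 1) ≠ 0 := Nat.cast_add_one_ne_zero n
    refine mul_left_cancel₀ hn ?_
    push_cast at h₁ ⊢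
    linear_combination h₁

/-- For creators this is `form_X_mul`. For annihilators the generators of `x` are moved to the right
one at a time, which also decides the pairing with the vacuum. -/
theorem form_q (h : IsSymplectic Ω) (a : ι) (k : ℤ) (x y : Space ι) :
    form Ω (q Ω a k x) y = Complex.I * form Ω x (q Ω a (-1 - k) y) := by
  obtain ⟨n, rfl⟩ | ⟨n, rfl⟩ := int_cases k
  · rw [show -1 - (n : ℤ) = -n - 1 by ring, q_creation]
    induction x using space_induction generalizing y with
    | one => rw [q_annihilation_one, form_one, coeff_zero_X_mul]; simp
    | add u v hu hv => simp only [map_add, LinearMap.add_apply, hu, hv, mul_add]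
    | smul c u hu => simp only [map_smul, LinearMap.smul_apply, hu, smul_eq_mul]; ring
    | X_mul b j x hx =>
      have hc := q_annihilation_mul Ω b j (X (a, n)) y
      rw [q_annihilation_mul, q_annihilation_X, map_add, LinearMap.add_apply, form_X_mul h,
        form_X_mul h, hx, hc, q_annihilation_X]
      by_cases hj : n = j
      -- The contractions on the two sides agree because the sign of `i² = -1` cancels the skewness
      -- of `Ω⁻¹`.
      · rw [if_pos hj, if_pos hj.symm, ← smul_eq_C_mul, ← smul_eq_C_mul, h.skew_inv a b, map_smul, map_add, map_smul]
        simp only [LinearMap.smul_apply, smul_eq_mul]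
        linear_combination (Ω⁻¹ a b * form Ω x y) * Complex.I_sq
      · rw [if_neg hj, if_neg (Ne.symm hj)]
        simp
  · rw [q_creation, form_X_mul h, show -1 - (-(n : ℤ) - 1) = n by ring]

/-- Modes and adjoint modes obey matching recursions in the state, so the relation for the
generating fields propagates to all fields. -/
theorem form_mode (h : IsSymplectic Ω) (x : Space ι) (m : ℤ) (u v : Space ι) :
    form Ω (mode Ω x m u) v = form Ω u (dagger Ω m x v) := by
  induction x using space_induction_der generalizing m u v with
  | one =>
    rw [mode_one, dagger_one]
    split_ifs <;> simp
  | add x y hx hy => simp only [map_add, LinearMap.add_apply, Pi.add_apply, hx, hy]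
  | smul c x hx => simp only [map_smul, LinearMap.smul_apply, Pi.smul_apply, hx]
  | der x hx =>
    rw [mode_der, dagger_der h, map_smul, LinearMap.smul_apply, hx, map_smul]
  | X_mul a x hx =>
    have h₁ := hasFiniteSupport_mode Ω x u m (fun j => q Ω a (-1 - j)) (by simp)
    have h₂ := hasFiniteSupport_q_natCast Ω a u (fun j => mode Ω x (m - 1 - j)) (by simp)
    have h₃ := hasFiniteSupport_q_natCast Ω a v (fun j => dagger Ω (m + j) x) (by simp)
    have h₄ := hasFiniteSupport_dagger (Ω := Ω) x v m (fun j => q Ω a (-1 - j)) (by simp)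
    have hf : ∀ f : ℕ → Space ι, Function.HasFiniteSupport f →
        form Ω (∑ᶠ j, f j) v = ∑ᶠ j, form Ω (f j) v := fun f hf =>
      map_finsum ((form Ω).flip v) hf
    rw [mode_X_zero_mul, dagger_X_mul h, map_add, LinearMap.add_apply, map_smul, map_add, hf _ h₁,
      hf _ h₂, map_finsum _ h₃, map_finsum _ h₄, smul_add, smul_finsum, smul_finsum]
    congr 1
    · refine finsum_congr fun j => ?_
      rw [form_q h, hx, smul_eq_mul, sub_sub_cancel]
    · refine finsum_congr fun j => ?_
      rw [hx, form_q h, smul_eq_mul]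

/-- L₁ω is the contraction of the skew matrix Ω with the symmetric products `X (b, 0) * X (a, 0)`.
Since ω is thus quasi-primary, only the leading term of its adjoint modes survives. -/
theorem virasoroMode_one_omega (h : IsSymplectic Ω) : virasoroMode Ω 1 (omega Ω) = 0 := by
  have hX : ∀ a b, virasoroMode Ω 1 (X (b, 0) * X (a, 1)) = X (b, 0) * X (a, 0) := fun a b => by
    have := virasoroMode_q h 1 a (-(1 : ℕ) - 1) 1
    rw [q_creation, mul_one, virasoroMode_one 1 (by norm_num), map_zero,
      show -((1 : ℕ) : ℤ) - 1 + 1 = -(0 : ℕ) - 1 by norm_num, q_creation, mul_one] at this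
    rw [virasoroMode_one_X_mul h, this]
    norm_num
  have h₁ : ∑ a, ∑ b, Ω a b • (X (b, 0) * X (a, 0) : Space ι) =
      -∑ a, ∑ b, Ω a b • (X (b, 0) * X (a, 0) : Space ι) := by
    conv_lhs => rw [Finset.sum_comm]
    simp only [← Finset.sum_neg_distrib]
    refine Finset.sum_congr rfl fun a _ => Finset.sum_congr rfl fun b _ => ?_
    rw [h.skew a b, neg_smul, mul_comm]
  simp only [omega, map_smul, map_sum, hX]
  rw [self_eq_neg.1 h₁, smul_zero]

theorem dagger_omega (h : IsSymplectic Ω) (m : ℤ) :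
    dagger Ω (m + 1) (omega Ω) = virasoroMode Ω (-m) := by
  rw [dagger_of_mem_wt (d := 4) (N := 5) (by norm_num) (omega_mem_wt Ω), Complex.I_pow_four, one_smul,
    Finset.sum_eq_single_of_mem 0 (by simp) fun k _ hk => ?_]
  · rw [pow_zero, virasoroMode]
    simp only [Nat.factorial_zero, Nat.cast_one, inv_one, one_smul, Module.End.one_apply]
    rw [show ((4 : ℕ) : ℤ) - (m + 1) - 2 - (0 : ℕ) = -m + 1 by push_cast; ring]
  · obtain ⟨k, rfl⟩ := Nat.exists_eq_succ_of_ne_zero hk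
    rw [Nat.succ_eq_add_one, pow_succ, Module.End.mul_apply, virasoroMode_one_omega h]
    simp

theorem form_virasoroMode (h : IsSymplectic Ω) (m : ℤ) (u v : Space ι) :
    form Ω (virasoroMode Ω m u) v = form Ω u (virasoroMode Ω (-m) v) := by
  rw [← dagger_omega h, ← form_mode h]
  rfl

theorem form_mode_eq_finsum (h : IsSymplectic Ω) {d : ℤ} {x : Space ι} (hx : x ∈ wt d)
    (n : ℤ) (u v : Space ι) : form Ω (mode Ω x n u) v = Complex.I ^ d *
      ∑ᶠ k : ℕ, ((k.factorial : ℂ)⁻¹ *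
        form Ω u (mode Ω ((virasoroMode Ω 1 ^ k) x) (d - n - 2 - k) v)) := by
  obtain hd | hd := lt_or_ge d 0
  · rw [wt_eq_bot hd, Submodule.mem_bot] at hx
    simp [hx]
  · obtain ⟨d, rfl⟩ := Int.eq_ofNat_of_zero_le hd
    rw [form_mode h, dagger_of_mem_wt d.lt_succ_self hx, zpow_natCast,
      finsum_eq_sum_range d.succ fun k hk => by
        simp [virasoroMode_one_pow_eq_zero hx (Nat.lt_of_succ_le hk)] ]
    simp only [LinearMap.smul_apply, LinearMap.sum_apply, map_smul, map_sum, smul_eq_mul]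

end Sb

/-! ### The operator σ and the conjugation ρ. -/

namespace GradedUnitary

variable {W : Type*} [AddCommGroup W] [Module ℂ W]

theorem sigmaMap_apply {B : LinearMap.BilinForm ℂ W} {F : ℤ → Submodule ℂ W}
    (h : DirectSum.IsInternal (refinedGrading B F)) {r : ℤ} {x : W}
    (hx : x ∈ refinedGrading B F r) : sigmaMap B F x = (Complex.I ^ r : ℂ) • x := by
  rw [sigmaMap, dif_pos h, LinearMap.comp_apply]
  have : (LinearEquiv.ofBijective (DirectSum.coeLinearMap (refinedGrading B F)) h).symm x =
      DirectSum.lof ℂ ℤ (fun r => refinedGrading B F r) r ⟨x, hx⟩ := by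
    rw [LinearEquiv.symm_apply_eq]
    exact (DirectSum.coeLinearMap_lof (refinedGrading B F) (i := r) ⟨x, hx⟩).symm
  erw [this, DirectSum.toModule_lof]
  rfl

end GradedUnitary

namespace Sb

open GradedUnitary MvPolynomial

/-- Formulated for additive maps so that it covers the antilinear ρ; for this reason the
coefficients stay inside the monomials. -/
theorem addMonoidHom_mem_of_support {σ M : Type*} [AddCommGroup M] (f : MvPolynomial σ ℂ →+ M)
    (S : AddSubgroup M) {x : MvPolynomial σ ℂ}
    (h : ∀ u, coeff u x ≠ 0 → f (monomial u (coeff u x)) ∈ S) : f x ∈ S := by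
  rw [x.as_sum, map_sum]
  exact sum_mem fun u hu => h u (mem_support_iff.1 hu)

variable {ι : Type*}

theorem monomial_isWeightedHomogeneous (u : ι × ℕ →₀ ℕ) (c : ℂ) :
    IsWeightedHomogeneous (fun _ : ι × ℕ => (1 : ℤ)) (monomial u c) u.degree :=
  isWeightedHomogeneous_monomial _ _ _ (weight_one_eq_degree u)

theorem addMonoidHom_isWeightedHomogeneous {f : Space ι →+ Space ι}
    (hf : ∀ u c, IsWeightedHomogeneous (fun _ : ι × ℕ => (1 : ℤ)) (f (monomial u c)) u.degree)
    {r : ℤ} {x : Space ι} (hx : IsWeightedHomogeneous (fun _ : ι × ℕ => (1 : ℤ)) x r) :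
    IsWeightedHomogeneous (fun _ : ι × ℕ => (1 : ℤ)) (f x) r := by
  refine addMonoidHom_mem_of_support f (weightedHomogeneousSubmodule ℂ _ r).toAddSubgroup
    fun u hu => ?_
  rw [← hx hu, weight_one_eq_degree]
  exact hf u _

theorem addMonoidHom_mem_filtration {f : Space ι →+ Space ι}
    (hf : ∀ u c, IsWeightedHomogeneous (fun _ : ι × ℕ => (1 : ℤ)) (f (monomial u c)) u.degree)
    {r : ℤ} {x : Space ι} (hx : x ∈ filtration r) : f x ∈ filtration r := by
  refine addMonoidHom_mem_of_support f (filtration r).toAddSubgroup fun u hu => ?_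
  obtain ⟨h₁, h₂⟩ := mem_filtration_iff.1 hx u hu
  exact mem_filtration_of_isWeightedHomogeneous (hf u _) h₁ h₂

/-- The operator acting as `i ^ l` on products of `l` generators. -/
def degreeRotation : Space ι →ₐ[ℂ] Space ι := aeval fun p => Complex.I • X p

theorem degreeRotation_X (p : ι × ℕ) : degreeRotation (X p : Space ι) = Complex.I • X p :=
  aeval_X _ _

theorem degreeRotation_monomial (u : ι × ℕ →₀ ℕ) (c : ℂ) :
    degreeRotation (monomial u c : Space ι) = Complex.I ^ u.degree • monomial u c := by
  rw [monomial_eq_smul, map_smul, smul_comm]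
  congr 1
  induction u using exponent_induction with
  | zero => simp [degreeRotation]
  | add p u hu =>
    rw [monomial_single_add, map_mul, hu, degreeRotation_X, map_add, Finsupp.degree_single, pow_add,
      pow_one, smul_mul_smul_comm]

theorem degreeRotation_isWeightedHomogeneous (u : ι × ℕ →₀ ℕ) (c : ℂ) :
    IsWeightedHomogeneous (fun _ : ι × ℕ => (1 : ℤ))
      (degreeRotation (monomial u c : Space ι)) u.degree := by
  rw [degreeRotation_monomial]
  exact Submodule.smul_mem (weightedHomogeneousSubmodule ℂ _ _) _
    (monomial_isWeightedHomogeneous u c)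

theorem degreeRotation_mem_filtration {r : ℤ} {x : Space ι} (hx : x ∈ filtration r) :
    degreeRotation x ∈ filtration r :=
  addMonoidHom_mem_filtration (f := (degreeRotation : Space ι →ₐ[ℂ] Space ι))
    degreeRotation_isWeightedHomogeneous hx

variable [Fintype ι]

section rho

variable (Ω : Matrix ι ι ℂ)

theorem rho_one : rho Ω 1 = 1 := map_one (eval₂Hom _ _)

theorem rho_mul (x y : Space ι) : rho Ω (x * y) = rho Ω x * rho Ω y := map_mul (eval₂Hom _ _) x y

theorem rho_smul (c : ℂ) (x : Space ι) : rho Ω (c • x) = conj c • rho Ω x := map_smulₛₗ _ c x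

theorem rho_finsum {f : ℕ → Space ι} (hf : Function.HasFiniteSupport f) :
    rho Ω (∑ᶠ j, f j) = ∑ᶠ j, rho Ω (f j) :=
  (rho Ω).toAddMonoidHom.map_finsum hf

theorem rho_X (a : ι) (n : ℕ) : rho Ω (X (a, n)) = -∑ b, Ω a b • X (b, n) := by
  refine (eval₂Hom_X' _ _ _).trans ?_
  simp only [smul_eq_C_mul]

theorem rho_X_mul (a : ι) (n : ℕ) (x : Space ι) :
    rho Ω (X (a, n) * x) = -∑ b, Ω a b • (X (b, n) * rho Ω x) := by
  rw [rho_mul, rho_X, neg_mul, Finset.sum_mul]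
  simp only [smul_mul_assoc]

theorem rho_der (x : Space ι) : rho Ω (der x) = der (rho Ω x) := by
  induction x using space_induction with
  | one => rw [der_one, map_zero, rho_one, der_one]
  | add x y hx hy => rw [map_add, map_add, hx, hy, map_add, map_add]
  | smul c x hx => rw [map_smul, rho_smul, hx, rho_smul, map_smul]
  | X_mul a n x hx =>
    rw [der_mul, map_add, rho_mul, rho_mul, rho_mul, der_mul, hx, der_X, rho_smul, rho_X, rho_X]
    simp only [map_neg, map_sum, map_smul, der_X, smul_neg, Finset.smul_sum, smul_comm (Ω _ _)]
    simp

theorem rho_monomial_isWeightedHomogeneous (u : ι × ℕ →₀ ℕ) (c : ℂ) :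
    IsWeightedHomogeneous (fun _ : ι × ℕ => (1 : ℤ)) (rho Ω (monomial u c)) u.degree := by
  rw [monomial_eq_smul, rho_smul]
  refine Submodule.smul_mem (weightedHomogeneousSubmodule ℂ _ _) _ ?_
  induction u using exponent_induction with
  | zero => simpa [rho_one] using isWeightedHomogeneous_one ℂ _
  | add p u hu =>
    rw [monomial_single_add, show p = (p.1, p.2) from rfl, rho_X_mul]
    refine neg_mem (sum_mem fun b _ => Submodule.smul_mem _ _ ?_)
    have := (isWeightedHomogeneous_X ℂ (fun _ : ι × ℕ => (1 : ℤ)) (b, p.2)).mul hu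
    simpa using this

/-- Each generator contributes `i * conj i = 1`, as ρ is antilinear and preserves the number of
generators. This is the relation ρσ = σ⁻¹ρ. -/
theorem degreeRotation_rho_degreeRotation (x : Space ι) :
    degreeRotation (rho Ω (degreeRotation x)) = rho Ω x := by
  induction x using space_induction with
  | one => rw [map_one, rho_one, map_one]
  | add x y hx hy => simp only [map_add, hx, hy]
  | smul c x hx => simp only [map_smul, rho_smul, hx]
  | X_mul a n x hx =>
    simp only [map_mul, rho_mul, hx, degreeRotation_X, rho_smul, rho_X, map_smul, map_neg, map_sum]
    congr 1
    simp [Finset.smul_sum, smul_smul, mul_left_comm]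

theorem rho_mem_filtration {r : ℤ} {x : Space ι} (hx : x ∈ filtration r) :
    rho Ω x ∈ filtration r :=
  addMonoidHom_mem_filtration (f := (rho Ω).toAddMonoidHom)
    (rho_monomial_isWeightedHomogeneous Ω) hx

theorem degreeRotation_rho_mem_filtration {r : ℤ} {x : Space ι} (hx : x ∈ filtration r) :
    degreeRotation (rho Ω x) ∈ filtration r :=
  degreeRotation_mem_filtration (rho_mem_filtration Ω hx)

theorem degreeRotation_rho_isWeightedHomogeneous {r : ℤ} {x : Space ι}
    (hx : IsWeightedHomogeneous (fun _ : ι × ℕ => (1 : ℤ)) x r) :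
    IsWeightedHomogeneous (fun _ : ι × ℕ => (1 : ℤ)) (degreeRotation (rho Ω x)) r :=
  addMonoidHom_isWeightedHomogeneous (f := (degreeRotation : Space ι →ₐ[ℂ] Space ι))
    degreeRotation_isWeightedHomogeneous
    (addMonoidHom_isWeightedHomogeneous (f := (rho Ω).toAddMonoidHom)
      (rho_monomial_isWeightedHomogeneous Ω) hx)

end rho

variable [DecidableEq ι] {Ω : Matrix ι ι ℂ}

theorem IsSymplectic.sum_inv_smul_sum (h : IsSymplectic Ω) {M : Type*} [AddCommGroup M]
    [Module ℂ M] (f : ι → M) (a : ι) : ∑ b, Ω⁻¹ a b • ∑ c, Ω b c • f c = f a := by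
  simp only [Finset.smul_sum, smul_smul]
  rw [Finset.sum_comm]
  simp only [← Finset.sum_smul, h.sum_inv_mul]
  simp

theorem inv_apply_of_mem_unitaryGroup (hU : Ω ∈ Matrix.unitaryGroup ι ℂ) (a b : ι) :
    Ω⁻¹ a b = conj (Ω b a) := by
  rw [Matrix.inv_eq_left_inv (Matrix.mem_unitaryGroup_iff'.1 hU)]
  rfl

/-- Unitarity turns conjugation into the transposed inverse, and skewness turns the transpose into a
sign. This identity makes ρ square to -1 on generators and fix ω. -/
theorem conj_apply_of_mem_unitaryGroup (h : IsSymplectic Ω) (hU : Ω ∈ Matrix.unitaryGroup ι ℂ)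
    (a b : ι) : conj (Ω a b) = -Ω⁻¹ a b := by
  rw [← inv_apply_of_mem_unitaryGroup hU, h.skew_inv]

theorem rho_rho_X (h : IsSymplectic Ω) (hU : Ω ∈ Matrix.unitaryGroup ι ℂ) (a : ι) (n : ℕ) :
    rho Ω (rho Ω (X (a, n))) = -X (a, n) := by
  rw [rho_X, map_neg, map_sum]
  refine congrArg _ (Eq.trans ?_ (h.sum_inv_smul_sum (fun c => X (c, n)) a))
  refine Finset.sum_congr rfl fun b _ => ?_
  rw [rho_smul, rho_X, conj_apply_of_mem_unitaryGroup h hU, smul_neg, neg_smul, neg_neg]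

theorem rho_rho_monomial (h : IsSymplectic Ω) (hU : Ω ∈ Matrix.unitaryGroup ι ℂ)
    (u : ι × ℕ →₀ ℕ) (c : ℂ) :
    rho Ω (rho Ω (monomial u c)) = (-1 : ℂ) ^ u.degree • monomial u c := by
  rw [monomial_eq_smul, rho_smul, rho_smul, Complex.conj_conj, smul_comm]
  congr 1
  induction u using exponent_induction with
  | zero => simp [rho_one]
  | add p u hu =>
    rw [monomial_single_add, rho_mul, rho_mul, hu, show p = (p.1, p.2) from rfl, rho_rho_X h hU,
      map_add, Finsupp.degree_single, pow_add, pow_one, mul_smul, neg_one_smul, neg_mul,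
      mul_smul_comm]

theorem rho_rho_of_mem_z2 (h : IsSymplectic Ω) (hU : Ω ∈ Matrix.unitaryGroup ι ℂ)
    {α : ZMod 2} {x : Space ι} (hx : x ∈ z2 α) {c : ℂ}
    (hc : ∀ n : ℕ, (n : ZMod 2) = α → (-1 : ℂ) ^ n = c) : rho Ω (rho Ω x) = c • x := by
  have := addMonoidHom_mem_of_support
    ((rho Ω).toAddMonoidHom.comp (rho Ω).toAddMonoidHom - (c • LinearMap.id : Space ι →ₗ[ℂ] Space ι).toAddMonoidHom) ⊥
    (x := x) fun u hu => ?_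
  · exact sub_eq_zero.1 (AddSubgroup.mem_bot.1 this)
  · rw [AddSubgroup.mem_bot]
    refine sub_eq_zero.2 ((rho_rho_monomial h hU u _).trans ?_)
    rw [hc _ (mem_z2_iff.1 hx u hu)]
    rfl

theorem rho_rho_rho_rho (h : IsSymplectic Ω) (hU : Ω ∈ Matrix.unitaryGroup ι ℂ) (x : Space ι) :
    rho Ω (rho Ω (rho Ω (rho Ω x))) = x := by
  induction x using space_induction with
  | one => simp only [rho_one]
  | add x y hx hy => simp only [map_add, hx, hy]
  | smul c x hx => simp only [rho_smul, hx, Complex.conj_conj]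
  | X_mul a n x hx =>
    simp only [rho_mul _ (X _), rho_mul _ (rho _ _), hx]
    rw [rho_rho_X h hU, map_neg, map_neg, rho_rho_X h hU, neg_neg]

theorem rho_bijective (h : IsSymplectic Ω) (hU : Ω ∈ Matrix.unitaryGroup ι ℂ) :
    Function.Bijective (rho Ω) :=
  Function.bijective_iff_has_inverse.2
    ⟨fun x => rho Ω (rho Ω (rho Ω x)), rho_rho_rho_rho h hU, rho_rho_rho_rho h hU⟩

theorem degreeRotation_bijective (h : IsSymplectic Ω) (hU : Ω ∈ Matrix.unitaryGroup ι ℂ) :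
    Function.Bijective (degreeRotation : Space ι →ₐ[ℂ] Space ι) := by
  refine ⟨fun x y hxy => (rho_bijective h hU).1 ?_, fun x => ?_⟩
  · rw [← degreeRotation_rho_degreeRotation, hxy, degreeRotation_rho_degreeRotation]
  · obtain ⟨y, rfl⟩ := (rho_bijective h hU).2 x
    exact ⟨_, degreeRotation_rho_degreeRotation Ω y⟩

theorem q_rho_X (h : IsSymplectic Ω) (b c : ι) (n j : ℕ) :
    q Ω b n (rho Ω (X (c, j))) = if n = j then if c = b then 1 else 0 else 0 := by
  rw [rho_X, map_neg, map_sum]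
  simp only [map_smul, q_annihilation_X]
  split_ifs with h₁ h₂
  all_goals simp only [smul_eq_C_mul, ← C_mul, ← map_sum, ← map_neg, h.skew_inv _ b, mul_neg,
    Finset.sum_neg_distrib, neg_neg, h.sum_mul_inv, smul_zero, Finset.sum_const_zero, neg_zero]
  · rw [if_pos h₂, C_1]
  · rw [if_neg h₂, C_0]

/-- ρ respects the Heisenberg relations. For annihilators both sides obey the same Leibniz rule
after ρ, so the generators decide, and there unitarity is needed. -/
theorem rho_q (h : IsSymplectic Ω) (hU : Ω ∈ Matrix.unitaryGroup ι ℂ) (a : ι) (k : ℤ)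
    (v : Space ι) : rho Ω (q Ω a k v) = -∑ b, Ω a b • q Ω b k (rho Ω v) := by
  obtain ⟨n, rfl⟩ | ⟨n, rfl⟩ := int_cases k
  · induction v using space_induction with
    | one => simp [q_annihilation_one, rho_one]
    | add x y hx hy => simp only [map_add, hx, hy, smul_add, Finset.sum_add_distrib, neg_add]
    | smul c x hx =>
      simp only [map_smul, rho_smul, hx, smul_neg, Finset.smul_sum, smul_comm (Ω _ _)]
    | X_mul c j x hx =>
      have hX : ∑ b, Ω a b • q Ω b n (rho Ω (X (c, j))) = -rho Ω (q Ω a n (X (c, j))) := by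
        simp only [q_rho_X h]
        rw [q_annihilation_X]
        split_ifs
        · rw [C_eq_smul_one, rho_smul, rho_one, inv_apply_of_mem_unitaryGroup hU, Complex.conj_conj,
            h.skew a c]
          simp
        · simp
      have hm : ∑ b, Ω a b • q Ω b n (rho Ω (X (c, j)) * rho Ω x) =
          (∑ b, Ω a b • q Ω b n (rho Ω (X (c, j)))) * rho Ω x +
            rho Ω (X (c, j)) * ∑ b, Ω a b • q Ω b n (rho Ω x) := by
        rw [Finset.sum_mul, Finset.mul_sum, ← Finset.sum_add_distrib]
        refine Finset.sum_congr rfl fun b _ => ?_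
        rw [q_annihilation_mul, smul_add, smul_mul_assoc, mul_smul_comm]
      rw [q_annihilation_mul, map_add, rho_mul, rho_mul, rho_mul, hx, hm, hX]
      ring
  · simp only [q_creation, rho_X_mul]

theorem rho_mode (h : IsSymplectic Ω) (hU : Ω ∈ Matrix.unitaryGroup ι ℂ) (x : Space ι) (m : ℤ)
    (v : Space ι) : rho Ω (mode Ω x m v) = mode Ω (rho Ω x) m (rho Ω v) := by
  induction x using space_induction_der generalizing m v with
  | one =>
    rw [rho_one, mode_one, mode_one]
    split_ifs
    · rfl
    · exact map_zero _
  | add x y hx hy => simp only [map_add, LinearMap.add_apply, Pi.add_apply, hx, hy]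
  | smul c x hx =>
    simp only [map_smul, rho_smul, LinearMap.smul_apply, Pi.smul_apply, hx]
  | der x hx =>
    rw [mode_der, rho_smul, hx, rho_der, mode_der]
    simp
  | X_mul a x hx =>
    rw [mode_X_zero_mul, map_add,
      rho_finsum Ω (hasFiniteSupport_mode Ω x v m (fun j => q Ω a (-1 - j)) (by simp)),
      rho_finsum Ω (hasFiniteSupport_q_natCast Ω a v (fun j => mode Ω x (m - 1 - j)) (by simp))]
    simp only [rho_q h hU, hx, rho_X_mul, map_neg, map_sum, map_smul,
      finsum_neg_distrib, Pi.neg_apply, LinearMap.neg_apply, Finset.sum_apply, Pi.smul_apply,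
      LinearMap.sum_apply, LinearMap.smul_apply, mode_X_zero_mul, smul_add, Finset.sum_add_distrib,
      neg_add]
    rw [finsum_sum_comm _ _ fun b _ => hasFiniteSupport_mode Ω (rho Ω x) (rho Ω v) m
        (fun j y => Ω a b • q Ω b (-1 - j) y) (by simp),
      finsum_sum_comm _ _ fun b _ => hasFiniteSupport_q_natCast Ω b (rho Ω v)
        (fun j y => Ω a b • mode Ω (rho Ω x) (m - 1 - j) y) (by simp)]
    simp only [smul_finsum]

theorem rho_omega (h : IsSymplectic Ω) (hU : Ω ∈ Matrix.unitaryGroup ι ℂ) :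
    rho Ω (omega Ω) = omega Ω := by
  rw [omega, rho_smul, map_sum]
  congr 1
  · simp [map_ofNat]
  have h₁ : ∀ a, rho Ω (∑ b, Ω a b • (X (b, 0) * X (a, 1))) = X (a, 0) * ∑ b, Ω b a • X (b, 1) :=
    fun a => by
      rw [map_sum]
      have h₂ := h.sum_inv_smul_sum (fun c => (X (c, 0) : Space ι)) a
      rw [← h₂, Finset.sum_mul]
      refine Finset.sum_congr rfl fun b _ => ?_
      rw [rho_smul, rho_mul, rho_X, rho_X, conj_apply_of_mem_unitaryGroup h hU, neg_mul_neg,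
        neg_smul, smul_mul_assoc, ← smul_neg, ← mul_neg, ← Finset.sum_neg_distrib]
      simp only [← neg_smul, ← h.skew]
  simp only [h₁, Finset.mul_sum]
  rw [Finset.sum_comm]
  simp only [mul_smul_comm]

end Sb

/-! ### Positivity, nondegeneracy and the refined grading. -/

namespace Sb

open GradedUnitary MvPolynomial

variable {ι : Type*} [Fintype ι] [DecidableEq ι] {Ω : Matrix ι ι ℂ}

/-- Under the form, multiplication by σρ of a generator is adjoint to the partial derivative in that
generator. Removing generators one by one makes `r` the product of the factorials of the exponents.
-/
theorem form_degreeRotation_rho_monomial (h : IsSymplectic Ω) (u : ι × ℕ →₀ ℕ) :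
    ∃ r : ℝ, 0 < r ∧ ∀ (c : ℂ) (y : Space ι),
      form Ω (degreeRotation (rho Ω (monomial u c))) y = conj c * r * coeff u y := by
  suffices H : ∃ r : ℝ, 0 < r ∧ ∀ y : Space ι,
      form Ω (degreeRotation (rho Ω (monomial u 1))) y = r * coeff u y by
    obtain ⟨r, hr, H⟩ := H
    refine ⟨r, hr, fun c y => ?_⟩
    rw [monomial_eq_smul, rho_smul, map_smul, map_smul, LinearMap.smul_apply, H, smul_eq_mul, mul_assoc]
  induction u using exponent_induction with
  | zero => exact ⟨1, one_pos, fun y => by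
      simpa [rho_one] using form_one (Ω := Ω) y⟩
  | add p u hu =>
    obtain ⟨r, hr, H⟩ := hu
    refine ⟨r * (u p + 1), by positivity, fun y => ?_⟩
    obtain ⟨a, n⟩ := p
    rw [monomial_single_add, rho_X_mul, map_neg, map_sum, map_neg, map_sum, LinearMap.neg_apply,
      LinearMap.sum_apply]
    have h₁ : ∀ b, form Ω (degreeRotation (Ω a b • (X (b, n) * rho Ω (monomial u 1)))) y =
        -(Ω a b * form Ω (degreeRotation (rho Ω (monomial u 1))) (q Ω b n y)) := fun b => by
      rw [map_smul, map_mul, degreeRotation_X, smul_mul_assoc, map_smul, map_smul,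
        LinearMap.smul_apply, LinearMap.smul_apply, form_X_mul h, smul_eq_mul, smul_eq_mul]
      linear_combination (Ω a b * form Ω (degreeRotation (rho Ω (monomial u 1))) (q Ω b n y)) *
        Complex.I_sq
    simp only [h₁, Finset.sum_neg_distrib, neg_neg]
    have h₂ := congrArg (form Ω (degreeRotation (rho Ω (monomial u 1)))) (pderiv_eq_sum_q h a n y)
    simp only [map_sum, map_smul, smul_eq_mul] at h₂
    rw [← h₂, H, coeff_pderiv, add_comm u]
    push_cast
    ring

theorem exists_form_degreeRotation_rho (h : IsSymplectic Ω) : ∃ r : (ι × ℕ →₀ ℕ) → ℝ,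
    (∀ u, 0 < r u) ∧ ∀ (x y : Space ι) (s : Finset (ι × ℕ →₀ ℕ)), x.support ⊆ s →
      form Ω (degreeRotation (rho Ω x)) y = ∑ u ∈ s, conj (coeff u x) * r u * coeff u y := by
  choose r hr H using form_degreeRotation_rho_monomial h
  refine ⟨r, hr, fun x y s hs => ?_⟩
  conv_lhs => rw [x.as_sum]
  simp only [map_sum, LinearMap.sum_apply, H]
  refine Finset.sum_subset hs fun u _ hu => ?_
  rw [notMem_support_iff.1 hu, map_zero, zero_mul, zero_mul]

theorem form_degreeRotation_rho_conj (h : IsSymplectic Ω) (x y : Space ι) :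
    form Ω (degreeRotation (rho Ω x)) y = conj (form Ω (degreeRotation (rho Ω y)) x) := by
  classical
  obtain ⟨r, -, H⟩ := exists_form_degreeRotation_rho h
  rw [H x y (x.support ∪ y.support) Finset.subset_union_left,
    H y x (x.support ∪ y.support) Finset.subset_union_right, map_sum]
  refine Finset.sum_congr rfl fun u _ => ?_
  simp only [map_mul, Complex.conj_conj, Complex.conj_ofReal]
  ring

theorem form_degreeRotation_rho_self_pos (h : IsSymplectic Ω) {x : Space ι} (hx : x ≠ 0) :
    0 < (form Ω (degreeRotation (rho Ω x)) x).re := by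
  obtain ⟨r, hr, H⟩ := exists_form_degreeRotation_rho h
  rw [H x x _ subset_rfl, Complex.re_sum]
  refine Finset.sum_pos (fun u hu => ?_) (support_nonempty.2 hx)
  rw [mul_right_comm, ← Complex.normSq_eq_conj_mul_self, ← Complex.ofReal_mul, Complex.ofReal_re]
  exact mul_pos (Complex.normSq_pos.2 (mem_support_iff.1 hu)) (hr u)

theorem degreeRotation_rho_pow_four (h : IsSymplectic Ω) (hU : Ω ∈ Matrix.unitaryGroup ι ℂ)
    (x : Space ι) : degreeRotation (rho Ω (degreeRotation (rho Ω
      (degreeRotation (rho Ω (degreeRotation (rho Ω x))))))) = x := by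
  simp only [degreeRotation_rho_degreeRotation, rho_rho_rho_rho h hU]

/-- The fourth power of σρ is the identity, so every `x` in `S` equals σρ `w` with `w` in `S`.
Pairing `x` with `w`, or σρ `y` with `y`, gives a positive number. -/
theorem nondegenerateOn_form (h : IsSymplectic Ω) (hU : Ω ∈ Matrix.unitaryGroup ι ℂ)
    {S : Submodule ℂ (Space ι)} (hS : ∀ x ∈ S, degreeRotation (rho Ω x) ∈ S) :
    NondegenerateOn (form Ω) S := by
  refine ⟨fun x hx hB => ?_, fun y hy hB => ?_⟩
  · by_contra hc
    rw [← degreeRotation_rho_pow_four h hU x] at hB hc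
    set w := degreeRotation (rho Ω (degreeRotation (rho Ω (degreeRotation (rho Ω x)))))
    have hw : w ∈ S := hS _ (hS _ (hS _ hx))
    have := form_degreeRotation_rho_self_pos h (x := w) fun hw₀ => hc (by
      rw [hw₀, map_zero, map_zero])
    rw [hB w hw] at this
    simp at this
  · by_contra hc
    have := form_degreeRotation_rho_self_pos h hc
    rw [hB _ (hS _ hy)] at this
    simp at this

/-- Writing x = σρ w, the pairing of `x` with a monomial is, up to a positive factor, a conjugated
coefficient of `w`. Orthogonality to lower degrees thus says that `w`, and with it `x`, is
homogeneous. -/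
theorem refinedGrading_eq (h : IsSymplectic Ω) (hU : Ω ∈ Matrix.unitaryGroup ι ℂ) :
    refinedGrading (form Ω) filtration =
      weightedHomogeneousSubmodule ℂ (fun _ : ι × ℕ => (1 : ℤ)) := by
  obtain ⟨s, hs, H⟩ := exists_form_degreeRotation_rho h
  funext r
  ext x
  set w := degreeRotation (rho Ω (degreeRotation (rho Ω (degreeRotation (rho Ω x))))) with hw
  have hx : degreeRotation (rho Ω w) = x := degreeRotation_rho_pow_four h hU x
  constructor
  · rintro ⟨hxr, hB⟩
    have hwr : w ∈ filtration r := degreeRotation_rho_mem_filtration Ω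
      (degreeRotation_rho_mem_filtration Ω (degreeRotation_rho_mem_filtration Ω hxr))
    rw [← hx] at hB ⊢
    refine degreeRotation_rho_isWeightedHomogeneous Ω fun u hu => ?_
    rw [weight_one_eq_degree]
    obtain ⟨h₁, h₂⟩ := mem_filtration_iff.1 hwr u hu
    by_contra hc
    -- By parity, a degree at most `r` and different from `r` is at most `r - 2`, so this monomial
    -- is an admissible test vector.
    have := hB (monomial u 1) (mem_filtration_of_isWeightedHomogeneous
      (monomial_isWeightedHomogeneous u 1) (by omega) (by omega))
    rw [H _ _ _ subset_rfl, Finset.sum_eq_single_of_mem u (mem_support_iff.2 hu) fun v _ hv => by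
      rw [coeff_monomial, if_neg hv.symm, mul_zero], coeff_monomial, if_pos rfl, mul_one] at this
    exact mul_ne_zero ((map_ne_zero _).2 hu) (Complex.ofReal_ne_zero.2 (hs u).ne') this
  · intro hxr
    refine ⟨mem_filtration_of_isWeightedHomogeneous hxr le_rfl (by simp), fun y hy => ?_⟩
    have hwr := degreeRotation_rho_isWeightedHomogeneous Ω
      (degreeRotation_rho_isWeightedHomogeneous Ω (degreeRotation_rho_isWeightedHomogeneous Ω hxr))
    rw [← hx, H _ _ _ subset_rfl]
    refine Finset.sum_eq_zero fun u hu => ?_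
    have h₁ := hwr (mem_support_iff.1 hu)
    rw [weight_one_eq_degree] at h₁
    have h₂ : coeff u y = 0 := by
      by_contra hc
      have := (mem_filtration_iff.1 hy u hc).1
      omega
    rw [h₂, mul_zero]

theorem refinedGrading_isInternal (h : IsSymplectic Ω) (hU : Ω ∈ Matrix.unitaryGroup ι ℂ) :
    DirectSum.IsInternal (refinedGrading (form Ω) filtration) := by
  rw [refinedGrading_eq h hU]
  have := weightedDecomposition ℂ (fun _ : ι × ℕ => (1 : ℤ))
  exact DirectSum.Decomposition.isInternal _

theorem sigmaMap_eq (h : IsSymplectic Ω) (hU : Ω ∈ Matrix.unitaryGroup ι ℂ) (x : Space ι) :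
    sigmaMap (form Ω) filtration x = degreeRotation x := by
  induction x using induction_on' with
  | add x y hx hy => rw [map_add, map_add, hx, hy]
  | monomial u c =>
    rw [sigmaMap_apply (r := u.degree) (refinedGrading_isInternal h hU), degreeRotation_monomial,
      zpow_natCast]
    rw [refinedGrading_eq h hU]
    exact monomial_isWeightedHomogeneous u c

end Sb

/-! ### Existence of bases with unitary Gram matrix. -/

namespace LinearMap.BilinForm

theorem fromBlocks_mem_unitaryGroup {m n : Type*} [Fintype m] [Fintype n] [DecidableEq m]
    [DecidableEq n] {A : Matrix m m ℂ} {B : Matrix n n ℂ} (hA : A ∈ Matrix.unitaryGroup m ℂ)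
    (hB : B ∈ Matrix.unitaryGroup n ℂ) :
    Matrix.fromBlocks A 0 0 B ∈ Matrix.unitaryGroup (m ⊕ n) ℂ := by
  rw [Matrix.mem_unitaryGroup_iff, Matrix.star_eq_conjTranspose] at *
  rw [Matrix.fromBlocks_conjTranspose, Matrix.fromBlocks_multiply, hA, hB]
  simp

/-- A symplectic vector space has a basis with unitary Gram matrix. -/
theorem exists_basis_toMatrix_mem_unitaryGroup (n : ℕ) {V : Type*} [AddCommGroup V] [Module ℂ V]
    [FiniteDimensional ℂ V] (hn : Module.finrank ℂ V = n) (Ω : LinearMap.BilinForm ℂ V)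
    (hAlt : Ω.IsAlt) (hNondeg : Ω.Nondegenerate) :
    ∃ (κ : Type) (_ : Fintype κ) (_ : DecidableEq κ) (e : Module.Basis κ ℂ V),
      LinearMap.BilinForm.toMatrix e Ω ∈ Matrix.unitaryGroup κ ℂ := by
  induction n using Nat.strong_induction_on generalizing V with
  | _ n ih =>
  obtain hV | hV := subsingleton_or_nontrivial V
  · refine ⟨Empty, inferInstance, inferInstance, Module.Basis.empty V, ?_⟩
    rw [Matrix.mem_unitaryGroup_iff]
    exact Subsingleton.elim _ _
  obtain ⟨v, hv⟩ := exists_ne (0 : V)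
  obtain ⟨w, hw⟩ : ∃ w, Ω v w = 1 := by
    obtain ⟨w, hw⟩ : ∃ w, Ω v w ≠ 0 := by
      by_contra! hc
      exact hv (hNondeg.1 v hc)
    exact ⟨(Ω v w)⁻¹ • w, by rw [map_smul, smul_eq_mul, inv_mul_cancel₀ hw]⟩
  have hwv : Ω w v = -1 := by rw [← hAlt.neg_eq, hw]
  have hli : LinearIndependent ℂ ![v, w] := by
    rw [LinearIndependent.pair_iff]
    intro s t hst
    have h₁ := congrArg (Ω v) hst
    have h₂ := congrArg (Ω w) hst
    rw [map_add, map_smul, map_smul, hAlt.self_eq_zero, hw] at h₁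
    rw [map_add, map_smul, map_smul, hAlt.self_eq_zero, hwv] at h₂
    simp at h₁ h₂
    exact ⟨h₂, h₁⟩
  -- A hyperbolic plane, whose Gram matrix is unitary since `Ω v w = 1`. Its orthogonal complement
  -- is again symplectic and two dimensions smaller; the combined Gram matrix is block diagonal.
  set p := Submodule.span ℂ (Set.range ![v, w])
  let b := Module.Basis.span hli
  have hb : ∀ i, (b i : V) = ![v, w] i := fun i => congrArg Subtype.val (Module.Basis.span_apply hli i)
  have hM : LinearMap.BilinForm.toMatrix b (Ω.restrict p) = !![0, 1; -1, 0] := by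
    ext i j
    rw [LinearMap.BilinForm.toMatrix_apply]
    change Ω (b i) (b j) = _
    rw [hb, hb]
    fin_cases i <;> fin_cases j <;> simp [hw, hwv, hAlt.self_eq_zero]
  have hp : (Ω.restrict p).Nondegenerate := by
    rw [LinearMap.BilinForm.nondegenerate_iff_det_ne_zero b, hM]
    simp
  have hc := isCompl_orthogonal_of_restrict_nondegenerate hAlt.isRefl hp
  have hq : (Ω.restrict (Ω.orthogonal p)).Nondegenerate := by
    rw [restrict_nondegenerate_iff_isCompl_orthogonal hAlt.isRefl,
      orthogonal_orthogonal hNondeg hAlt.isRefl]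
    exact hc.symm
  have hfr : Module.finrank ℂ (Ω.orthogonal p) < n := by
    have h₁ := Submodule.finrank_add_eq_of_isCompl hc
    have h₂ : Module.finrank ℂ p = 2 := by
      rw [Module.finrank_eq_card_basis b, Fintype.card_fin]
    omega
  obtain ⟨κ, _, _, e, he⟩ := ih _ hfr rfl (Ω.restrict (Ω.orthogonal p))
    (fun x => hAlt.self_eq_zero (x : V)) hq
  refine ⟨Fin 2 ⊕ κ, inferInstance, inferInstance,
    (b.prod e).map (Submodule.prodEquivOfIsCompl _ _ hc), ?_⟩
  convert fromBlocks_mem_unitaryGroup (A := LinearMap.BilinForm.toMatrix b (Ω.restrict p)) ?_ he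
  · ext i j
    rw [LinearMap.BilinForm.toMatrix_apply]
    have h₀ : ∀ i j, Ω (b i) (e j) = 0 := fun i j => (e j).2 _ (b i).2
    obtain i | i := i <;> obtain j | j := j <;>
      simp [Submodule.coe_prodEquivOfIsCompl', toMatrix_apply, h₀, hAlt.isRefl.eq_zero (h₀ _ _)]
  · rw [hM, Matrix.mem_unitaryGroup_iff, Matrix.star_eq_conjTranspose]
    ext i j
    fin_cases i <;> fin_cases j <;> simp [Matrix.mul_apply]

theorem exists_basis_fin_toMatrix_mem_unitaryGroup {V : Type*} [AddCommGroup V] [Module ℂ V]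
    [FiniteDimensional ℂ V] (Ω : LinearMap.BilinForm ℂ V) (hAlt : Ω.IsAlt)
    (hNondeg : Ω.Nondegenerate) : ∃ e : Module.Basis (Fin (Module.finrank ℂ V)) ℂ V,
      LinearMap.BilinForm.toMatrix e Ω ∈ Matrix.unitaryGroup (Fin (Module.finrank ℂ V)) ℂ := by
  obtain ⟨κ, _, _, e, he⟩ := exists_basis_toMatrix_mem_unitaryGroup _ rfl Ω hAlt hNondeg
  let f := Fintype.equivFinOfCardEq (Module.finrank_eq_card_basis e).symm
  refine ⟨e.reindex f, ?_⟩
  have : LinearMap.BilinForm.toMatrix (e.reindex f) Ω =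
      (LinearMap.BilinForm.toMatrix e Ω).submatrix f.symm f.symm := by
    ext i j
    simp [toMatrix_apply]
  rw [this, Matrix.mem_unitaryGroup_iff, Matrix.star_eq_conjTranspose, Matrix.conjTranspose_submatrix,
    Matrix.submatrix_mul_equiv, ← Matrix.star_eq_conjTranspose, Matrix.mem_unitaryGroup_iff.1 he,
    Matrix.submatrix_one_equiv]

end LinearMap.BilinForm

/-! ### Assembling the axioms. -/

namespace Sb

open GradedUnitary MvPolynomial

theorem koszulSign_zero_left (i : ZMod 2) : koszulSign 0 i = 1 := by
  simp [koszulSign]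

variable {ι : Type*}

/-- Yields all compatibilities between gradings and filtration: each subspace involved is spanned by
monomials, and a monomial is homogeneous for every grading. -/
theorem mem_iSup_inf_of_support {κ : Type*} {S : Submodule ℂ (Space ι)} {T : κ → Submodule ℂ (Space ι)}
    (hS : ∀ x ∈ S, ∀ u, coeff u x ≠ 0 → (monomial u 1 : Space ι) ∈ S)
    (hT : ∀ u, ∃ k, (monomial u 1 : Space ι) ∈ T k) : S ≤ ⨆ k, S ⊓ T k := fun x hx =>
  linearMap_mem_of_support LinearMap.id _ fun u hu => by
    obtain ⟨k, hk⟩ := hT u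
    exact Submodule.mem_iSup_of_mem k ⟨hS x hx u hu, hk⟩

theorem monomial_mem_z2 (u : ι × ℕ →₀ ℕ) : (monomial u 1 : Space ι) ∈ z2 (u.degree : ZMod 2) := by
  classical
  rw [mem_z2_iff]
  intro v hv
  rw [coeff_monomial] at hv
  rw [show u = v by by_contra hc; exact hv (if_neg hc)]

theorem monomial_mem_filtration_of_mem {r : ℤ} {x : Space ι} (hx : x ∈ filtration r)
    {u : ι × ℕ →₀ ℕ} (hu : coeff u x ≠ 0) : (monomial u 1 : Space ι) ∈ filtration r := by
  obtain ⟨h₁, h₂⟩ := mem_filtration_iff.1 hx u hu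
  exact mem_filtration_of_isWeightedHomogeneous (monomial_isWeightedHomogeneous u 1) h₁ h₂

variable [Fintype ι] [DecidableEq ι] {Ω : Matrix ι ι ℂ}

/-- The algebra is purely even, so every axiom with Koszul signs reduces to the case of sign 1 or to
the zero vector. -/
theorem par_eq_zero_or {i : ZMod 2} {x : Space ι} (hx : x ∈ (mobius Ω).par i) : i = 0 ∨ x = 0 := by
  by_cases hi : i = 0
  · exact Or.inl hi
  · right
    simpa [mobius, hi] using hx

theorem mem_par_zero (x : Space ι) : x ∈ (mobius Ω).par 0 := by
  simp [mobius]

theorem par_isInternal : DirectSum.IsInternal (mobius Ω).par := by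
  rw [DirectSum.isInternal_submodule_iff_iSupIndep_and_iSup_eq_top]
  refine ⟨fun i => ?_, eq_top_iff.2 fun x _ => Submodule.mem_iSup_of_mem 0 (mem_par_zero x)⟩
  rw [Submodule.disjoint_def]
  intro x hx hx'
  obtain rfl | hx := par_eq_zero_or hx
  · refine (Submodule.mem_bot ℂ).1 ((iSup₂_le fun j hj => ?_ :
      (⨆ (j) (_ : j ≠ 0), (mobius Ω).par j) ≤ ⊥) hx')
    intro y hy
    exact (Submodule.mem_bot ℂ).2 ((par_eq_zero_or hy).resolve_left hj)
  · exact hx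

theorem isVertexAlgebra (h : IsSymplectic Ω) : IsVertexAlgebra (mobius Ω).toVertexData where
  par_internal := par_isInternal
  vac_par := mem_par_zero _
  mode_par i j x hx y hy n := by
    obtain rfl | rfl := par_eq_zero_or hx
    · obtain rfl | rfl := par_eq_zero_or hy
      · exact mem_par_zero _
      · rw [map_zero]
        exact zero_mem _
    · simp
  vacuum n y := mode_one Ω n y
  creation x := mode_neg_one_apply_one Ω x
  creation_nonneg x n hn := by
    obtain ⟨n, rfl⟩ := Int.eq_ofNat_of_zero_le hn
    exact mode_apply_one Ω x n
  der_vac := der_one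
  translation x n y := der_mode h x n y
  locality i j x hx y hy := by
    obtain rfl | rfl := par_eq_zero_or hx
    · obtain ⟨N, hN⟩ := locality Ω h.skew_inv x y
      refine ⟨N, fun m n v => ?_⟩
      have := congrFun (congrFun (hN v) m) n
      rw [shiftDiff_pow_apply] at this
      simp only [smul_sub, Finset.sum_sub_distrib] at this
      rw [koszulSign_zero_left, one_smul]
      exact sub_eq_zero.1 this
    · exact ⟨0, fun m n v => by simp⟩

theorem virasoro_apply (h : IsSymplectic Ω) : ∃ c : ℂ, ∀ (m n : ℤ) (y : Space ι),
    virasoroMode Ω m (virasoroMode Ω n y) - virasoroMode Ω n (virasoroMode Ω m y) =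
      ((m : ℂ) - n) • virasoroMode Ω (m + n) y +
        (if m + n = 0 then c / 12 * ((m : ℂ) ^ 3 - m) else 0) • y := by
  obtain ⟨c, hc⟩ := virasoro h
  exact ⟨c, fun m n y => congrArg (fun Z : Module.End ℂ (Space ι) => Z y) (hc m n)⟩

theorem isMobius (h : IsSymplectic Ω) : IsMobius (mobius Ω) where
  toIsVertexAlgebra := isVertexAlgebra h
  wt_internal := wt_isInternal
  wt_finite := wt_finiteDimensional
  wt_bounded := ⟨0, fun d hd => wt_eq_bot hd⟩
  wt_par d x hx := Submodule.mem_iSup_of_mem 0 ⟨hx, mem_par_zero x⟩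
  mode_wt d e x hx y hy n := mode_mem_wt Ω hx hy n
  L_comm m n hm hn y := by
    obtain ⟨c, hc⟩ := virasoro_apply h
    refine (hc m n y).trans (add_eq_left.2 (smul_eq_zero_of_left ?_ y))
    obtain ⟨h₁, h₂⟩ := abs_le.1 hm
    split_ifs
    -- The central term `m ^ 3 - m` vanishes on the Möbius range.
    · interval_cases m <;> norm_num
    · rfl
  L_vac m hm := virasoroMode_one m (abs_le.1 hm).1
  L_neg_one := LinearMap.ext (omega_zero_eq_der h)
  L_zero d x hx := omega_one_of_mem_wt h hx
  L_covariance m hm x k y := by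
    obtain ⟨h₁, h₂⟩ := abs_le.1 hm
    obtain ⟨M, hM⟩ := Int.eq_ofNat_of_zero_le (show 0 ≤ m + 1 by omega)
    obtain rfl : m = M - 1 := by omega
    have hc : OmegaCovariant Ω M x := by
      obtain rfl | rfl | rfl : M = 0 ∨ M = 1 ∨ M = 2 := by omega
      exacts [omegaCovariant_zero h x, omegaCovariant_one h x, omegaCovariant_two h x]
    have := hc k y
    rw [sub_add_cancel, Int.toNat_natCast]
    simp only [mobius, mode_def, sub_add_cancel]
    rw [this]
    refine Finset.sum_congr rfl fun j _ => ?_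
    rw [show k + (M - 1) + 1 - j = M + k - (j : ℤ) by ring]

theorem isVOA (h : IsSymplectic Ω) : IsVOA (mobius Ω) (omega Ω) where
  toIsMobius := isMobius h
  conformal_par := mem_par_zero _
  conformal_wt := omega_mem_wt Ω
  L_eq _ _ := rfl
  virasoro := virasoro_apply h

theorem isInvariantForm (h : IsSymplectic Ω) : IsInvariantForm (mobius Ω) (form Ω) where
  mode i j d x hx u hu n v := by
    obtain rfl | rfl := par_eq_zero_or hx.2
    · rw [koszulSign_zero_left, one_mul]
      exact form_mode_eq_finsum h hx.1 n u v
    · simp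
  mobius m hm u v := form_virasoroMode h m u v

theorem isHalfIntegralFiltration (Ω : Matrix ι ι ℂ) :
    IsHalfIntegralFiltration (mobius Ω).toVertexData z2 filtration where
  z2_internal := z2_isInternal
  z2_par i := mem_iSup_inf_of_support (fun x hx u hu => by
      obtain rfl | rfl := par_eq_zero_or hx
      · exact mem_par_zero _
      · simp at hu) fun u => ⟨_, monomial_mem_z2 u⟩
  mode_z2 α β x hx y hy n := mode_mem_z2 Ω hx hy n
  le_z2 := filtration_le_z2
  le_succ r := filtration_mono (by omega) (by simp)
  exhaustive α x hx := exists_mem_filtration hx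
  vac_mem := mem_filtration_of_isWeightedHomogeneous (isWeightedHomogeneous_one ℂ _) le_rfl (by simp)
  mode_mem r t x hx y hy n := mode_mem_filtration_of_le Ω hx hy n (Or.inl rfl)

theorem isNondegenerateFiltration (h : IsSymplectic Ω) (hU : Ω ∈ Matrix.unitaryGroup ι ℂ) :
    IsNondegenerateFiltration (mobius Ω) (form Ω) filtration where
  wt_compatible _ := mem_iSup_inf_of_support
    (fun _ hx _ hu => monomial_mem_filtration_of_mem hx hu) fun u => ⟨_, monomial_mem_wt u 1 rfl⟩
  nondegenerate _ := nondegenerateOn_form h hU fun _ hx => degreeRotation_rho_mem_filtration Ω hx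

theorem isConjugation (h : IsSymplectic Ω) (hU : Ω ∈ Matrix.unitaryGroup ι ℂ) :
    IsConjugation (mobius Ω) filtration (rho Ω) where
  bijective := rho_bijective h hU
  der := rho_der Ω
  vac := rho_one Ω
  mode i j x hx y hy n := by
    obtain rfl | rfl := par_eq_zero_or hx
    · rw [koszulSign_zero_left, one_smul]
      exact rho_mode h hU x n y
    · simp
  mobius m hm x := by
    have := rho_mode h hU (omega Ω) (m + 1) x
    rw [rho_omega h hU] at this
    exact this.symm
  filtration r x hx := rho_mem_filtration Ω hx

theorem isQuaternionicStructure (h : IsSymplectic Ω) (hU : Ω ∈ Matrix.unitaryGroup ι ℂ) :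
    IsQuaternionicStructure (mobius Ω) (form Ω) z2 filtration (rho Ω) where
  toIsConjugation := isConjugation h hU
  sq_even x hx := by
    rw [rho_rho_of_mem_z2 h hU hx fun n hn =>
      ((ZMod.natCast_eq_zero_iff_even).1 hn).neg_one_pow, one_smul]
  sq_odd x hx := by
    rw [rho_rho_of_mem_z2 h hU hx fun n hn =>
      ((ZMod.natCast_eq_one_iff_odd).1 hn).neg_one_pow, neg_one_smul]
  sigma_bijective := by
    have := degreeRotation_bijective h hU
    rwa [← show ⇑(sigmaMap (form Ω) filtration) = degreeRotation from funext (sigmaMap_eq h hU)]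
      at this
  sigma x := by
    rw [sigmaMap_eq h hU, sigmaMap_eq h hU, degreeRotation_rho_degreeRotation]

theorem isGradedUnitaryVOA (h : IsSymplectic Ω) (hU : Ω ∈ Matrix.unitaryGroup ι ℂ) :
    IsGradedUnitaryVOA (mobius Ω) (omega Ω) (form Ω) z2 filtration (rho Ω) where
  isMobius := isMobius h
  z2_wt d := mem_iSup_inf_of_support
    (fun x hx u hu => monomial_mem_wt u 1 (hx hu)) fun u => ⟨_, monomial_mem_z2 u⟩
  invariant := isInvariantForm h
  form_nondegenerate := nondegenerateOn_form h hU fun _ _ => Submodule.mem_top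
  filtration := isHalfIntegralFiltration Ω
  filtration_nondegenerate := isNondegenerateFiltration h hU
  filtration_good r t x hx y hy n hn := mode_mem_filtration_of_le Ω hx hy n (Or.inr ⟨hn, rfl⟩)
  quaternionic := isQuaternionicStructure h hU
  hermitian x y := by
    rw [sigmaMap_eq h hU, sigmaMap_eq h hU]
    exact form_degreeRotation_rho_conj h x y
  positive x hx := by
    rw [sigmaMap_eq h hU]
    exact form_degreeRotation_rho_self_pos h hx
  isVOA := isVOA h
  conj_conformal := rho_omega h hU

theorem isSymplectic_toMatrix {V : Type*} [AddCommGroup V] [Module ℂ V]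
    {Ω : LinearMap.BilinForm ℂ V} (hAlt : Ω.IsAlt) (e : Module.Basis ι ℂ V)
    (hU : LinearMap.BilinForm.toMatrix e Ω ∈ Matrix.unitaryGroup ι ℂ) :
    IsSymplectic (LinearMap.BilinForm.toMatrix e Ω) where
  transpose := by
    ext i j
    simp [LinearMap.BilinForm.toMatrix_apply, hAlt.neg_eq]
  isUnit := Matrix.isUnit_det_of_right_inverse (Matrix.mem_unitaryGroup_iff.1 hU)

end Sb

end

theorem proposition2p16 {V : Type*} [AddCommGroup V] [Module ℂ V] [FiniteDimensional ℂ V]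
    (Ω : LinearMap.BilinForm ℂ V) (hAlt : Ω.IsAlt) (hNondeg : Ω.Nondegenerate) :
    (∃ e : Module.Basis (Fin (Module.finrank ℂ V)) ℂ V,
      LinearMap.BilinForm.toMatrix e Ω ∈ Matrix.unitaryGroup (Fin (Module.finrank ℂ V)) ℂ) ∧
    ∀ {ι : Type*} [Fintype ι] [DecidableEq ι] (e : Module.Basis ι ℂ V),
      LinearMap.BilinForm.toMatrix e Ω ∈ Matrix.unitaryGroup ι ℂ →
      GradedUnitary.IsGradedUnitaryVOA
        (Sb.mobius (LinearMap.BilinForm.toMatrix e Ω))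
        (Sb.omega (LinearMap.BilinForm.toMatrix e Ω))
        (Sb.form (LinearMap.BilinForm.toMatrix e Ω))
        Sb.z2 Sb.filtration
        (Sb.rho (LinearMap.BilinForm.toMatrix e Ω)) := by
  refine ⟨Ω.exists_basis_fin_toMatrix_mem_unitaryGroup hAlt hNondeg, fun e hU => ?_⟩
  exact Sb.isGradedUnitaryVOA (Sb.isSymplectic_toMatrix hAlt e hU) hU
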